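/- Let $(X,d)$ be a finite metric space with $|X|=n>1$. In the metrical task systems (MTS) problem, cost functions $c_1,c_2,\dots : X\to\mathbb R_{\ge 0}$ arrive one at a time. A deterministic online algorithm with initial state $\rho_0\in X$ chooses, for each $t\ge 1$, a state $\rho_t=\rho_t(c_1,\dots,c_t)\in X$. Its service cost is $\mathsf{serv}=\sum_{t\ge1}c_t(\rho_t)$, its movement cost is $\mathsf{move}=\sum_{t\ge1}d(\rho_{t-1},\rho_t)$, and its cost is $\mathsf{serv}+\mathsf{move}$ (all values in $[0,\infty]$). A randomized online algorithm is, for each $\rho_0$, a random deterministic online algorithm with initial state $\rho_0$. Let $\mathsf{cost}^*(\mathbf c)$ be the infimum of $\sum_{t\ge1}[c_t(\rho_t)+d(\rho_{t-1},\rho_t)]$ over all sequences of states starting at $\rho_0$. A randomized online algorithm is $\alpha$-competitive if for every $\rho_0$ there is $\beta>0$ such that $\mathbb E[\mathsf{cost}]\le\alpha\,\mathsf{cost}^*(\mathbf c)+\beta$ for all cost sequences $\mathbf c$. It is $\alpha$-competitive for service costs and $\alpha'$-competitive for movement costs if for every $\rho_0$ there is $\beta>0$ such that $\mathbb E[\mathsf{serv}]\le\alpha\,\mathsf{cost}^*(\mathbf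 c)+\beta$ and $\mathbb E[\mathsf{move}]\le\alpha'\,\mathsf{cost}^*(\mathbf c)+\beta$ for all $\mathbf c$. A marked DAG over $X$ consists of a finite directed acyclic graph $(V,A)$ with a single source $r$ whose set of sinks is $X$, arc lengths $\omega_{uv}>0$ with $\omega_{uv}>\omega_{vw}$ whenever $uv,vw\in A$, and numbers $\theta_{uv}>0$ $(uv\in A)$ with $\sum_{v:uv\in A}\theta_{uv}=1$ for every $u\in V\setminus X$. Put $\eta_{uv}=1+\log(1/\theta_{uv})$ and $\delta_{uv}=\theta_{uv}/\eta_{uv}$. Let $\mathcal Q$ be the set of all $q\in\mathbb R_{\ge0}^A$ with $\sum_{v:uv\in A}q_{uv}=1$ for all $u\in V\setminus X$, and write $q^{(u)}=(q_{uv})_{v:uv\in A}$. Each $q\in\mathcal Q$ induces the unit flow $F$ with $F_r=1$, $F_{uv}=F_uq_{uv}$ for $uv\in A$, and $F_v=\sum_{u:uv\in A}F_{uv}$ for $v\ne r$; its restriction $(F_x)_{x\in X}$ is a probability distribution $\Lambda(q)$ on $X$. For $\kappa>0$ and $u\in V\setminus X$, let $$\Phi^{(u)}(p)=\frac1\kappa\sum_{v:uv\in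 A}\frac{\omega_{uv}}{\eta_{uv}}(p_v+\delta_{uv})\log(p_v+\delta_{uv}),$$ and let $D^{(u)}(p\,\|\,q)=\Phi^{(u)}(p)-\Phi^{(u)}(q)-\langle\nabla\Phi^{(u)}(q),p-q\rangle$ be its Bregman divergence. (The multiscale entropy of a flow $F$ is $\sum_{u\in V\setminus X}F_u\,\Phi^{(u)}\big((F_{uv}/F_u)_v\big)$.) For $q\in\mathcal Q$ and $c\in\mathbb R_{\ge0}^X$, the mirror descent step $\mathcal A(q,c)=p\in\mathcal Q$ is defined, proceeding from the sinks to the source, by $\hat c_x=c_x$ for $x\in X$ and, for $u\in V\setminus X$, $$p^{(u)}=\operatorname{argmin}\Big\{D^{(u)}(p'\,\|\,q^{(u)})+\sum_{v:uv\in A}p'_v\,\hat c_v\Big\},\qquad \hat c_u=\sum_{v:uv\in A}p_{uv}\,\hat c_v,$$ where $p'$ ranges over the probability vectors on $\{v:uv\in A\}$. Given $p_0\in\mathcal Q$ and a function $N:\mathbb R_{\ge 0}^X\to\mathbb N$ (the number of pieces into which a cost function is split), the mirror descent trajectory is the sequence in which $p_t$ is obtained from $p_{t-1}$ by applying the step $\mathcal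 A(\cdot,c_t/N(c_t))$ exactly $N(c_t)$ times. **Theorem.** There is a universal constant $C>0$ such that for every $n$-point metric space $(X,d)$ with $n>1$ there are a marked DAG over $X$, a $\kappa>0$ and an $\varepsilon>0$ with the following property. For every $p_0\in\mathcal Q$ and every $N$ with $\|c\|_\infty\le\varepsilon N(c)$ for all $c\in\mathbb R_{\ge0}^X$, there is a randomized online algorithm for MTS on $(X,d)$ whose state $\rho_t$ has, for all $t\ge1$, all $\rho_0$ and all $c_1,\dots,c_t$, the law $\Lambda(p_t)$ given by the mirror descent trajectory, and this algorithm is $C(\log n)^2$-competitive, and moreover $1$-competitive for service costs and $C(\log n)^2$-competitive for movement costs. -/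

import Mathlib

open scoped NNReal ENNReal MeasureTheory

universe u

noncomputable section

/-! ## Metrical task systems -/

/-- A deterministic online algorithm: after the costs `c₁, …, c_t` have been revealed, it occupies
a state that depends on these costs only.  For `t = 0` this is its initial state. -/
abbrev OnlineAlgorithm (X : Type u) : Type u :=
  (t : ℕ) → (Fin t → X → ℝ≥0) → X

/-- The first `t` members of a cost sequence (`c t` is the cost function that arrives at
time `t + 1`). -/
def costHistory {X : Type u} (c : ℕ → X → ℝ≥0) (t : ℕ) : Fin t → X → ℝ≥0 :=
  fun i => c i

/-- Total service cost of an online algorithm on a cost sequence. -/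
def OnlineAlgorithm.serv {X : Type u} (A : OnlineAlgorithm X) (c : ℕ → X → ℝ≥0) : ℝ≥0∞ :=
  ∑' t : ℕ, (c t (A (t + 1) (costHistory c (t + 1))) : ℝ≥0∞)

/-- Total movement cost of an online algorithm on a cost sequence. -/
def OnlineAlgorithm.move {X : Type u} [MetricSpace X] (A : OnlineAlgorithm X)
    (c : ℕ → X → ℝ≥0) : ℝ≥0∞ :=
  ∑' t : ℕ, edist (A t (costHistory c t)) (A (t + 1) (costHistory c (t + 1)))

/-- Total cost of an online algorithm on a cost sequence. -/
def OnlineAlgorithm.cost {X : Type u} [MetricSpace X] (A : OnlineAlgorithm X)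
    (c : ℕ → X → ℝ≥0) : ℝ≥0∞ :=
  A.serv c + A.move c

/-- The offline optimum: the infimum of the total cost over all sequences of states that start
at `x₀`. -/
def offlineCost {X : Type u} [MetricSpace X] (x₀ : X) (c : ℕ → X → ℝ≥0) : ℝ≥0∞ :=
  ⨅ (r : ℕ → X) (_ : r 0 = x₀), ∑' t : ℕ, ((c t (r (t + 1)) : ℝ≥0∞) + edist (r t) (r (t + 1)))

/-- A randomized online algorithm: for every initial state `x₀`, a random deterministic online
algorithm that starts at `x₀`. -/
structure RandomizedAlgorithm (X : Type u) where
  Ω : Type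
  [mΩ : MeasurableSpace Ω]
  prob : MeasureTheory.Measure Ω
  [isProb : MeasureTheory.IsProbabilityMeasure prob]
  alg : X → Ω → OnlineAlgorithm X
  alg_zero : ∀ (x₀ : X) (s : Ω) (h : Fin 0 → X → ℝ≥0), alg x₀ s 0 h = x₀
  measurable_alg : ∀ (x₀ : X) (t : ℕ) (h : Fin t → X → ℝ≥0) (x : X),
    MeasurableSet {s : Ω | alg x₀ s t h = x}

attribute [instance] RandomizedAlgorithm.mΩ RandomizedAlgorithm.isProb

namespace RandomizedAlgorithm

variable {X : Type u} [MetricSpace X]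

/-- `R` is `α`-competitive. -/
def IsCompetitive (R : RandomizedAlgorithm X) (α : ℝ) : Prop :=
  ∀ x₀ : X, ∃ β : ℝ, 0 < β ∧ ∀ c : ℕ → X → ℝ≥0,
    ∫⁻ s, (R.alg x₀ s).cost c ∂(R.prob)
      ≤ ENNReal.ofReal α * offlineCost x₀ c + ENNReal.ofReal β

/-- `R` is `α`-competitive for service costs and `α'`-competitive for movement costs. -/
def IsRefinedCompetitive (R : RandomizedAlgorithm X) (α α' : ℝ) : Prop :=
  ∀ x₀ : X, ∃ β : ℝ, 0 < β ∧ ∀ c : ℕ → X → ℝ≥0,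
    ∫⁻ s, (R.alg x₀ s).serv c ∂(R.prob)
        ≤ ENNReal.ofReal α * offlineCost x₀ c + ENNReal.ofReal β ∧
      ∫⁻ s, (R.alg x₀ s).move c ∂(R.prob)
        ≤ ENNReal.ofReal α' * offlineCost x₀ c + ENNReal.ofReal β

end RandomizedAlgorithm

/-! ## Marked flow DAGs -/

/-- A directed acyclic graph over `X`: it has a single source, and its sinks are exactly the points
of `X` (through the injection `sink`). -/
structure FlowDAG (X : Type u) where
  V : Type u
  [fintypeV : Fintype V]
  /-- `Adj a b` says that there is an arc from `a` to `b`. -/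
  Adj : V → V → Prop
  acyclic : ∀ v : V, ¬ Relation.TransGen Adj v v
  root : V
  source_iff : ∀ v : V, (∀ a : V, ¬ Adj a v) ↔ v = root
  sink : X ↪ V
  sink_iff : ∀ v : V, (∀ b : V, ¬ Adj v b) ↔ ∃ x : X, sink x = v

attribute [instance] FlowDAG.fintypeV

namespace FlowDAG

variable {X : Type u} (D : FlowDAG X)

open scoped Classical in
/-- The endpoints of the arcs leaving `a`. -/
def out (a : D.V) : Finset D.V := Finset.univ.filter fun b => D.Adj a b

theorem mem_out {a b : D.V} : b ∈ D.out a ↔ D.Adj a b := by simp [out]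

theorem wellFounded_adj : WellFounded D.Adj := by
  have : IsTrans D.V (Relation.TransGen D.Adj) := ⟨fun _ _ _ h h' => h.trans h'⟩
  have : Std.Irrefl (Relation.TransGen D.Adj) := ⟨D.acyclic⟩
  exact Subrelation.wf (fun h => Relation.TransGen.single h)
    (Finite.wellFounded_of_trans_of_irrefl (Relation.TransGen D.Adj))

theorem wellFounded_adj_swap : WellFounded (fun b a : D.V => D.Adj a b) := by
  have : IsTrans D.V (fun b a => Relation.TransGen D.Adj a b) := ⟨fun _ _ _ h h' => h'.trans h⟩
  have : Std.Irrefl (fun b a => Relation.TransGen D.Adj a b) := ⟨D.acyclic⟩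
  exact Subrelation.wf (fun h => Relation.TransGen.single h)
    (Finite.wellFounded_of_trans_of_irrefl (fun b a => Relation.TransGen D.Adj a b))

theorem out_nonempty_iff (a : D.V) : (D.out a).Nonempty ↔ ¬ ∃ x : X, D.sink x = a := by
  rw [← D.sink_iff a]
  push Not
  exact exists_congr fun b => D.mem_out

/-- The probability vectors on the arcs that leave `a`, as vectors indexed by all vertices that
vanish where there is no arc. -/
def localSimplex (a : D.V) : Set (D.V → ℝ) :=
  {p | p ∈ stdSimplex ℝ D.V ∧ ∀ b, ¬ D.Adj a b → p b = 0}

/-- The set `Q` of transition matrices: nonnegative vectors on the arcs which, at each vertex that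
is not a sink, sum to `1` over the arcs leaving it. -/
def policies : Set (D.V → D.V → ℝ) :=
  {p | (∀ a b, 0 ≤ p a b) ∧ (∀ a b, ¬ D.Adj a b → p a b = 0) ∧
    ∀ a, (¬ ∃ x : X, D.sink x = a) → ∑ b ∈ D.out a, p a b = 1}

open scoped Classical in
/-- The flow `F_v` through each vertex `v` of the unit flow `F` with `F_{uv} = F_u q_{uv}` on every
arc `uv`: one at the root, and the flow into `v` at each other vertex. -/
def vertexFlow (q : D.V → D.V → ℝ) : D.V → ℝ :=
  D.wellFounded_adj.fix fun v flow =>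
    if v = D.root then 1
    else ∑ a : D.V, if h : D.Adj a v then flow a h * q a v else 0

open scoped Classical in
theorem vertexFlow_eq (q : D.V → D.V → ℝ) (v : D.V) :
    D.vertexFlow q v = if v = D.root then 1
      else ∑ a : D.V, if D.Adj a v then D.vertexFlow q a * q a v else 0 := by
  unfold vertexFlow
  rw [WellFounded.fix_eq]
  simp only [dite_eq_ite]

/-- The probability mass that the unit flow of `q` places at the point `x`. -/
def sinkMass (q : D.V → D.V → ℝ) (x : X) : ℝ := D.vertexFlow q (D.sink x)

end FlowDAG

/-- A marked DAG over `X`: positive arc lengths `ω` that decrease along paths, and positive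
transition probabilities `θ`.  Only the values at arcs matter. -/
structure MarkedDAG (X : Type u) extends FlowDAG X where
  ω : V → V → ℝ
  ω_pos : ∀ a b, Adj a b → 0 < ω a b
  ω_decreasing : ∀ a b e, Adj a b → Adj b e → ω b e < ω a b
  θ : V → V → ℝ
  θ_pos : ∀ a b, Adj a b → 0 < θ a b
  θ_sum : ∀ a, (¬ ∃ x : X, sink x = a) → ∑ b ∈ toFlowDAG.out a, θ a b = 1

/-! ## Mirror descent with the multiscale entropy -/

/-- The Bregman divergence of `Φ`. -/
def bregmanDivergence {E : Type u} [NormedAddCommGroup E] [NormedSpace ℝ E] (Φ : E → ℝ)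
    (p q : E) : ℝ :=
  Φ p - Φ q - fderiv ℝ Φ q (p - q)

namespace MarkedDAG

variable {X : Type u} (D : MarkedDAG X)

/-- `η_{ab} = 1 + log (1 / θ_{ab})`. -/
def η (a b : D.V) : ℝ := 1 + Real.log (1 / D.θ a b)

/-- `δ_{ab} = θ_{ab} / η_{ab}`. -/
def δ (a b : D.V) : ℝ := D.θ a b / D.η a b

theorem θ_le_one {a b : D.V} (h : D.Adj a b) : D.θ a b ≤ 1 := by
  have hs : ¬ ∃ x : X, D.sink x = a :=
    (D.out_nonempty_iff a).1 ⟨b, D.mem_out.2 h⟩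
  rw [← D.θ_sum a hs]
  exact Finset.single_le_sum (f := fun e => D.θ a e)
    (fun e he => (D.θ_pos a e (D.mem_out.1 he)).le) (D.mem_out.2 h)

theorem η_ge_one {a b : D.V} (h : D.Adj a b) : 1 ≤ D.η a b := by
  have := Real.log_nonneg ((one_le_div (D.θ_pos a b h)).2 (D.θ_le_one h))
  unfold η
  linarith

theorem δ_pos {a b : D.V} (h : D.Adj a b) : 0 < D.δ a b :=
  div_pos (D.θ_pos a b h) (lt_of_lt_of_le one_pos (D.η_ge_one h))

/-- The regularizer at the vertex `a`.  The multiscale entropy of a flow `F` is the sum, over the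
vertices `a` that are not sinks, of `F_a` times the value of this function at
`(F_{ab} / F_a)_b`. -/
def localEntropy (κ : ℝ) (a : D.V) (p : D.V → ℝ) : ℝ :=
  κ⁻¹ * ∑ b ∈ D.out a, D.ω a b / D.η a b * ((p b + D.δ a b) * Real.log (p b + D.δ a b))

/-- The function that one mirror descent step minimizes at the vertex `a`. -/
def localObjective (κ : ℝ) (a : D.V) (q : D.V → ℝ) (cHat : D.V → ℝ) (p : D.V → ℝ) : ℝ :=
  bregmanDivergence (D.localEntropy κ a) p q + ∑ b ∈ D.out a, p b * cHat b

theorem exists_isMinOn_localObjective (κ : ℝ) (a : D.V) (q cHat : D.V → ℝ)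
    (h : (D.out a).Nonempty) :
    ∃ p ∈ D.localSimplex a, IsMinOn (D.localObjective κ a q cHat) (D.localSimplex a) p := by
  classical
  have hc : IsCompact (D.localSimplex a) := by
    have h2 : IsClosed {p : D.V → ℝ | ∀ b, ¬ D.Adj a b → p b = 0} := by
      simp only [Set.ofPred_forall]
      exact isClosed_iInter fun b => isClosed_iInter fun _ =>
        isClosed_eq (continuous_apply b) continuous_const
    exact (isCompact_stdSimplex ℝ D.V).inter_right h2
  have hne : (D.localSimplex a).Nonempty := by
    obtain ⟨b, hb⟩ := h
    refine ⟨Pi.single b 1, single_mem_stdSimplex ℝ b, fun e he => ?_⟩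
    refine Pi.single_eq_of_ne ?_ _
    rintro rfl
    exact he (D.mem_out.1 hb)
  refine hc.exists_isMinOn hne ?_
  have hΦ : ContinuousOn (D.localEntropy κ a) (D.localSimplex a) := by
    unfold localEntropy
    refine continuousOn_const.mul (continuousOn_finsetSum _ fun b hb => ?_)
    have hadd : ContinuousOn (fun p : D.V → ℝ => p b + D.δ a b) (D.localSimplex a) := by
      fun_prop
    refine continuousOn_const.mul (hadd.mul (hadd.log fun p hp => ?_))
    have h1 : 0 ≤ p b := hp.1.1 b
    have h2 := D.δ_pos (D.mem_out.1 hb)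
    positivity
  unfold localObjective bregmanDivergence
  refine ((hΦ.sub continuousOn_const).sub ?_).add ?_
  · exact ((fderiv ℝ (D.localEntropy κ a) q).continuous.comp
      (continuous_id.sub continuous_const)).continuousOn
  · fun_prop

open scoped Classical in
/-- The minimizer of the local objective (zero at a sink, which no arc leaves). -/
def localStep (κ : ℝ) (a : D.V) (q : D.V → ℝ) (cHat : D.V → ℝ) : D.V → ℝ :=
  if h : (D.out a).Nonempty then (D.exists_isMinOn_localObjective κ a q cHat h).choose else 0

open scoped Classical in
/-- The costs `ĉ_v`: at a sink the given cost, and at any other vertex the average of the costs of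
its children under the updated transition probabilities. -/
def cHat (κ : ℝ) (c : X → ℝ) (q : D.V → D.V → ℝ) : D.V → ℝ :=
  D.wellFounded_adj_swap.fix fun a rec =>
    if h : ∃ x : X, D.sink x = a then c h.choose
    else
      let r : D.V → ℝ := fun b => if hb : D.Adj a b then rec b hb else 0
      ∑ b ∈ D.out a, D.localStep κ a (q a) r b * r b

open scoped Classical in
/-- One step of mirror descent from `q` in response to the cost `c`. -/
def mirrorStep (κ : ℝ) (c : X → ℝ) (q : D.V → D.V → ℝ) : D.V → D.V → ℝ :=
  fun a => D.localStep κ a (q a) fun b => if D.Adj a b then D.cHat κ c q b else 0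

theorem cHat_sink (κ : ℝ) (c : X → ℝ) (q : D.V → D.V → ℝ) (x : X) :
    D.cHat κ c q (D.sink x) = c x := by
  have h : ∃ y : X, D.sink y = D.sink x := ⟨x, rfl⟩
  unfold cHat
  rw [WellFounded.fix_eq, dif_pos h, D.sink.injective h.choose_spec]

theorem cHat_of_not_sink (κ : ℝ) (c : X → ℝ) (q : D.V → D.V → ℝ) (a : D.V)
    (h : ¬ ∃ x : X, D.sink x = a) :
    D.cHat κ c q a = ∑ b ∈ D.out a, D.mirrorStep κ c q a b * D.cHat κ c q b := by
  conv_lhs => unfold cHat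
  rw [WellFounded.fix_eq, dif_neg h]
  refine Finset.sum_congr rfl fun b hb => ?_
  have hb' := D.mem_out.1 hb
  simp only [hb', dif_pos, dite_eq_ite]
  rfl

theorem mirrorStep_spec (κ : ℝ) (c : X → ℝ) (q : D.V → D.V → ℝ) (a : D.V)
    (h : ¬ ∃ x : X, D.sink x = a) :
    D.mirrorStep κ c q a ∈ D.localSimplex a ∧
      IsMinOn (D.localObjective κ a (q a) (D.cHat κ c q)) (D.localSimplex a)
        (D.mirrorStep κ c q a) := by
  classical
  have hne := (D.out_nonempty_iff a).2 h
  have hobj : D.localObjective κ a (q a) (D.cHat κ c q) =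
      D.localObjective κ a (q a) (fun b => if D.Adj a b then D.cHat κ c q b else 0) := by
    funext p
    unfold localObjective
    congr 1
    refine Finset.sum_congr rfl fun b hb => ?_
    simp only [if_pos (D.mem_out.1 hb)]
  rw [hobj]
  unfold mirrorStep localStep
  rw [dif_pos hne]
  exact (D.exists_isMinOn_localObjective κ a (q a) _ hne).choose_spec

/-- The mirror descent trajectory from `p₀`.  A cost function `c` is served by splitting it into
`N c` equal pieces and making one mirror descent step for each piece. -/
def mirrorDescent (κ : ℝ) (N : (X → ℝ≥0) → ℕ) (p₀ : D.V → D.V → ℝ) :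
    (t : ℕ) → (Fin t → X → ℝ≥0) → D.V → D.V → ℝ
  | 0, _ => p₀
  | t + 1, h =>
    (D.mirrorStep κ fun x => (h (Fin.last t) x : ℝ) / N (h (Fin.last t)))^[N (h (Fin.last t))]
      (mirrorDescent κ N p₀ t fun i => h i.castSucc)

/-- At every time `t ≥ 1`, the state of `R` is distributed according to the flow into the sinks
of the mirror descent trajectory. -/
def IsPlayedBy (R : RandomizedAlgorithm X) (κ : ℝ) (N : (X → ℝ≥0) → ℕ)
    (p₀ : D.V → D.V → ℝ) : Prop :=
  ∀ (x₀ : X) (t : ℕ), 1 ≤ t → ∀ (h : Fin t → X → ℝ≥0) (x : X),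
    R.prob {s | R.alg x₀ s t h = x} =
      ENNReal.ofReal (D.sinkMass (D.mirrorDescent κ N p₀ t h) x)

end MarkedDAG

end

noncomputable section

namespace FlowDAG

variable {X : Type u} (D : FlowDAG X)

open scoped Classical in
/-- The vertices that are not sinks. -/
def inner : Finset D.V := Finset.univ.filter fun a => ¬ ∃ x : X, D.sink x = a

theorem mem_inner {a : D.V} : a ∈ D.inner ↔ ¬ ∃ x : X, D.sink x = a := by simp [inner]

theorem out_sink (x : X) : D.out (D.sink x) = ∅ := by
  rw [← Finset.not_nonempty_iff_eq_empty, D.out_nonempty_iff]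
  simp

theorem not_adj_root (a : D.V) : ¬ D.Adj a D.root := (D.source_iff D.root).2 rfl a

open scoped Classical in
theorem vertexFlow_eq_add (q : D.V → D.V → ℝ) (v : D.V) :
    D.vertexFlow q v = (if v = D.root then 1 else 0) +
      ∑ a : D.V, if D.Adj a v then D.vertexFlow q a * q a v else 0 := by
  rw [vertexFlow_eq]
  split_ifs with h
  · subst h
    simp [D.not_adj_root]
  · simp

theorem vertexFlow_nonneg {q : D.V → D.V → ℝ} (hq : q ∈ D.policies) (v : D.V) :
    0 ≤ D.vertexFlow q v := by
  classical
  induction v using D.wellFounded_adj.induction with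
  | _ v ih =>
    rw [vertexFlow_eq]
    split_ifs
    · exact zero_le_one
    · refine Finset.sum_nonneg fun a _ => ?_
      split_ifs with h
      · exact mul_nonneg (ih a h) (hq.1 a v)
      · exact le_rfl

theorem sum_sum_adj (f : D.V → D.V → ℝ) :
    (∑ v, ∑ a, (open scoped Classical in if D.Adj a v then f a v else 0)) =
      ∑ a, ∑ b ∈ D.out a, f a b := by
  classical
  rw [Finset.sum_comm]
  refine Finset.sum_congr rfl fun a _ => ?_
  rw [out, Finset.sum_filter]

theorem sum_vertexFlow_mul (q : D.V → D.V → ℝ) (φ : D.V → ℝ) :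
    ∑ v, D.vertexFlow q v * φ v =
      φ D.root + ∑ a, D.vertexFlow q a * ∑ b ∈ D.out a, q a b * φ b := by
  classical
  have h1 : ∀ v, D.vertexFlow q v * φ v = (if v = D.root then φ v else 0) +
      ∑ a : D.V, if D.Adj a v then D.vertexFlow q a * (q a v * φ v) else 0 := by
    intro v
    rw [vertexFlow_eq_add, add_mul, Finset.sum_mul]
    congr 1
    · split_ifs <;> simp
    · refine Finset.sum_congr rfl fun a _ => ?_
      split_ifs <;> ring
  rw [Finset.sum_congr rfl fun v _ => h1 v, Finset.sum_add_distrib, sum_sum_adj]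
  simp [Finset.mul_sum]

theorem sinkMass_nonneg {q : D.V → D.V → ℝ} (hq : q ∈ D.policies) (x : X) :
    0 ≤ D.sinkMass q x := D.vertexFlow_nonneg hq _

section

variable [Fintype X]

theorem sum_eq_sum_sink_add_sum_inner (f : D.V → ℝ) :
    ∑ v, f v = ∑ x, f (D.sink x) + ∑ a ∈ D.inner, f a := by
  classical
  rw [inner, ← Finset.sum_filter_add_sum_filter_not Finset.univ (fun a => ∃ x : X, D.sink x = a)]
  congr 1
  · have : (Finset.univ.filter fun a => ∃ x : X, D.sink x = a) = Finset.univ.map D.sink := by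
      ext a; simp
    rw [this, Finset.sum_map]
  · exact Finset.sum_congr (by ext; simp) fun _ _ => rfl

/-- Conservation of flow, tested against a function on the vertices. -/
theorem sum_sinkMass_add_sum_inner (q : D.V → D.V → ℝ) (φ : D.V → ℝ) :
    ∑ x, D.sinkMass q x * φ (D.sink x) +
      ∑ a ∈ D.inner, D.vertexFlow q a * (φ a - ∑ b ∈ D.out a, q a b * φ b) = φ D.root := by
  have h := D.sum_vertexFlow_mul q φ
  rw [D.sum_eq_sum_sink_add_sum_inner, D.sum_eq_sum_sink_add_sum_inner
    (fun a => D.vertexFlow q a * ∑ b ∈ D.out a, q a b * φ b)] at h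
  simp only [out_sink, Finset.sum_empty, mul_zero, Finset.sum_const_zero, zero_add] at h
  simp only [mul_sub, Finset.sum_sub_distrib, sinkMass]
  linarith

theorem sum_sinkMass {q : D.V → D.V → ℝ} (hq : q ∈ D.policies) : ∑ x, D.sinkMass q x = 1 := by
  have h := D.sum_sinkMass_add_sum_inner q (fun _ => 1)
  rw [Finset.sum_eq_zero (s := D.inner)] at h
  · simpa using h
  · intro a ha
    have := hq.2.2 a (D.mem_inner.1 ha)
    simp [this]

end

open scoped Classical in
/-- The expected value of `f` at the sink that is reached from a vertex under `q`. -/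
def value (q : D.V → D.V → ℝ) (f : X → ℝ) : D.V → ℝ :=
  D.wellFounded_adj_swap.fix fun a rec =>
    if h : ∃ x : X, D.sink x = a then f h.choose
    else ∑ b, if hb : D.Adj a b then q a b * rec b hb else 0

theorem value_sink (q : D.V → D.V → ℝ) (f : X → ℝ) (x : X) :
    D.value q f (D.sink x) = f x := by
  have h : ∃ y : X, D.sink y = D.sink x := ⟨x, rfl⟩
  unfold value
  rw [WellFounded.fix_eq, dif_pos h, D.sink.injective h.choose_spec]

theorem value_inner (q : D.V → D.V → ℝ) (f : X → ℝ) {a : D.V} (h : a ∈ D.inner) :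
    D.value q f a = ∑ b ∈ D.out a, q a b * D.value q f b := by
  classical
  conv_lhs => unfold value
  rw [WellFounded.fix_eq, dif_neg (D.mem_inner.1 h), out, Finset.sum_filter]
  refine Finset.sum_congr rfl fun b hb => ?_
  simp only [dite_eq_ite]
  rfl

theorem sum_sinkMass_mul [Fintype X] (q : D.V → D.V → ℝ) (f : X → ℝ) :
    ∑ x, D.sinkMass q x * f x = D.value q f D.root := by
  have h := D.sum_sinkMass_add_sum_inner q (D.value q f)
  rw [Finset.sum_eq_zero (s := D.inner)] at h
  · simpa [value_sink] using h
  · intro a ha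
    rw [← D.value_inner q f ha, sub_self, mul_zero]

/-- Induction from the sinks towards the root. -/
theorem sink_induction {P : D.V → Prop} (hsink : ∀ x, P (D.sink x))
    (hinner : ∀ a ∈ D.inner, (∀ b ∈ D.out a, P b) → P a) (v : D.V) : P v := by
  induction v using D.wellFounded_adj_swap.induction with
  | _ v ih =>
    by_cases h : ∃ x : X, D.sink x = v
    · obtain ⟨x, rfl⟩ := h
      exact hsink x
    · exact hinner v (D.mem_inner.2 h) fun b hb => ih b (D.mem_out.1 hb)

end FlowDAG

namespace MarkedDAG

variable {X : Type u} (D : MarkedDAG X)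

/-- The amount of flow that has to be rerouted, weighted by arc lengths, when the policy `q` is
replaced by the policy `p`. -/
def shift (q p : D.V → D.V → ℝ) : ℝ :=
  ∑ a, D.vertexFlow q a * ∑ b ∈ D.out a, D.ω a b * |p a b - q a b|

theorem sum_weight_mul_abs_vertexFlow_sub_le {q p : D.V → D.V → ℝ} (hq : q ∈ D.policies)
    (hp : p ∈ D.policies) {W : D.V → ℝ} {τ : ℝ} (hτ : 0 ≤ τ) (hW : ∀ a, 0 ≤ W a)
    (hωW : ∀ a b, D.Adj a b → D.ω a b ≤ W a) (hWω : ∀ a b, D.Adj a b → τ * W b ≤ D.ω a b) :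
    (τ - 1) * ∑ v, W v * |D.vertexFlow p v - D.vertexFlow q v| ≤ D.shift q p := by
  classical
  set F := D.vertexFlow q
  set F' := D.vertexFlow p
  have h1 : ∀ v, |F' v - F v| ≤ ∑ a, if D.Adj a v then
      (F a * |p a v - q a v| + |F' a - F a| * p a v) else 0 := by
    intro v
    have : F' v - F v = ∑ a, if D.Adj a v then F' a * p a v - F a * q a v else 0 := by
      simp only [F', F]
      rw [D.vertexFlow_eq_add p, D.vertexFlow_eq_add q, add_sub_add_left_eq_sub,
        ← Finset.sum_sub_distrib]
      refine Finset.sum_congr rfl fun a _ => ?_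
      split_ifs <;> simp
    rw [this]
    refine (Finset.abs_sum_le_sum_abs _ _).trans (Finset.sum_le_sum fun a _ => ?_)
    split_ifs with h
    · have e : F' a * p a v - F a * q a v = F a * (p a v - q a v) + (F' a - F a) * p a v := by ring
      rw [e]
      refine (abs_add_le _ _).trans ?_
      rw [abs_mul, abs_mul, abs_of_nonneg (D.vertexFlow_nonneg hq a), abs_of_nonneg (hp.1 a v)]
    · simp
  have h2 : τ * ∑ v, W v * |F' v - F v| ≤
      ∑ a, ∑ b ∈ D.out a, D.ω a b * (F a * |p a b - q a b| + |F' a - F a| * p a b) := by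
    rw [← D.sum_sum_adj, Finset.mul_sum]
    refine Finset.sum_le_sum fun v _ => ?_
    calc τ * (W v * |F' v - F v|) ≤ τ * (W v * ∑ a, if D.Adj a v then
      (F a * |p a v - q a v| + |F' a - F a| * p a v) else 0) :=
          mul_le_mul_of_nonneg_left (mul_le_mul_of_nonneg_left (h1 v) (hW v)) hτ
      _ = ∑ a, if D.Adj a v then (τ * W v) * (F a * |p a v - q a v| + |F' a - F a| * p a v) else 0 := by
        rw [← mul_assoc, Finset.mul_sum]
        refine Finset.sum_congr rfl fun a _ => ?_
        split_ifs <;> simp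
      _ ≤ _ := by
        refine Finset.sum_le_sum fun a _ => ?_
        split_ifs with h
        · refine mul_le_mul_of_nonneg_right (hWω a v h) (add_nonneg ?_ ?_)
          · exact mul_nonneg (D.vertexFlow_nonneg hq a) (abs_nonneg _)
          · exact mul_nonneg (abs_nonneg _) (hp.1 a v)
        · exact le_rfl
  have h3 : ∑ a, ∑ b ∈ D.out a, D.ω a b * (F a * |p a b - q a b| + |F' a - F a| * p a b) ≤
      D.shift q p + ∑ a, W a * |F' a - F a| := by
    rw [shift, ← Finset.sum_add_distrib]
    refine Finset.sum_le_sum fun a _ => ?_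
    have : ∑ b ∈ D.out a, D.ω a b * (F a * |p a b - q a b| + |F' a - F a| * p a b) =
        F a * ∑ b ∈ D.out a, D.ω a b * |p a b - q a b| +
          |F' a - F a| * ∑ b ∈ D.out a, D.ω a b * p a b := by
      rw [Finset.mul_sum, Finset.mul_sum, ← Finset.sum_add_distrib]
      exact Finset.sum_congr rfl fun b _ => by ring
    rw [this, mul_comm (W a)]
    refine add_le_add le_rfl (mul_le_mul_of_nonneg_left ?_ (abs_nonneg _))
    by_cases ha : a ∈ D.inner
    · calc ∑ b ∈ D.out a, D.ω a b * p a b ≤ ∑ b ∈ D.out a, W a * p a b :=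
            Finset.sum_le_sum fun b hb =>
              mul_le_mul_of_nonneg_right (hωW a b (D.mem_out.1 hb)) (hp.1 a b)
        _ = W a := by rw [← Finset.mul_sum, hp.2.2 a (D.mem_inner.1 ha), mul_one]
    · have : D.out a = ∅ := by
        rw [D.mem_inner, not_not] at ha
        obtain ⟨x, rfl⟩ := ha
        exact D.out_sink x
      simp [this, hW a]
  linarith

end MarkedDAG

theorem sub_le_mul_log_sub_log {x y : ℝ} (hx : 0 < x) (hy : 0 < y) :
    x - y ≤ x * (Real.log x - Real.log y) := by
  have h := Real.log_le_sub_one_of_pos (div_pos hy hx)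
  rw [Real.log_div hy.ne' hx.ne'] at h
  have h2 := mul_le_mul_of_nonneg_left h hx.le
  have h3 : x * (y / x - 1) = y - x := by field_simp
  rw [h3] at h2
  linarith

namespace FlowDAG

variable {X : Type u} (D : FlowDAG X)

theorem sum_out_of_mem_localSimplex {a : D.V} {p : D.V → ℝ} (hp : p ∈ D.localSimplex a) :
    ∑ b ∈ D.out a, p b = 1 := by
  rw [← hp.1.2]
  refine Finset.sum_subset (Finset.subset_univ _) fun b _ hb => hp.2 b fun h => hb (D.mem_out.2 h)

theorem le_one_of_mem_localSimplex {a : D.V} {p : D.V → ℝ} (hp : p ∈ D.localSimplex a) (b : D.V) :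
    p b ≤ 1 := by
  rw [← hp.1.2]
  exact Finset.single_le_sum (f := p) (fun e _ => hp.1.1 e) (Finset.mem_univ b)

theorem mem_localSimplex_of_mem_policies {q : D.V → D.V → ℝ} (hq : q ∈ D.policies) {a : D.V}
    (ha : a ∈ D.inner) : q a ∈ D.localSimplex a := by
  refine ⟨⟨hq.1 a, ?_⟩, hq.2.1 a⟩
  rw [← hq.2.2 a (D.mem_inner.1 ha)]
  refine (Finset.sum_subset (Finset.subset_univ _) fun b _ hb => ?_).symm
  exact hq.2.1 a b fun h => hb (D.mem_out.2 h)

open scoped Classical in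
theorem single_mem_localSimplex {a b : D.V} (h : D.Adj a b) :
    Pi.single b (1 : ℝ) ∈ D.localSimplex a := by
  refine ⟨single_mem_stdSimplex ℝ b, fun e he => Pi.single_eq_of_ne ?_ _⟩
  rintro rfl
  exact he h

end FlowDAG

namespace MarkedDAG

variable {X : Type u} (D : MarkedDAG X)

theorem η_pos {a b : D.V} (h : D.Adj a b) : 0 < D.η a b := one_pos.trans_le (D.η_ge_one h)

theorem δ_mul_η {a b : D.V} (h : D.Adj a b) : D.δ a b * D.η a b = D.θ a b :=
  div_mul_cancel₀ _ (D.η_pos h).ne'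

theorem δ_le_one {a b : D.V} (h : D.Adj a b) : D.δ a b ≤ 1 :=
  (div_le_one (D.η_pos h)).2 ((D.θ_le_one h).trans (D.η_ge_one h))

/-- The Bregman divergence of the regularizer at the vertex `a`. -/
def localDiv (κ : ℝ) (a : D.V) (p q : D.V → ℝ) : ℝ :=
  ∑ b ∈ D.out a, κ⁻¹ * (D.ω a b / D.η a b) *
    ((p b + D.δ a b) * (Real.log (p b + D.δ a b) - Real.log (q b + D.δ a b)) - (p b - q b))

/-- The difference of the gradients of the regularizer at the vertex `a`. -/
def localGradSub (κ : ℝ) (a : D.V) (p q : D.V → ℝ) (b : D.V) : ℝ :=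
  κ⁻¹ * (D.ω a b / D.η a b) * (Real.log (p b + D.δ a b) - Real.log (q b + D.δ a b))

theorem hasFDerivAt_localEntropy (κ : ℝ) {a : D.V} {q : D.V → ℝ}
    (hq : ∀ b ∈ D.out a, 0 ≤ q b) :
    HasFDerivAt (D.localEntropy κ a) (κ⁻¹ • ∑ b ∈ D.out a, (D.ω a b / D.η a b) •
      (Real.log (q b + D.δ a b) + 1) • ContinuousLinearMap.proj (R := ℝ) (φ := fun _ : D.V => ℝ) b)
      q := by
  unfold localEntropy
  refine HasFDerivAt.const_mul (HasFDerivAt.fun_sum fun b hb => HasFDerivAt.const_mul ?_ _) _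
  have h1 : HasFDerivAt (fun p : D.V → ℝ => p b + D.δ a b)
      (ContinuousLinearMap.proj (R := ℝ) (φ := fun _ : D.V => ℝ) b) q :=
    ((ContinuousLinearMap.proj (R := ℝ) (φ := fun _ : D.V => ℝ) b).hasFDerivAt).add_const _
  have hpos : q b + D.δ a b ≠ 0 :=
    (add_pos_of_nonneg_of_pos (hq b hb) (D.δ_pos (D.mem_out.1 hb))).ne'
  have h2 := (Real.hasDerivAt_mul_log hpos).comp_hasFDerivAt q h1
  exact h2

theorem localDiv_three_point (κ : ℝ) (a : D.V) (l p q : D.V → ℝ) :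
    D.localDiv κ a l q - D.localDiv κ a l p - D.localDiv κ a p q =
      ∑ b ∈ D.out a, D.localGradSub κ a p q b * (l b - p b) := by
  unfold localDiv localGradSub
  rw [← Finset.sum_sub_distrib, ← Finset.sum_sub_distrib]
  exact Finset.sum_congr rfl fun b _ => by ring

variable {D}

theorem coeff_nonneg {κ : ℝ} (hκ : 0 < κ) {a b : D.V} (h : D.Adj a b) :
    0 ≤ κ⁻¹ * (D.ω a b / D.η a b) :=
  mul_nonneg (inv_nonneg.2 hκ.le) (div_nonneg (D.ω_pos a b h).le (D.η_pos h).le)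

theorem localDiv_nonneg {κ : ℝ} (hκ : 0 < κ) {a : D.V} {p q : D.V → ℝ}
    (hp : ∀ b ∈ D.out a, 0 ≤ p b) (hq : ∀ b ∈ D.out a, 0 ≤ q b) : 0 ≤ D.localDiv κ a p q := by
  refine Finset.sum_nonneg fun b hb => ?_
  have h := D.mem_out.1 hb
  have h1 := sub_le_mul_log_sub_log (add_pos_of_nonneg_of_pos (hp b hb) (D.δ_pos h))
    (add_pos_of_nonneg_of_pos (hq b hb) (D.δ_pos h))
  refine mul_nonneg (coeff_nonneg hκ h) ?_
  linarith

theorem localDiv_self (κ : ℝ) (a : D.V) (p : D.V → ℝ) : D.localDiv κ a p p = 0 :=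
  Finset.sum_eq_zero fun b _ => by simp

theorem variational {κ : ℝ} {a : D.V} {q p c l : D.V → ℝ} (hq : ∀ b ∈ D.out a, 0 ≤ q b)
    (hp : p ∈ D.localSimplex a) (hmin : IsMinOn (D.localObjective κ a q c) (D.localSimplex a) p)
    (hl : l ∈ D.localSimplex a) :
    0 ≤ ∑ b ∈ D.out a, (D.localGradSub κ a p q b + c b) * (l b - p b) := by
  have hd : HasFDerivAt (D.localObjective κ a q c)
      (κ⁻¹ • (∑ b ∈ D.out a, (D.ω a b / D.η a b) •
        (Real.log (p b + D.δ a b) + 1) • ContinuousLinearMap.proj (R := ℝ) (φ := fun _ : D.V => ℝ) b)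
      - fderiv ℝ (D.localEntropy κ a) q
      + ∑ b ∈ D.out a, c b • ContinuousLinearMap.proj (R := ℝ) (φ := fun _ : D.V => ℝ) b) p := by
    unfold localObjective bregmanDivergence
    refine HasFDerivAt.add (HasFDerivAt.sub
      ((D.hasFDerivAt_localEntropy κ fun b _ => hp.1.1 b).sub_const _) ?_) ?_
    · exact (fderiv ℝ (D.localEntropy κ a) q).hasFDerivAt.comp p ((hasFDerivAt_id p).sub_const q)
    · refine HasFDerivAt.fun_sum fun b hb => ?_
      exact ((ContinuousLinearMap.proj (R := ℝ) (φ := fun _ : D.V => ℝ) b).hasFDerivAt).mul_const _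
  have hconv : Convex ℝ (D.localSimplex a) := by
    refine (convex_stdSimplex ℝ D.V).inter ?_
    intro x hx y hy s t _ _ _ b hb
    simp [hx b hb, hy b hb]
  have key := IsLocalMinOn.hasFDerivWithinAt_nonneg (y := l - p) hmin.localize hd.hasFDerivWithinAt
    (sub_mem_posTangentConeAt_of_segment_subset (hconv.segment_subset hp hl))
  rw [(D.hasFDerivAt_localEntropy κ hq).fderiv] at key
  simp only [_root_.add_apply, _root_.sub_apply,
    _root_.smul_apply, _root_.sum_apply,
    ContinuousLinearMap.proj_apply, smul_eq_mul, Pi.sub_apply] at key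
  rw [← mul_sub, ← Finset.sum_sub_distrib, Finset.mul_sum, ← Finset.sum_add_distrib] at key
  refine key.trans_eq (Finset.sum_congr rfl fun b _ => ?_)
  unfold localGradSub
  ring

/-- The data of one update at the vertex `a`: `p` satisfies the optimality condition of the local
mirror descent step from `q` with costs `c`. -/
structure IsLocalUpdate (κ : ℝ) (a : D.V) (q c p : D.V → ℝ) : Prop where
  left_mem : q ∈ D.localSimplex a
  mem : p ∈ D.localSimplex a
  optimal : ∀ l ∈ D.localSimplex a,
    0 ≤ ∑ b ∈ D.out a, (D.localGradSub κ a p q b + c b) * (l b - p b)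

theorem IsLocalUpdate.localDiv_le {κ : ℝ} (hκ : 0 < κ) {a : D.V} {q c p l : D.V → ℝ}
    (h : IsLocalUpdate κ a q c p) (hl : l ∈ D.localSimplex a) :
    D.localDiv κ a l p ≤ D.localDiv κ a l q +
      (∑ b ∈ D.out a, l b * c b - ∑ b ∈ D.out a, p b * c b) := by
  have h1 := h.optimal l hl
  have h2 := D.localDiv_three_point κ a l p q
  have h3 := localDiv_nonneg hκ (fun b (_ : b ∈ D.out a) => h.mem.1.1 b)
    (fun b (_ : b ∈ D.out a) => h.left_mem.1.1 b)
  have h4 : ∑ b ∈ D.out a, (D.localGradSub κ a p q b + c b) * (l b - p b) =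
      ∑ b ∈ D.out a, D.localGradSub κ a p q b * (l b - p b) +
        (∑ b ∈ D.out a, l b * c b - ∑ b ∈ D.out a, p b * c b) := by
    rw [← Finset.sum_sub_distrib, ← Finset.sum_add_distrib]
    exact Finset.sum_congr rfl fun b _ => by ring
  linarith

theorem IsLocalUpdate.sum_mul_le {κ : ℝ} (hκ : 0 < κ) {a : D.V} {q c p : D.V → ℝ}
    (h : IsLocalUpdate κ a q c p) :
    ∑ b ∈ D.out a, p b * c b ≤ ∑ b ∈ D.out a, q b * c b := by
  have h1 := h.localDiv_le hκ h.left_mem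
  rw [localDiv_self] at h1
  have h3 := localDiv_nonneg hκ (fun b (_ : b ∈ D.out a) => h.left_mem.1.1 b)
    (fun b (_ : b ∈ D.out a) => h.mem.1.1 b)
  linarith

theorem abs_log_sub_log_le {a b : D.V} (h : D.Adj a b) {s t : ℝ} (hs : 0 ≤ s) (hs1 : s ≤ 1)
    (ht : 0 ≤ t) (ht1 : t ≤ 1) :
    |Real.log (s + D.δ a b) - Real.log (t + D.δ a b)| ≤ 2 * D.η a b := by
  have hδ := D.δ_pos h
  have hη := D.η_pos h
  have hη1 := D.η_ge_one h
  have hδ1 := D.δ_le_one h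
  have hlow : ∀ r : ℝ, 0 ≤ r → Real.log (D.δ a b) ≤ Real.log (r + D.δ a b) := fun r hr =>
    Real.log_le_log hδ (by linarith)
  have hup : ∀ r : ℝ, 0 ≤ r → r ≤ 1 → Real.log (r + D.δ a b) ≤ 1 := fun r hr hr1 => by
    have := Real.log_le_sub_one_of_pos (show 0 < r + D.δ a b by linarith)
    linarith
  have hlogδ : 1 - 2 * D.η a b ≤ Real.log (D.δ a b) := by
    unfold δ
    rw [Real.log_div (D.θ_pos a b h).ne' hη.ne']
    have h1 : Real.log (D.θ a b) = 1 - D.η a b := by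
      unfold η; rw [one_div, Real.log_inv]; ring
    have h2 := Real.log_le_sub_one_of_pos hη
    linarith
  have := hlow s hs
  have := hlow t ht
  have := hup s hs hs1
  have := hup t ht ht1
  rw [abs_le]
  constructor <;> linarith

theorem abs_localGradSub_le {κ : ℝ} (hκ : 0 < κ) {a b : D.V} (h : D.Adj a b) {p q : D.V → ℝ}
    (hp : p ∈ D.localSimplex a) (hq : q ∈ D.localSimplex a) :
    |D.localGradSub κ a p q b| ≤ 2 / κ * D.ω a b := by
  unfold localGradSub
  rw [abs_mul, abs_of_nonneg (coeff_nonneg hκ h)]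
  have h1 := abs_log_sub_log_le h (hp.1.1 b) (D.le_one_of_mem_localSimplex hp b) (hq.1.1 b)
    (D.le_one_of_mem_localSimplex hq b)
  refine (mul_le_mul_of_nonneg_left h1 (coeff_nonneg hκ h)).trans_eq ?_
  have := (D.η_pos h).ne'
  field_simp

theorem localDiv_sub_localDiv_le {κ : ℝ} (hκ : 0 < κ) {a : D.V} {l l' q : D.V → ℝ}
    (hl : l ∈ D.localSimplex a) (hl' : l' ∈ D.localSimplex a) (hq : q ∈ D.localSimplex a) :
    D.localDiv κ a l' q - D.localDiv κ a l q ≤ 2 / κ * ∑ b ∈ D.out a, D.ω a b * |l' b - l b| := by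
  have h1 := D.localDiv_three_point κ a l l' q
  have h2 := localDiv_nonneg hκ (fun b (_ : b ∈ D.out a) => hl.1.1 b)
    (fun b (_ : b ∈ D.out a) => hl'.1.1 b)
  have h3 : -∑ b ∈ D.out a, D.localGradSub κ a l' q b * (l b - l' b) ≤
      2 / κ * ∑ b ∈ D.out a, D.ω a b * |l' b - l b| := by
    rw [← Finset.sum_neg_distrib, Finset.mul_sum]
    refine Finset.sum_le_sum fun b hb => ?_
    have h := D.mem_out.1 hb
    rw [← mul_neg, neg_sub]
    refine (le_abs_self _).trans ?_
    rw [abs_mul, ← mul_assoc]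
    exact mul_le_mul_of_nonneg_right (abs_localGradSub_le hκ h hl' hq) (abs_nonneg _)
  linarith

theorem sum_mul_le_of_localSimplex {a : D.V} {W : D.V → ℝ}
    (hωW : ∀ a b, D.Adj a b → D.ω a b ≤ W a) {p : D.V → ℝ} (hp : p ∈ D.localSimplex a) :
    ∑ b ∈ D.out a, D.ω a b * p b ≤ W a := by
  calc ∑ b ∈ D.out a, D.ω a b * p b ≤ ∑ b ∈ D.out a, W a * p b :=
        Finset.sum_le_sum fun b hb =>
          mul_le_mul_of_nonneg_right (hωW a b (D.mem_out.1 hb)) (hp.1.1 b)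
    _ = W a := by rw [← Finset.mul_sum, D.sum_out_of_mem_localSimplex hp, mul_one]

theorem sum_mul_abs_sub_le_of_localSimplex {a : D.V} {W : D.V → ℝ}
    (hωW : ∀ a b, D.Adj a b → D.ω a b ≤ W a) {p q : D.V → ℝ} (hp : p ∈ D.localSimplex a)
    (hq : q ∈ D.localSimplex a) :
    ∑ b ∈ D.out a, D.ω a b * |p b - q b| ≤ 2 * W a := by
  have h1 := sum_mul_le_of_localSimplex hωW hp
  have h2 := sum_mul_le_of_localSimplex hωW hq
  have : ∑ b ∈ D.out a, D.ω a b * |p b - q b| ≤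
      ∑ b ∈ D.out a, D.ω a b * p b + ∑ b ∈ D.out a, D.ω a b * q b := by
    rw [← Finset.sum_add_distrib]
    refine Finset.sum_le_sum fun b hb => ?_
    rw [← mul_add]
    refine mul_le_mul_of_nonneg_left ?_ (D.ω_pos a b (D.mem_out.1 hb)).le
    have := hp.1.1 b
    have := hq.1.1 b
    rw [abs_le]
    constructor <;> linarith
  linarith

theorem localDiv_le {κ : ℝ} (hκ : 0 < κ) {a : D.V} {W : D.V → ℝ}
    (hωW : ∀ a b, D.Adj a b → D.ω a b ≤ W a) {l q : D.V → ℝ}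
    (hl : l ∈ D.localSimplex a) (hq : q ∈ D.localSimplex a) :
    D.localDiv κ a l q ≤ 4 / κ * W a := by
  have h1 := localDiv_sub_localDiv_le hκ hq hl hq
  rw [localDiv_self, sub_zero] at h1
  have h2 := sum_mul_abs_sub_le_of_localSimplex hωW hl hq
  have h3 : 4 / κ * W a = 2 / κ * (2 * W a) := by ring
  rw [h3]
  exact h1.trans (mul_le_mul_of_nonneg_left h2 (by positivity))

end MarkedDAG

namespace MarkedDAG

variable {X : Type u} {D : MarkedDAG X}

namespace IsLocalUpdate

variable {κ : ℝ} {a : D.V} {q c p : D.V → ℝ}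

/-- The Lagrange multiplier of the constraint `∑ p = 1`. -/
def multiplier (_ : IsLocalUpdate κ a q c p) : ℝ :=
  ∑ b ∈ D.out a, (D.localGradSub κ a p q b + c b) * p b

theorem multiplier_le (h : IsLocalUpdate κ a q c p) {b : D.V} (hb : b ∈ D.out a) :
    h.multiplier ≤ D.localGradSub κ a p q b + c b := by
  classical
  have h1 := h.optimal _ (D.single_mem_localSimplex (D.mem_out.1 hb))
  simp only [mul_sub, Finset.sum_sub_distrib] at h1
  rw [Finset.sum_eq_single_of_mem b hb (fun e _ he => by simp [Pi.single_eq_of_ne he])] at h1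
  rw [Pi.single_eq_same, mul_one] at h1
  unfold multiplier
  linarith

theorem eq_multiplier (h : IsLocalUpdate κ a q c p) {b : D.V} (hb : b ∈ D.out a) (hp : 0 < p b) :
    D.localGradSub κ a p q b + c b = h.multiplier := by
  have h0 : ∑ e ∈ D.out a, (D.localGradSub κ a p q e + c e - h.multiplier) * p e = 0 := by
    simp only [sub_mul, Finset.sum_sub_distrib]
    rw [← Finset.mul_sum, D.sum_out_of_mem_localSimplex h.mem, mul_one]
    unfold multiplier
    ring
  rw [Finset.sum_eq_zero_iff_of_nonneg fun e he =>
    mul_nonneg (sub_nonneg.2 (h.multiplier_le he)) (h.mem.1.1 e)] at h0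
  rcases mul_eq_zero.1 (h0 b hb) with h1 | h1
  · linarith
  · exact absurd h1 hp.ne'

theorem localGradSub_nonneg (hκ : 0 < κ) (h : IsLocalUpdate κ a q c p) {b : D.V}
    (hb : b ∈ D.out a) (hqp : q b ≤ p b) : 0 ≤ D.localGradSub κ a p q b := by
  have hA := D.mem_out.1 hb
  refine mul_nonneg (coeff_nonneg hκ hA) (sub_nonneg.2 (Real.log_le_log ?_ ?_))
  · exact add_pos_of_nonneg_of_pos (h.left_mem.1.1 b) (D.δ_pos hA)
  · linarith

theorem localGradSub_nonpos (hκ : 0 < κ) (h : IsLocalUpdate κ a q c p) {b : D.V}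
    (hb : b ∈ D.out a) (hpq : p b ≤ q b) : D.localGradSub κ a p q b ≤ 0 := by
  have hA := D.mem_out.1 hb
  refine mul_nonpos_of_nonneg_of_nonpos (coeff_nonneg hκ hA)
    (sub_nonpos.2 (Real.log_le_log ?_ ?_))
  · exact add_pos_of_nonneg_of_pos (h.mem.1.1 b) (D.δ_pos hA)
  · linarith

theorem multiplier_nonneg (hκ : 0 < κ) (h : IsLocalUpdate κ a q c p)
    (hc : ∀ b ∈ D.out a, 0 ≤ c b) : 0 ≤ h.multiplier := by
  have hsp := D.sum_out_of_mem_localSimplex h.mem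
  have hsq := D.sum_out_of_mem_localSimplex h.left_mem
  obtain ⟨b, hb, hpos, hle⟩ : ∃ b ∈ D.out a, 0 < p b ∧ q b ≤ p b := by
    by_contra! hcon
    obtain ⟨e, he, hpe⟩ : ∃ e ∈ D.out a, 0 < p e := by
      by_contra! hcon'
      have := Finset.sum_nonpos hcon'
      linarith
    have : ∑ b ∈ D.out a, p b < ∑ b ∈ D.out a, q b := by
      refine Finset.sum_lt_sum (fun b hb => ?_) ⟨e, he, hcon e he hpe⟩
      rcases (h.mem.1.1 b).eq_or_lt with h0 | h0
      · exact h0 ▸ h.left_mem.1.1 b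
      · exact (hcon b hb h0).le
    linarith
  rw [← h.eq_multiplier hb hpos]
  exact add_nonneg (h.localGradSub_nonneg hκ hb hle) (hc b hb)

theorem multiplier_le_of_le (hκ : 0 < κ) (h : IsLocalUpdate κ a q c p) {ε : ℝ}
    (hc : ∀ b ∈ D.out a, c b ≤ ε) : h.multiplier ≤ ε := by
  have hsp := D.sum_out_of_mem_localSimplex h.mem
  have hsq := D.sum_out_of_mem_localSimplex h.left_mem
  obtain ⟨b, hb, hle⟩ : ∃ b ∈ D.out a, p b ≤ q b := by
    refine Finset.exists_le_of_sum_le ?_ (hsp.trans hsq.symm).le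
    by_contra hcon
    rw [Finset.not_nonempty_iff_eq_empty] at hcon
    simp [hcon] at hsp
  have h1 := h.multiplier_le hb
  have h2 := h.localGradSub_nonpos hκ hb hle
  have h3 := hc b hb
  linarith

end IsLocalUpdate

theorem ω_mul_log_sub_log (κ : ℝ) (hκ : 0 < κ) {a b : D.V} (hA : D.Adj a b) (p q : D.V → ℝ) :
    D.ω a b * (Real.log (p b + D.δ a b) - Real.log (q b + D.δ a b)) =
      κ * D.η a b * D.localGradSub κ a p q b := by
  unfold localGradSub
  have := (D.η_pos hA).ne'
  field_simp

theorem exp_log_sub_log_mul {a b : D.V} (hA : D.Adj a b) {p q : D.V → ℝ} (hp : 0 ≤ p b)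
    (hq : 0 ≤ q b) :
    p b + D.δ a b =
      (q b + D.δ a b) * Real.exp (Real.log (p b + D.δ a b) - Real.log (q b + D.δ a b)) := by
  have h1 := add_pos_of_nonneg_of_pos hp (D.δ_pos hA)
  have h2 := add_pos_of_nonneg_of_pos hq (D.δ_pos hA)
  rw [Real.exp_sub, Real.exp_log h1, Real.exp_log h2]
  field_simp

variable (D) in
/-- The local part of the potential function that pays for movement. -/
def localPotential (a : D.V) (p : D.V → ℝ) : ℝ :=
  ∑ b ∈ D.out a, D.ω a b * (8 * (p b - D.δ a b * Real.log (p b + D.δ a b)) - p b)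

theorem sum_ω_mul_abs_sub_le {κ : ℝ} (hκ : 0 < κ) {a : D.V} (ha : a ∈ D.inner) {q c p : D.V → ℝ}
    (h : IsLocalUpdate κ a q c p) {ε : ℝ} (hc0 : ∀ b ∈ D.out a, 0 ≤ c b)
    (hc : ∀ b ∈ D.out a, c b ≤ ε) (hε : ∀ b ∈ D.out a, κ * D.η a b * ε ≤ D.ω a b) :
    ∑ b ∈ D.out a, D.ω a b * |p b - q b| ≤
      D.localPotential a p - D.localPotential a q +
        8 * κ * ∑ b ∈ D.out a, q b * (D.η a b * c b) := by
  set m := h.multiplier with hm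
  have hm0 : 0 ≤ m := h.multiplier_nonneg hκ hc0
  have hmε : m ≤ ε := h.multiplier_le_of_le hκ hc
  have hq0 := h.left_mem.1.1
  have hp0 := h.mem.1.1
  have hin : ∀ b ∈ D.out a, D.ω a b * |p b - q b| ≤
      4 * κ * m * (q b * D.η a b + D.θ a b) - D.ω a b * (p b - q b) := by
    intro b hb
    have hA := D.mem_out.1 hb
    have hω := D.ω_pos a b hA
    have hη := D.η_pos hA
    have hδ := D.δ_pos hA
    have hθ : D.θ a b = D.δ a b * D.η a b := (D.δ_mul_η hA).symm
    rcases le_or_gt (p b) (q b) with hle | hlt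
    · rw [abs_of_nonpos (sub_nonpos.2 hle)]
      have : 0 ≤ 4 * κ * m * (q b * D.η a b + D.θ a b) := by
        have := hq0 b
        rw [hθ]
        positivity
      linarith
    · rw [abs_of_pos (sub_pos.2 hlt)]
      have hg := h.eq_multiplier hb ((hq0 b).trans_lt hlt)
      have hx := ω_mul_log_sub_log κ hκ hA p q
      have he := exp_log_sub_log_mul hA (hp0 b) (hq0 b)
      set x := Real.log (p b + D.δ a b) - Real.log (q b + D.δ a b) with hxdef
      have hx0 : 0 ≤ x := by
        rw [hxdef, sub_nonneg]
        exact Real.log_le_log (add_pos_of_nonneg_of_pos (hq0 b) hδ) (by linarith)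
      have hgm : D.localGradSub κ a p q b ≤ m := by
        have := hc0 b hb
        linarith
      have hωx : D.ω a b * x ≤ κ * D.η a b * m := by
        rw [hx]
        exact mul_le_mul_of_nonneg_left hgm (by positivity)
      have hx1 : x ≤ 1 := by
        have h1 : κ * D.η a b * m ≤ κ * D.η a b * ε :=
          mul_le_mul_of_nonneg_left hmε (by positivity)
        have h2 := hε b hb
        by_contra! hcon
        nlinarith
      have hexp : Real.exp x - 1 ≤ 2 * x := by
        have := Real.abs_exp_sub_one_le (x := x) (by rwa [abs_of_nonneg hx0])
        rw [abs_of_nonneg hx0] at this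
        exact (le_abs_self _).trans this
      have hqδ : 0 ≤ q b + D.δ a b := add_nonneg (hq0 b) hδ.le
      have hpq : p b - q b ≤ (q b + D.δ a b) * (2 * x) := by
        have := mul_le_mul_of_nonneg_left hexp hqδ
        linarith
      have h3 : D.ω a b * (p b - q b) ≤ 2 * κ * m * (q b * D.η a b + D.θ a b) := by
        calc D.ω a b * (p b - q b) ≤ D.ω a b * ((q b + D.δ a b) * (2 * x)) :=
              mul_le_mul_of_nonneg_left hpq hω.le
          _ = 2 * (q b + D.δ a b) * (D.ω a b * x) := by ring
          _ ≤ 2 * (q b + D.δ a b) * (κ * D.η a b * m) :=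
              mul_le_mul_of_nonneg_left hωx (by positivity)
          _ = _ := by rw [hθ]; ring
      linarith
  have hpot : ∀ b ∈ D.out a, κ * D.η a b * q b * (m - c b) ≤
      D.ω a b * ((p b - D.δ a b * Real.log (p b + D.δ a b)) -
        (q b - D.δ a b * Real.log (q b + D.δ a b))) := by
    intro b hb
    have hA := D.mem_out.1 hb
    have hω := D.ω_pos a b hA
    have hη := D.η_pos hA
    have hδ := D.δ_pos hA
    have hx := ω_mul_log_sub_log κ hκ hA p q
    have he := exp_log_sub_log_mul hA (hp0 b) (hq0 b)
    have hml := h.multiplier_le hb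
    set x := Real.log (p b + D.δ a b) - Real.log (q b + D.δ a b) with hxdef
    have hqδ : 0 ≤ q b + D.δ a b := add_nonneg (hq0 b) hδ.le
    have h1 : q b * x ≤ p b - q b - D.δ a b * x := by
      have := mul_le_mul_of_nonneg_left (Real.add_one_le_exp x) hqδ
      linarith
    have h2 : κ * D.η a b * q b * (m - c b) ≤ D.ω a b * (q b * x) := by
      calc κ * D.η a b * q b * (m - c b) ≤ κ * D.η a b * q b * D.localGradSub κ a p q b := by
            refine mul_le_mul_of_nonneg_left (by linarith) ?_
            have := hq0 b
            positivity
        _ = q b * (D.ω a b * x) := by rw [hx]; ring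
        _ = _ := by ring
    refine h2.trans ((mul_le_mul_of_nonneg_left h1 hω.le).trans_eq ?_)
    rw [hxdef]
    ring
  have hsη : 1 ≤ ∑ b ∈ D.out a, q b * D.η a b := by
    rw [← D.sum_out_of_mem_localSimplex h.left_mem]
    exact Finset.sum_le_sum fun b hb =>
      le_mul_of_one_le_right (hq0 b) (D.η_ge_one (D.mem_out.1 hb))
  have hθ := D.θ_sum a (D.mem_inner.1 ha)
  have h1 := Finset.sum_le_sum hin
  have h2 := Finset.sum_le_sum hpot
  rw [Finset.sum_sub_distrib, ← Finset.mul_sum, Finset.sum_add_distrib, hθ] at h1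
  have h3 : ∑ b ∈ D.out a, κ * D.η a b * q b * (m - c b) =
      κ * m * ∑ b ∈ D.out a, q b * D.η a b - κ * ∑ b ∈ D.out a, q b * (D.η a b * c b) := by
    rw [Finset.mul_sum, Finset.mul_sum, ← Finset.sum_sub_distrib]
    exact Finset.sum_congr rfl fun b _ => by ring
  have h4 : D.localPotential a p - D.localPotential a q =
      8 * (∑ b ∈ D.out a, D.ω a b * ((p b - D.δ a b * Real.log (p b + D.δ a b)) -
        (q b - D.δ a b * Real.log (q b + D.δ a b)))) - ∑ b ∈ D.out a, D.ω a b * (p b - q b) := by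
    unfold localPotential
    rw [Finset.mul_sum, ← Finset.sum_sub_distrib, ← Finset.sum_sub_distrib]
    exact Finset.sum_congr rfl fun b _ => by ring
  have h5 : κ * m * 1 ≤ κ * m * ∑ b ∈ D.out a, q b * D.η a b :=
    mul_le_mul_of_nonneg_left hsη (by positivity)
  rw [h3] at h2
  rw [h4]
  linarith

theorem abs_localPotential_le {a : D.V} (ha : a ∈ D.inner) {W : D.V → ℝ}
    (hωW : ∀ a b, D.Adj a b → D.ω a b ≤ W a) {p : D.V → ℝ} (hp : p ∈ D.localSimplex a) :
    |D.localPotential a p| ≤ 24 * W a := by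
  have hb : ∀ b ∈ D.out a,
      |D.ω a b * (8 * (p b - D.δ a b * Real.log (p b + D.δ a b)) - p b)| ≤
      7 * (D.ω a b * p b) + 16 * (D.θ a b * W a) := by
    intro b hb
    have hA := D.mem_out.1 hb
    have hω := D.ω_pos a b hA
    have hδ := D.δ_pos hA
    have hη1 := D.η_ge_one hA
    have hp0 := hp.1.1 b
    have hlog : |Real.log (p b + D.δ a b)| ≤ 2 * D.η a b := by
      have h1 := abs_log_sub_log_le hA le_rfl zero_le_one hp0 (D.le_one_of_mem_localSimplex hp b)
      have hp1 := D.le_one_of_mem_localSimplex hp b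
      have h2 : Real.log (p b + D.δ a b) ≤ 1 := by
        have := Real.log_le_sub_one_of_pos (show 0 < p b + D.δ a b by linarith)
        have := D.δ_le_one hA
        linarith
      have h3 := abs_log_sub_log_le hA zero_le_one le_rfl hp0 hp1
      have h4 : 0 ≤ Real.log (1 + D.δ a b) := Real.log_nonneg (by linarith)
      rw [abs_le] at h3 ⊢
      constructor <;> linarith
    rw [abs_mul, abs_of_pos hω]
    have h1 : |8 * (p b - D.δ a b * Real.log (p b + D.δ a b)) - p b| ≤
        7 * p b + 16 * D.θ a b := by
      have e : 8 * (p b - D.δ a b * Real.log (p b + D.δ a b)) - p b =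
        7 * p b - 8 * (D.δ a b * Real.log (p b + D.δ a b)) := by ring
      have h2 : |D.δ a b * Real.log (p b + D.δ a b)| ≤ 2 * D.θ a b := by
        rw [abs_mul, abs_of_pos hδ, ← D.δ_mul_η hA]
        have := mul_le_mul_of_nonneg_left hlog hδ.le
        linarith
      rw [e]
      rw [abs_le] at h2 ⊢
      constructor <;> linarith
    have h2 := mul_le_mul_of_nonneg_left h1 hω.le
    have h3 : D.ω a b * D.θ a b ≤ D.θ a b * W a := by
      rw [mul_comm]
      exact mul_le_mul_of_nonneg_left (hωW a b hA) (D.θ_pos a b hA).le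
    linarith
  have h1 := (Finset.abs_sum_le_sum_abs _ _).trans (Finset.sum_le_sum hb)
  rw [Finset.sum_add_distrib, ← Finset.mul_sum, ← Finset.mul_sum, ← Finset.sum_mul,
    D.θ_sum a (D.mem_inner.1 ha)] at h1
  have h2 := sum_mul_le_of_localSimplex hωW hp
  have h3 : 0 ≤ W a := by
    obtain ⟨b, hb⟩ := (D.out_nonempty_iff a).2 (D.mem_inner.1 ha)
    exact (D.ω_pos a b (D.mem_out.1 hb)).le.trans (hωW a b (D.mem_out.1 hb))
  unfold localPotential
  linarith

end MarkedDAG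

/-- A marked DAG that is adapted to a metric: arc lengths decay by a factor `100` along paths, each
path has weight at most `K`, arc lengths dominate distances, and every point `x` has a reference
policy that routes the unit flow to `x` and varies in a `σ`-Lipschitz way. -/
structure MarkedDAG.Adapted {X : Type u} [MetricSpace X] (D : MarkedDAG X) (K σ : ℝ) where
  W : D.V → ℝ
  W_nonneg : ∀ a, 0 ≤ W a
  ω_le : ∀ a b, D.Adj a b → D.ω a b ≤ W a
  le_ω : ∀ a b, D.Adj a b → 100 * W b ≤ D.ω a b
  height : D.V → ℝ
  height_nonneg : ∀ a, 0 ≤ height a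
  height_le : ∀ a b, D.Adj a b → D.η a b + height b ≤ height a
  height_root : height D.root ≤ K
  S : D.V → Set X
  mem_S_sink : ∀ x, x ∈ S (D.sink x)
  S_mono : ∀ a b, D.Adj a b → S b ⊆ S a
  dist_le : ∀ a b b', D.Adj a b → D.Adj a b' → b ≠ b' → ∀ x ∈ S b, ∀ y ∈ S b',
    dist x y ≤ D.ω a b + D.ω a b'
  ref : X → D.V → D.V → ℝ
  ref_mem : ∀ x, ref x ∈ D.policies
  sinkMass_ref : ∀ x y, y ≠ x → D.sinkMass (ref x) y = 0
  shift_ref_le : ∀ x y, D.shift (ref x) (ref y) ≤ σ * dist x y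

namespace MarkedDAG

variable {X : Type u} {D : MarkedDAG X}

theorem mirrorStep_mem_policies (κ : ℝ) (c : X → ℝ) (q : D.V → D.V → ℝ) :
    D.mirrorStep κ c q ∈ D.policies := by
  classical
  have h1 : ∀ a ∈ D.inner, D.mirrorStep κ c q a ∈ D.localSimplex a := fun a ha =>
    (D.mirrorStep_spec κ c q a (D.mem_inner.1 ha)).1
  have h0 : ∀ a ∉ D.inner, D.mirrorStep κ c q a = 0 := by
    intro a ha
    unfold mirrorStep localStep
    rw [dif_neg]
    rwa [D.out_nonempty_iff, ← D.mem_inner]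
  refine ⟨fun a b => ?_, fun a b hab => ?_, fun a ha =>
    D.sum_out_of_mem_localSimplex (h1 a (D.mem_inner.2 ha))⟩
  · by_cases ha : a ∈ D.inner
    · exact (h1 a ha).1.1 b
    · rw [h0 a ha]; exact le_rfl
  · by_cases ha : a ∈ D.inner
    · exact (h1 a ha).2 b hab
    · rw [h0 a ha]; rfl

theorem isLocalUpdate_mirrorStep (κ : ℝ) (c : X → ℝ) {q : D.V → D.V → ℝ} (hq : q ∈ D.policies)
    {a : D.V} (ha : a ∈ D.inner) :
    IsLocalUpdate κ a (q a) (D.cHat κ c q) (D.mirrorStep κ c q a) where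
  left_mem := D.mem_localSimplex_of_mem_policies hq ha
  mem := (D.mirrorStep_spec κ c q a (D.mem_inner.1 ha)).1
  optimal := fun _ hl =>
    have h := D.mirrorStep_spec κ c q a (D.mem_inner.1 ha)
    variational (fun b _ => hq.1 a b) h.1 h.2 hl

theorem cHat_inner (κ : ℝ) (c : X → ℝ) (q : D.V → D.V → ℝ) {a : D.V} (ha : a ∈ D.inner) :
    D.cHat κ c q a = ∑ b ∈ D.out a, D.mirrorStep κ c q a b * D.cHat κ c q b :=
  D.cHat_of_not_sink κ c q a (D.mem_inner.1 ha)

theorem cHat_eq_value (κ : ℝ) (c : X → ℝ) (q : D.V → D.V → ℝ) (v : D.V) :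
    D.cHat κ c q v = D.value (D.mirrorStep κ c q) c v := by
  induction v using D.sink_induction with
  | hsink x => rw [cHat_sink, D.value_sink]
  | hinner a ha ih =>
    rw [cHat_inner _ _ _ ha, D.value_inner _ _ ha]
    exact Finset.sum_congr rfl fun b hb => by rw [ih b hb]

theorem value_nonneg {q : D.V → D.V → ℝ} (hq : q ∈ D.policies) {c : X → ℝ} (hc : ∀ x, 0 ≤ c x)
    (v : D.V) : 0 ≤ D.value q c v := by
  induction v using D.sink_induction with
  | hsink x => rw [D.value_sink]; exact hc x
  | hinner a ha ih =>
    rw [D.value_inner _ _ ha]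
    exact Finset.sum_nonneg fun b hb => mul_nonneg (hq.1 a b) (ih b hb)

theorem value_le {q : D.V → D.V → ℝ} (hq : q ∈ D.policies) {c : X → ℝ} {ε : ℝ}
    (hc : ∀ x, c x ≤ ε) (v : D.V) : D.value q c v ≤ ε := by
  induction v using D.sink_induction with
  | hsink x => rw [D.value_sink]; exact hc x
  | hinner a ha ih =>
    rw [D.value_inner _ _ ha]
    calc ∑ b ∈ D.out a, q a b * D.value q c b ≤ ∑ b ∈ D.out a, q a b * ε :=
          Finset.sum_le_sum fun b hb => mul_le_mul_of_nonneg_left (ih b hb) (hq.1 a b)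
      _ = ε := by rw [← Finset.sum_mul, hq.2.2 a (D.mem_inner.1 ha), one_mul]

theorem cHat_le_value {κ : ℝ} (hκ : 0 < κ) (c : X → ℝ) {q : D.V → D.V → ℝ} (hq : q ∈ D.policies)
    (v : D.V) : D.cHat κ c q v ≤ D.value q c v := by
  induction v using D.sink_induction with
  | hsink x => rw [D.value_sink, cHat_sink]
  | hinner a ha ih =>
    rw [D.value_inner _ _ ha, cHat_inner _ _ _ ha]
    exact ((isLocalUpdate_mirrorStep κ c hq ha).sum_mul_le hκ).trans
      (Finset.sum_le_sum fun b hb => mul_le_mul_of_nonneg_left (ih b hb) (hq.1 a b))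

theorem shift_eq_sum_inner [Fintype X] (q p : D.V → D.V → ℝ) :
    D.shift q p = ∑ a ∈ D.inner, D.vertexFlow q a * ∑ b ∈ D.out a, D.ω a b * |p a b - q a b| := by
  unfold shift
  rw [D.sum_eq_sum_sink_add_sum_inner]
  simp [D.out_sink]

theorem shift_nonneg {q : D.V → D.V → ℝ} (hq : q ∈ D.policies) (p : D.V → D.V → ℝ) :
    0 ≤ D.shift q p :=
  Finset.sum_nonneg fun a _ => mul_nonneg (D.vertexFlow_nonneg hq a)
    (Finset.sum_nonneg fun b hb => mul_nonneg (D.ω_pos a b (D.mem_out.1 hb)).le (abs_nonneg _))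

variable (D) in
/-- The divergence of the flow of `l` from that of `q`, with respect to the multiscale entropy. -/
def flowDiv (κ : ℝ) (l q : D.V → D.V → ℝ) : ℝ :=
  ∑ a ∈ D.inner, D.vertexFlow l a * D.localDiv κ a (l a) (q a)

variable (D) in
/-- The potential function that pays for movement. -/
def flowPotential (q : D.V → D.V → ℝ) : ℝ :=
  ∑ a ∈ D.inner, D.vertexFlow q a * D.localPotential a (q a)

theorem flowDiv_nonneg {κ : ℝ} (hκ : 0 < κ) {l q : D.V → D.V → ℝ} (hl : l ∈ D.policies)
    (hq : q ∈ D.policies) : 0 ≤ D.flowDiv κ l q :=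
  Finset.sum_nonneg fun a _ => mul_nonneg (D.vertexFlow_nonneg hl a)
    (localDiv_nonneg hκ (fun b _ => hl.1 a b) (fun b _ => hq.1 a b))

theorem flowDiv_mirrorStep_le [Fintype X] {κ : ℝ} (hκ : 0 < κ) (c : X → ℝ)
    {l q : D.V → D.V → ℝ} (hl : l ∈ D.policies) (hq : q ∈ D.policies) :
    D.flowDiv κ l (D.mirrorStep κ c q) + D.value (D.mirrorStep κ c q) c D.root ≤
      D.flowDiv κ l q + D.value l c D.root := by
  have h1 := D.sum_sinkMass_add_sum_inner l (D.cHat κ c q)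
  simp only [cHat_sink] at h1
  rw [D.sum_sinkMass_mul, cHat_eq_value] at h1
  have h2 : D.flowDiv κ l (D.mirrorStep κ c q) ≤ D.flowDiv κ l q - ∑ a ∈ D.inner,
      D.vertexFlow l a * (D.cHat κ c q a - ∑ b ∈ D.out a, l a b * D.cHat κ c q b) := by
    unfold flowDiv
    rw [← Finset.sum_sub_distrib]
    refine Finset.sum_le_sum fun a ha => ?_
    rw [← mul_sub]
    refine mul_le_mul_of_nonneg_left ?_ (D.vertexFlow_nonneg hl a)
    have := (isLocalUpdate_mirrorStep κ c hq ha).localDiv_le hκ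
      (D.mem_localSimplex_of_mem_policies hl ha)
    rw [cHat_inner κ c q ha]
    linarith
  linarith

theorem Adapted.sum_W_mul_abs_le [MetricSpace X] {K σ : ℝ}
    (A : D.Adapted K σ) {q p : D.V → D.V → ℝ} (hq : q ∈ D.policies)
    (hp : p ∈ D.policies) :
    ∑ a ∈ D.inner, A.W a * |D.vertexFlow p a - D.vertexFlow q a| ≤ D.shift q p / 99 := by
  have h1 := D.sum_weight_mul_abs_vertexFlow_sub_le hq hp (by norm_num : (0 : ℝ) ≤ 100) A.W_nonneg
    A.ω_le A.le_ω
  have h2 : ∑ a ∈ D.inner, A.W a * |D.vertexFlow p a - D.vertexFlow q a| ≤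
      ∑ a, A.W a * |D.vertexFlow p a - D.vertexFlow q a| :=
    Finset.sum_le_sum_of_subset_of_nonneg (Finset.subset_univ _) fun a _ _ =>
      mul_nonneg (A.W_nonneg a) (abs_nonneg _)
  linarith

theorem Adapted.flowDiv_le [Fintype X] [MetricSpace X] {K σ : ℝ}
    (A : D.Adapted K σ) {κ : ℝ} (hκ : 0 < κ) {l l' q : D.V → D.V → ℝ} (hl : l ∈ D.policies)
    (hl' : l' ∈ D.policies) (hq : q ∈ D.policies) :
    D.flowDiv κ l' q ≤ D.flowDiv κ l q + 3 / κ * D.shift l l' := by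
  have h0 := A.sum_W_mul_abs_le hl hl'
  have h1 : D.flowDiv κ l' q ≤ D.flowDiv κ l q + (2 / κ * D.shift l l' + 4 / κ *
      ∑ a ∈ D.inner, A.W a * |D.vertexFlow l' a - D.vertexFlow l a|) := by
    unfold flowDiv
    rw [shift_eq_sum_inner, Finset.mul_sum, Finset.mul_sum, ← Finset.sum_add_distrib,
      ← Finset.sum_add_distrib]
    refine Finset.sum_le_sum fun a ha => ?_
    have hls := D.mem_localSimplex_of_mem_policies hl ha
    have hls' := D.mem_localSimplex_of_mem_policies hl' ha
    have hqs := D.mem_localSimplex_of_mem_policies hq ha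
    have h2 := mul_le_mul_of_nonneg_left (localDiv_sub_localDiv_le hκ hls hls' hqs)
      (D.vertexFlow_nonneg hl a)
    have h3 := localDiv_le hκ A.ω_le hls' hqs
    have h3' := localDiv_nonneg hκ (fun b (_ : b ∈ D.out a) => hl'.1 a b)
      (fun b (_ : b ∈ D.out a) => hq.1 a b)
    have h4 : (D.vertexFlow l' a - D.vertexFlow l a) * D.localDiv κ a (l' a) (q a) ≤
        |D.vertexFlow l' a - D.vertexFlow l a| * (4 / κ * A.W a) :=
      (mul_le_mul_of_nonneg_right (le_abs_self _) h3').trans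
        (mul_le_mul_of_nonneg_left h3 (abs_nonneg _))
    nlinarith
  have h2 : 4 / κ * ∑ a ∈ D.inner, A.W a * |D.vertexFlow l' a - D.vertexFlow l a| ≤
      1 / κ * D.shift l l' := by
    have := mul_le_mul_of_nonneg_left h0 (show 0 ≤ 4 / κ by positivity)
    refine this.trans ?_
    have h5 : 4 / κ * (D.shift l l' / 99) = 4 / 99 * (1 / κ * D.shift l l') := by ring
    have h6 : 0 ≤ 1 / κ * D.shift l l' := mul_nonneg (by positivity) (shift_nonneg hl _)
    rw [h5]
    linarith
  have h3 : 3 / κ * D.shift l l' = 2 / κ * D.shift l l' + 1 / κ * D.shift l l' := by ring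
  linarith

theorem Adapted.sum_vertexFlow_mul_W_le [Fintype X] [MetricSpace X] {K σ : ℝ}
    (A : D.Adapted K σ) {q : D.V → D.V → ℝ} (hq : q ∈ D.policies) :
    ∑ a ∈ D.inner, D.vertexFlow q a * A.W a ≤ 2 * A.W D.root := by
  have h := D.sum_sinkMass_add_sum_inner q (fun a => 2 * A.W a)
  have h1 : 0 ≤ ∑ x, D.sinkMass q x * (2 * A.W (D.sink x)) :=
    Finset.sum_nonneg fun x _ => mul_nonneg (D.sinkMass_nonneg hq x)
      (mul_nonneg zero_le_two (A.W_nonneg _))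
  have h2 : ∑ a ∈ D.inner, D.vertexFlow q a * A.W a ≤ ∑ a ∈ D.inner,
      D.vertexFlow q a * (2 * A.W a - ∑ b ∈ D.out a, q a b * (2 * A.W b)) := by
    refine Finset.sum_le_sum fun a ha => mul_le_mul_of_nonneg_left ?_ (D.vertexFlow_nonneg hq a)
    have : ∑ b ∈ D.out a, q a b * (2 * A.W b) ≤ ∑ b ∈ D.out a, q a b * A.W a := by
      refine Finset.sum_le_sum fun b hb => mul_le_mul_of_nonneg_left ?_ (hq.1 a b)
      have h3 := A.ω_le a b (D.mem_out.1 hb)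
      have h4 := A.le_ω a b (D.mem_out.1 hb)
      have h5 := A.W_nonneg b
      linarith
    rw [← Finset.sum_mul, hq.2.2 a (D.mem_inner.1 ha), one_mul] at this
    linarith
  linarith

theorem Adapted.abs_flowPotential_le [Fintype X] [MetricSpace X] {K σ : ℝ}
    (A : D.Adapted K σ) {q : D.V → D.V → ℝ} (hq : q ∈ D.policies) :
    |D.flowPotential q| ≤ 48 * A.W D.root := by
  refine (Finset.abs_sum_le_sum_abs _ _).trans ?_
  have : ∀ a ∈ D.inner, |D.vertexFlow q a * D.localPotential a (q a)| ≤
      24 * (D.vertexFlow q a * A.W a) := by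
    intro a ha
    rw [abs_mul, abs_of_nonneg (D.vertexFlow_nonneg hq a)]
    have := mul_le_mul_of_nonneg_left (abs_localPotential_le ha A.ω_le
      (D.mem_localSimplex_of_mem_policies hq ha)) (D.vertexFlow_nonneg hq a)
    linarith
  have h := Finset.sum_le_sum this
  rw [← Finset.mul_sum] at h
  have := A.sum_vertexFlow_mul_W_le hq
  linarith

theorem Adapted.sum_vertexFlow_mul_η_le [Fintype X] [MetricSpace X] {K σ : ℝ}
    (A : D.Adapted K σ) {q : D.V → D.V → ℝ} (hq : q ∈ D.policies) {c : X → ℝ}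
    (hc : ∀ x, 0 ≤ c x) :
    ∑ a ∈ D.inner, D.vertexFlow q a * ∑ b ∈ D.out a, q a b * (D.η a b * D.value q c b) ≤
      K * D.value q c D.root := by
  have h := D.sum_sinkMass_add_sum_inner q (fun a => A.height a * D.value q c a)
  have h1 : 0 ≤ ∑ x, D.sinkMass q x * (A.height (D.sink x) * D.value q c (D.sink x)) :=
    Finset.sum_nonneg fun x _ => mul_nonneg (D.sinkMass_nonneg hq x)
      (mul_nonneg (A.height_nonneg _) (value_nonneg hq hc _))
  have h2 : ∑ a ∈ D.inner, D.vertexFlow q a * ∑ b ∈ D.out a, q a b * (D.η a b * D.value q c b) ≤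
      ∑ a ∈ D.inner, D.vertexFlow q a * (A.height a * D.value q c a -
        ∑ b ∈ D.out a, q a b * (A.height b * D.value q c b)) := by
    refine Finset.sum_le_sum fun a ha => mul_le_mul_of_nonneg_left ?_ (D.vertexFlow_nonneg hq a)
    rw [D.value_inner q c ha, Finset.mul_sum, ← Finset.sum_sub_distrib]
    refine Finset.sum_le_sum fun b hb => ?_
    have h3 := mul_le_mul_of_nonneg_left (A.height_le a b (D.mem_out.1 hb))
      (mul_nonneg (hq.1 a b) (value_nonneg hq hc b))
    linarith
  have h3 := mul_le_mul_of_nonneg_right A.height_root (value_nonneg hq hc D.root)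
  linarith

theorem Adapted.shift_mirrorStep_le [Fintype X] [MetricSpace X] {K σ : ℝ}
    (A : D.Adapted K σ) {κ ε : ℝ} (hκ : 0 < κ) (hK : 0 < K) {c : X → ℝ}
    (hc : ∀ x, 0 ≤ c x) (hcε : ∀ x, c x ≤ ε)
    (hε : ∀ a b, D.Adj a b → κ * D.η a b * ε ≤ D.ω a b)
    (hε' : ∀ a b, D.Adj a b → 32 * κ * K * ε ≤ D.ω a b)
    {q : D.V → D.V → ℝ} (hq : q ∈ D.policies) :
    D.shift q (D.mirrorStep κ c q) ≤
      2 * (D.flowPotential (D.mirrorStep κ c q) - D.flowPotential q) +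
        16 * κ * K * D.value (D.mirrorStep κ c q) c D.root := by
  set p := D.mirrorStep κ c q with hpdef
  have hp : p ∈ D.policies := mirrorStep_mem_policies κ c q
  have hĉ : ∀ v, D.cHat κ c q v = D.value p c v := cHat_eq_value κ c q
  have hĉ0 : ∀ v, 0 ≤ D.cHat κ c q v := fun v => (hĉ v) ▸ value_nonneg hp hc v
  have hĉε : ∀ v, D.cHat κ c q v ≤ ε := fun v => (hĉ v) ▸ value_le hp hcε v
  set M := D.shift q p with hM
  have h1 : M ≤ ∑ a ∈ D.inner, D.vertexFlow q a * (D.localPotential a (p a) -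
      D.localPotential a (q a)) + 8 * κ * ∑ a ∈ D.inner,
        D.vertexFlow q a * ∑ b ∈ D.out a, q a b * (D.η a b * D.cHat κ c q b) := by
    rw [hM, shift_eq_sum_inner, Finset.mul_sum, ← Finset.sum_add_distrib]
    refine Finset.sum_le_sum fun a ha => ?_
    have := mul_le_mul_of_nonneg_left (sum_ω_mul_abs_sub_le hκ ha
      (isLocalUpdate_mirrorStep κ c hq ha) (fun b _ => hĉ0 b) (fun b _ => hĉε b)
      (fun b hb => hε a b (D.mem_out.1 hb))) (D.vertexFlow_nonneg hq a)
    linarith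
  have h2 : ∑ a ∈ D.inner, D.vertexFlow q a * (D.localPotential a (p a) -
      D.localPotential a (q a)) ≤ D.flowPotential p - D.flowPotential q + M / 4 := by
    have h3 : ∑ a ∈ D.inner, D.vertexFlow q a * (D.localPotential a (p a) -
        D.localPotential a (q a)) = D.flowPotential p - D.flowPotential q -
        ∑ a ∈ D.inner, (D.vertexFlow p a - D.vertexFlow q a) * D.localPotential a (p a) := by
      unfold flowPotential
      rw [← Finset.sum_sub_distrib, ← Finset.sum_sub_distrib]
      exact Finset.sum_congr rfl fun a _ => by ring
    have h4 : -∑ a ∈ D.inner, (D.vertexFlow p a - D.vertexFlow q a) * D.localPotential a (p a) ≤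
        24 * ∑ a ∈ D.inner, A.W a * |D.vertexFlow p a - D.vertexFlow q a| := by
      rw [← Finset.sum_neg_distrib, Finset.mul_sum]
      refine Finset.sum_le_sum fun a ha => ?_
      refine (neg_le_abs _).trans ?_
      rw [abs_mul]
      have := mul_le_mul_of_nonneg_left (abs_localPotential_le ha A.ω_le
        (D.mem_localSimplex_of_mem_policies hp ha)) (abs_nonneg (D.vertexFlow p a - D.vertexFlow q a))
      linarith
    have h5 := A.sum_W_mul_abs_le hq hp
    have h6 : 0 ≤ M := shift_nonneg hq p
    linarith
  have h3 : ∑ a ∈ D.inner, D.vertexFlow q a * ∑ b ∈ D.out a, q a b * (D.η a b * D.cHat κ c q b) ≤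
      K * D.value q c D.root := by
    refine le_trans ?_ (A.sum_vertexFlow_mul_η_le hq hc)
    refine Finset.sum_le_sum fun a ha => mul_le_mul_of_nonneg_left ?_ (D.vertexFlow_nonneg hq a)
    refine Finset.sum_le_sum fun b hb => mul_le_mul_of_nonneg_left ?_ (hq.1 a b)
    exact mul_le_mul_of_nonneg_left (cHat_le_value hκ c hq b) (D.η_pos (D.mem_out.1 hb)).le
  have h4 : 32 * κ * K * (D.value q c D.root - D.value p c D.root) ≤ M := by
    have h5 := D.sum_sinkMass_add_sum_inner q (D.cHat κ c q)
    simp only [cHat_sink] at h5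
    rw [D.sum_sinkMass_mul, hĉ] at h5
    have h6 : D.value q c D.root - D.value p c D.root = -∑ a ∈ D.inner, D.vertexFlow q a *
        (D.cHat κ c q a - ∑ b ∈ D.out a, q a b * D.cHat κ c q b) := by linarith
    rw [h6, ← Finset.sum_neg_distrib, Finset.mul_sum, hM, shift_eq_sum_inner]
    refine Finset.sum_le_sum fun a ha => ?_
    rw [← mul_neg, ← mul_assoc, mul_comm _ (D.vertexFlow q a), mul_assoc]
    refine mul_le_mul_of_nonneg_left ?_ (D.vertexFlow_nonneg hq a)
    rw [cHat_inner κ c q ha, neg_sub, ← Finset.sum_sub_distrib, Finset.mul_sum]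
    refine Finset.sum_le_sum fun b hb => ?_
    rw [← sub_mul, ← hpdef]
    calc 32 * κ * K * ((q a b - p a b) * D.cHat κ c q b)
        ≤ 32 * κ * K * (|p a b - q a b| * ε) := by
          refine mul_le_mul_of_nonneg_left ?_ (by positivity)
          refine (mul_le_mul_of_nonneg_right (le_abs_self _) (hĉ0 b)).trans ?_
          rw [abs_sub_comm]
          exact mul_le_mul_of_nonneg_left (hĉε b) (abs_nonneg _)
      _ = 32 * κ * K * ε * |p a b - q a b| := by ring
      _ ≤ _ := mul_le_mul_of_nonneg_right (hε' a b (D.mem_out.1 hb)) (abs_nonneg _)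
  have h5 := mul_le_mul_of_nonneg_left h3 (show 0 ≤ 8 * κ by positivity)
  linarith

end MarkedDAG

/-- There is a coupling of the weights `μ` and `ν` with transportation cost at most `r`. -/
def TransportCostLE {X : Type u} [Fintype X] [MetricSpace X] (μ ν : X → ℝ) (r : ℝ) : Prop :=
  ∃ J : X → X → ℝ, (∀ x y, 0 ≤ J x y) ∧ (∀ x, ∑ y, J x y = μ x) ∧ (∀ y, ∑ x, J x y = ν y) ∧
    ∑ x, ∑ y, J x y * dist x y ≤ r

namespace TransportCostLE

variable {X : Type u} [Fintype X] [MetricSpace X]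

theorem mono {μ ν : X → ℝ} {r r' : ℝ} (h : TransportCostLE μ ν r) (hr : r ≤ r') :
    TransportCostLE μ ν r' := by
  obtain ⟨J, h1, h2, h3, h4⟩ := h
  exact ⟨J, h1, h2, h3, h4.trans hr⟩

theorem refl {μ : X → ℝ} (hμ : ∀ x, 0 ≤ μ x) : TransportCostLE μ μ 0 := by
  classical
  refine ⟨fun x y => if x = y then μ x else 0, fun x y => ?_, fun x => by simp, fun y => by simp,
    (Finset.sum_eq_zero fun x _ => Finset.sum_eq_zero fun y _ => ?_).le⟩
  · dsimp only
    split_ifs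
    · exact hμ x
    · exact le_rfl
  · dsimp only
    split_ifs with h
    · simp [h]
    · simp

theorem trans {μ ν π : X → ℝ} {r s : ℝ} (h : TransportCostLE μ ν r) (h' : TransportCostLE ν π s) :
    TransportCostLE μ π (r + s) := by
  obtain ⟨J, h1, h2, h3, h4⟩ := h
  obtain ⟨J', h1', h2', h3', h4'⟩ := h'
  have hν : ∀ y, 0 ≤ ν y := fun y => h3 y ▸ Finset.sum_nonneg fun x _ => h1 x y
  have hJ : ∀ x y, J x y / ν y * ν y = J x y := by
    intro x y
    rcases eq_or_ne (ν y) 0 with h0 | h0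
    · rw [← h3 y, Finset.sum_eq_zero_iff_of_nonneg fun x _ => h1 x y] at h0
      simp [h0 x (Finset.mem_univ x)]
    · exact div_mul_cancel₀ _ h0
  have hJ' : ∀ y z, ν y * (J' y z / ν y) = J' y z := by
    intro y z
    rcases eq_or_ne (ν y) 0 with h0 | h0
    · have h5 := h2' y
      rw [h0, Finset.sum_eq_zero_iff_of_nonneg fun z _ => h1' y z] at h5
      simp [h5 z (Finset.mem_univ z)]
    · exact mul_div_cancel₀ _ h0
  have hrow : ∀ x y, ∑ z, J x y * J' y z / ν y = J x y := by
    intro x y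
    calc ∑ z, J x y * J' y z / ν y = J x y / ν y * ∑ z, J' y z := by
          rw [Finset.mul_sum]
          exact Finset.sum_congr rfl fun z _ => by ring
      _ = J x y := by rw [h2', hJ]
  have hcol : ∀ y z, ∑ x, J x y * J' y z / ν y = J' y z := by
    intro y z
    calc ∑ x, J x y * J' y z / ν y = (∑ x, J x y) * (J' y z / ν y) := by
          rw [Finset.sum_mul]
          exact Finset.sum_congr rfl fun z _ => by ring
      _ = J' y z := by rw [h3, hJ']
  refine ⟨fun x z => ∑ y, J x y * J' y z / ν y, fun x z => Finset.sum_nonneg fun y _ =>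
    div_nonneg (mul_nonneg (h1 x y) (h1' y z)) (hν y), fun x => ?_, fun z => ?_, ?_⟩
  · rw [Finset.sum_comm, ← h2 x]
    exact Finset.sum_congr rfl fun y _ => hrow x y
  · rw [Finset.sum_comm, ← h3' z]
    exact Finset.sum_congr rfl fun y _ => hcol y z
  · have e1 : ∑ x, ∑ y, J x y * dist x y = ∑ x, ∑ y, ∑ z, J x y * J' y z / ν y * dist x y := by
      refine Finset.sum_congr rfl fun x _ => Finset.sum_congr rfl fun y _ => ?_
      rw [← Finset.sum_mul, hrow]
    have e2 : ∑ y, ∑ z, J' y z * dist y z = ∑ x, ∑ y, ∑ z, J x y * J' y z / ν y * dist y z := by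
      symm
      rw [Finset.sum_comm]
      refine Finset.sum_congr rfl fun y _ => ?_
      rw [Finset.sum_comm]
      refine Finset.sum_congr rfl fun z _ => ?_
      rw [← Finset.sum_mul, hcol]
    have e3 : ∑ x, ∑ z, (∑ y, J x y * J' y z / ν y) * dist x z ≤
        ∑ x, ∑ y, ∑ z, J x y * J' y z / ν y * dist x y +
          ∑ x, ∑ y, ∑ z, J x y * J' y z / ν y * dist y z := by
      rw [← Finset.sum_add_distrib]
      refine Finset.sum_le_sum fun x _ => ?_
      simp only [Finset.sum_mul]
      rw [Finset.sum_comm, ← Finset.sum_add_distrib]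
      refine Finset.sum_le_sum fun y _ => ?_
      rw [← Finset.sum_add_distrib]
      refine Finset.sum_le_sum fun z _ => ?_
      rw [← mul_add]
      exact mul_le_mul_of_nonneg_left (dist_triangle x y z)
        (div_nonneg (mul_nonneg (h1 x y) (h1' y z)) (hν y))
    linarith

theorem of_diam {μ ν : X → ℝ} (hμ : ∀ x, 0 ≤ μ x) (hν : ∀ x, 0 ≤ ν x) (hμ1 : ∑ x, μ x = 1)
    (hν1 : ∑ x, ν x = 1) {r : ℝ} (hr : ∀ x y : X, dist x y ≤ r) : TransportCostLE μ ν r := by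
  refine ⟨fun x y => μ x * ν y, fun x y => mul_nonneg (hμ x) (hν y), fun x => ?_, fun y => ?_, ?_⟩
  · rw [← Finset.mul_sum, hν1, mul_one]
  · rw [← Finset.sum_mul, hμ1, one_mul]
  · calc ∑ x, ∑ y, μ x * ν y * dist x y ≤ ∑ x, ∑ y, μ x * ν y * r :=
          Finset.sum_le_sum fun x _ => Finset.sum_le_sum fun y _ =>
            mul_le_mul_of_nonneg_left (hr x y) (mul_nonneg (hμ x) (hν y))
      _ = r := by simp only [← Finset.sum_mul, ← Finset.mul_sum, hν1, hμ1, one_mul, mul_one]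

end TransportCostLE

theorem exists_excess_matching {ι : Type*} [DecidableEq ι] (s : Finset ι) (q p : ι → ℝ)
    (h : ∑ b ∈ s, q b = ∑ b ∈ s, p b) :
    ∃ R : ι → ι → ℝ, (∀ b b', 0 ≤ R b b') ∧ (∀ b, R b b = 0) ∧
      (∀ b ∈ s, ∑ b' ∈ s, R b b' = max (q b - p b) 0) ∧
      (∀ b' ∈ s, ∑ b ∈ s, R b b' = max (p b' - q b') 0) := by
  have hT : ∑ b ∈ s, max (q b - p b) 0 = ∑ b ∈ s, max (p b - q b) 0 := by
    rw [← sub_eq_zero, ← Finset.sum_sub_distrib]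
    have : ∀ b ∈ s, max (q b - p b) 0 - max (p b - q b) 0 = q b - p b := by
      intro b _
      rcases le_total (q b) (p b) with h | h
      · rw [max_eq_right (by linarith), max_eq_left (by linarith)]; ring
      · rw [max_eq_left (by linarith), max_eq_right (by linarith)]; ring
    rw [Finset.sum_congr rfl this, Finset.sum_sub_distrib, h, sub_self]
  set T := ∑ b ∈ s, max (q b - p b) 0 with hTdef
  have hz : T = 0 → ∀ b ∈ s, max (q b - p b) 0 = 0 := fun h0 =>
    (Finset.sum_eq_zero_iff_of_nonneg fun b _ => le_max_right _ _).1 h0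
  have hz' : T = 0 → ∀ b ∈ s, max (p b - q b) 0 = 0 := fun h0 =>
    (Finset.sum_eq_zero_iff_of_nonneg fun b _ => le_max_right _ _).1 (hT ▸ h0)
  have hT0 : 0 ≤ T := Finset.sum_nonneg fun b _ => le_max_right _ _
  refine ⟨fun b b' => max (q b - p b) 0 * max (p b' - q b') 0 / T, fun b b' => ?_, fun b => ?_,
    fun b hb => ?_, fun b' hb' => ?_⟩
  · exact div_nonneg (mul_nonneg (le_max_right _ _) (le_max_right _ _)) hT0
  · dsimp only
    rcases le_total (q b) (p b) with h | h
    · rw [max_eq_right (sub_nonpos.2 h)]; simp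
    · rw [max_eq_right (sub_nonpos.2 h)]; simp
  · rw [← Finset.sum_div, ← Finset.mul_sum, ← hT]
    rcases eq_or_ne T 0 with h0 | h0
    · simp [hz h0 b hb]
    · exact mul_div_cancel_right₀ _ h0
  · rw [← Finset.sum_div, ← Finset.sum_mul]
    rcases eq_or_ne T 0 with h0 | h0
    · simp [hz' h0 b' hb']
    · exact mul_div_cancel_left₀ _ h0

namespace FlowDAG

variable {X : Type u} (D : FlowDAG X)

open scoped Classical in
/-- The expected sum of `g` over the vertices, other than the sink, that are visited from a vertex
under `q`. -/
def charge (q : D.V → D.V → ℝ) (g : D.V → ℝ) : D.V → ℝ :=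
  D.wellFounded_adj_swap.fix fun a rec =>
    if ∃ x : X, D.sink x = a then 0
    else g a + ∑ b, if hb : D.Adj a b then q a b * rec b hb else 0

theorem charge_sink (q : D.V → D.V → ℝ) (g : D.V → ℝ) (x : X) :
    D.charge q g (D.sink x) = 0 := by
  unfold charge
  rw [WellFounded.fix_eq, if_pos ⟨x, rfl⟩]

theorem charge_inner (q : D.V → D.V → ℝ) (g : D.V → ℝ) {a : D.V} (h : a ∈ D.inner) :
    D.charge q g a = g a + ∑ b ∈ D.out a, q a b * D.charge q g b := by
  classical
  conv_lhs => unfold charge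
  rw [WellFounded.fix_eq, if_neg (D.mem_inner.1 h), out, Finset.sum_filter]
  congr 1

theorem charge_root [Fintype X] (q : D.V → D.V → ℝ) (g : D.V → ℝ) :
    D.charge q g D.root = ∑ a ∈ D.inner, D.vertexFlow q a * g a := by
  rw [← D.sum_sinkMass_add_sum_inner q (D.charge q g)]
  simp only [charge_sink, mul_zero, Finset.sum_const_zero, zero_add]
  refine Finset.sum_congr rfl fun a ha => ?_
  rw [D.charge_inner q g ha, add_sub_cancel_right]

open scoped Classical in
/-- The probability that the sink of `x` is reached from `v` under `q`. -/
def hit (q : D.V → D.V → ℝ) (v : D.V) (x : X) : ℝ := D.value q (Pi.single x 1) v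

theorem hit_root [Fintype X] (q : D.V → D.V → ℝ) (x : X) : D.hit q D.root x = D.sinkMass q x := by
  classical
  unfold hit
  rw [← D.sum_sinkMass_mul, Finset.sum_eq_single x]
  · simp
  · intro y _ hy
    simp [Pi.single_eq_of_ne hy]
  · simp

theorem hit_inner (q : D.V → D.V → ℝ) {a : D.V} (h : a ∈ D.inner) (x : X) :
    D.hit q a x = ∑ b ∈ D.out a, q a b * D.hit q b x := D.value_inner q _ h

open scoped Classical in
theorem hit_sink (q : D.V → D.V → ℝ) (x y : X) :
    D.hit q (D.sink y) x = if y = x then 1 else 0 := by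
  unfold hit
  rw [value_sink, Pi.single_apply]

theorem hit_nonneg {q : D.V → D.V → ℝ} (hq : q ∈ D.policies) (v : D.V) (x : X) :
    0 ≤ D.hit q v x := by
  classical
  induction v using D.sink_induction with
  | hsink y => rw [hit_sink]; split_ifs <;> norm_num
  | hinner a ha ih =>
    rw [D.hit_inner q ha]
    exact Finset.sum_nonneg fun b hb => mul_nonneg (hq.1 a b) (ih b hb)

theorem sum_hit [Fintype X] {q : D.V → D.V → ℝ} (hq : q ∈ D.policies) (v : D.V) :
    ∑ x, D.hit q v x = 1 := by
  classical
  induction v using D.sink_induction with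
  | hsink y => simp [hit_sink]
  | hinner a ha ih =>
    simp only [D.hit_inner q ha]
    rw [Finset.sum_comm, ← hq.2.2 a (D.mem_inner.1 ha)]
    refine Finset.sum_congr rfl fun b hb => ?_
    rw [← Finset.mul_sum, ih b hb, mul_one]

theorem mem_of_hit_ne_zero (q : D.V → D.V → ℝ) {S : D.V → Set X} (hS : ∀ x, x ∈ S (D.sink x))
    (hmono : ∀ a b, D.Adj a b → S b ⊆ S a) (v : D.V) (x : X) (h : D.hit q v x ≠ 0) : x ∈ S v := by
  classical
  induction v using D.sink_induction with
  | hsink y =>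
    rw [hit_sink] at h
    have : y = x := by by_contra hne; simp [hne] at h
    exact this ▸ hS y
  | hinner a ha ih =>
    rw [D.hit_inner q ha] at h
    obtain ⟨b, hb, hne⟩ := Finset.exists_ne_zero_of_sum_ne_zero h
    exact hmono a b (D.mem_out.1 hb) (ih b hb (right_ne_zero_of_mul hne))

end FlowDAG

namespace MarkedDAG

variable {X : Type u} [Fintype X] [MetricSpace X] {D : MarkedDAG X} {K σ : ℝ}

theorem Adapted.sum_hit_mul_hit_mul_dist_le (A : D.Adapted K σ) {q p : D.V → D.V → ℝ}
    (hq : q ∈ D.policies) (hp : p ∈ D.policies) {a b b' : D.V} (hb : D.Adj a b) (hb' : D.Adj a b')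
    (hne : b ≠ b') :
    ∑ x, ∑ y, D.hit q b x * D.hit p b' y * dist x y ≤ D.ω a b + D.ω a b' := by
  calc ∑ x, ∑ y, D.hit q b x * D.hit p b' y * dist x y
      ≤ ∑ x, ∑ y, D.hit q b x * D.hit p b' y * (D.ω a b + D.ω a b') := by
        refine Finset.sum_le_sum fun x _ => Finset.sum_le_sum fun y _ => ?_
        by_cases h : D.hit q b x * D.hit p b' y = 0
        · simp [h]
        · refine mul_le_mul_of_nonneg_left ?_
            (mul_nonneg (D.hit_nonneg hq b x) (D.hit_nonneg hp b' y))
          exact A.dist_le a b b' hb hb' hne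
            x (D.mem_of_hit_ne_zero q A.mem_S_sink A.S_mono b x (left_ne_zero_of_mul h))
            y (D.mem_of_hit_ne_zero p A.mem_S_sink A.S_mono b' y (right_ne_zero_of_mul h))
    _ = _ := by
        simp only [← Finset.sum_mul, ← Finset.mul_sum, D.sum_hit hq, D.sum_hit hp, one_mul]

theorem Adapted.transportCostLE_hit (A : D.Adapted K σ) {q p : D.V → D.V → ℝ}
    (hq : q ∈ D.policies) (hp : p ∈ D.policies) (v : D.V) :
    TransportCostLE (D.hit q v) (D.hit p v)
      (D.charge q (fun a => ∑ b ∈ D.out a, D.ω a b * |p a b - q a b|) v) := by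
  classical
  set g : D.V → ℝ := fun a => ∑ b ∈ D.out a, D.ω a b * |p a b - q a b| with hg
  induction v using D.sink_induction with
  | hsink x =>
    rw [D.charge_sink]
    have : D.hit q (D.sink x) = D.hit p (D.sink x) := by
      funext y; rw [D.hit_sink, D.hit_sink]
    rw [this]
    exact TransportCostLE.refl (D.hit_nonneg hp _)
  | hinner a ha ih =>
    choose! J hJ0 hJr hJc hJd using ih
    obtain ⟨R, hR0, hRd, hRr, hRc⟩ := exists_excess_matching (D.out a) (q a) (p a)
      ((hq.2.2 a (D.mem_inner.1 ha)).trans (hp.2.2 a (D.mem_inner.1 ha)).symm)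
    have hmin : ∀ s t : ℝ, min s t + max (s - t) 0 = s := by
      intro s t
      rcases le_total s t with h | h
      · rw [min_eq_left h, max_eq_right (by linarith)]; ring
      · rw [min_eq_right h, max_eq_left (by linarith)]; ring
    have hm0 : ∀ b, 0 ≤ min (q a b) (p a b) := fun b => le_min (hq.1 a b) (hp.1 a b)
    refine ⟨fun x y => ∑ b ∈ D.out a, min (q a b) (p a b) * J b x y +
      ∑ b ∈ D.out a, ∑ b' ∈ D.out a, R b b' * (D.hit q b x * D.hit p b' y), ?_, ?_, ?_, ?_⟩
    · intro x y
      refine add_nonneg (Finset.sum_nonneg fun b hb => mul_nonneg (hm0 b) (hJ0 b hb x y))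
        (Finset.sum_nonneg fun b _ => Finset.sum_nonneg fun b' _ => mul_nonneg (hR0 b b')
          (mul_nonneg (D.hit_nonneg hq b x) (D.hit_nonneg hp b' y)))
    · intro x
      rw [Finset.sum_add_distrib, Finset.sum_comm, Finset.sum_comm (s := Finset.univ),
        ← Finset.sum_add_distrib, D.hit_inner q ha]
      refine Finset.sum_congr rfl fun b hb => ?_
      rw [← Finset.mul_sum, hJr b hb x, Finset.sum_comm]
      simp only [← Finset.mul_sum, D.sum_hit hp, mul_one]
      rw [← Finset.sum_mul, hRr b hb, ← add_mul, hmin]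
    · intro y
      rw [Finset.sum_add_distrib, Finset.sum_comm, Finset.sum_comm (s := Finset.univ)]
      have : ∑ b ∈ D.out a, ∑ x, ∑ b' ∈ D.out a, R b b' * (D.hit q b x * D.hit p b' y) =
          ∑ b' ∈ D.out a, max (p a b' - q a b') 0 * D.hit p b' y := by
        have e : ∀ b ∈ D.out a, ∑ x, ∑ b' ∈ D.out a, R b b' * (D.hit q b x * D.hit p b' y) =
            ∑ b' ∈ D.out a, R b b' * D.hit p b' y := by
          intro b _
          rw [Finset.sum_comm]
          refine Finset.sum_congr rfl fun b' _ => ?_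
          rw [← Finset.mul_sum, ← Finset.sum_mul, D.sum_hit hq, one_mul]
        rw [Finset.sum_congr rfl e, Finset.sum_comm]
        refine Finset.sum_congr rfl fun b' hb' => ?_
        rw [← Finset.sum_mul, hRc b' hb']
      rw [this, ← Finset.sum_add_distrib, D.hit_inner p ha]
      refine Finset.sum_congr rfl fun b hb => ?_
      rw [← Finset.mul_sum, hJc b hb y, ← add_mul, min_comm, hmin]
    · rw [D.charge_inner q g ha]
      have e1 : ∑ x, ∑ y, (∑ b ∈ D.out a, min (q a b) (p a b) * J b x y) * dist x y ≤
          ∑ b ∈ D.out a, q a b * D.charge q g b := by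
        have : ∑ x, ∑ y, (∑ b ∈ D.out a, min (q a b) (p a b) * J b x y) * dist x y =
            ∑ b ∈ D.out a, min (q a b) (p a b) * ∑ x, ∑ y, J b x y * dist x y := by
          simp only [Finset.sum_mul, Finset.mul_sum]
          rw [Finset.sum_comm_cycle]
          refine Finset.sum_congr rfl fun b _ => Finset.sum_congr rfl fun x _ =>
            Finset.sum_congr rfl fun y _ => by ring
        rw [this]
        refine Finset.sum_le_sum fun b hb => ?_
        have h1 : 0 ≤ ∑ x, ∑ y, J b x y * dist x y := Finset.sum_nonneg fun x _ =>
          Finset.sum_nonneg fun y _ => mul_nonneg (hJ0 b hb x y) dist_nonneg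
        exact mul_le_mul (min_le_left _ _) (hJd b hb) h1 (hq.1 a b)
      have e2 : ∑ x, ∑ y, (∑ b ∈ D.out a, ∑ b' ∈ D.out a,
          R b b' * (D.hit q b x * D.hit p b' y)) * dist x y ≤ g a := by
        have : ∑ x, ∑ y, (∑ b ∈ D.out a, ∑ b' ∈ D.out a,
            R b b' * (D.hit q b x * D.hit p b' y)) * dist x y =
            ∑ b ∈ D.out a, ∑ b' ∈ D.out a, R b b' *
              ∑ x, ∑ y, D.hit q b x * D.hit p b' y * dist x y := by
          simp only [Finset.sum_mul, Finset.mul_sum]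
          rw [Finset.sum_comm_cycle]
          refine Finset.sum_congr rfl fun b _ => ?_
          rw [Finset.sum_comm_cycle]
          exact Finset.sum_congr rfl fun b' _ => Finset.sum_congr rfl fun x _ =>
            Finset.sum_congr rfl fun y _ => by ring
        rw [this]
        have h1 : ∑ b ∈ D.out a, ∑ b' ∈ D.out a, R b b' *
              ∑ x, ∑ y, D.hit q b x * D.hit p b' y * dist x y ≤
            ∑ b ∈ D.out a, ∑ b' ∈ D.out a, R b b' * (D.ω a b + D.ω a b') := by
          refine Finset.sum_le_sum fun b hb => Finset.sum_le_sum fun b' hb' => ?_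
          rcases eq_or_ne b b' with rfl | hne
          · simp [hRd]
          · exact mul_le_mul_of_nonneg_left (A.sum_hit_mul_hit_mul_dist_le hq hp
              (D.mem_out.1 hb) (D.mem_out.1 hb') hne) (hR0 b b')
        refine h1.trans_eq ?_
        simp only [mul_add, Finset.sum_add_distrib]
        rw [Finset.sum_comm (f := fun b b' => R b b' * D.ω a b'), ← Finset.sum_add_distrib, hg]
        refine Finset.sum_congr rfl fun b hb => ?_
        rw [← Finset.sum_mul, ← Finset.sum_mul, hRr b hb, hRc b hb, ← add_mul, mul_comm]
        congr 1
        rcases le_total (q a b) (p a b) with h | h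
        · rw [max_eq_right (by linarith), max_eq_left (by linarith), abs_of_nonneg (by linarith)]
          ring
        · rw [max_eq_left (by linarith), max_eq_right (by linarith), abs_of_nonpos (by linarith)]
          ring
      simp only [add_mul, Finset.sum_add_distrib]
      linarith

theorem Adapted.transportCostLE_sinkMass (A : D.Adapted K σ) {q p : D.V → D.V → ℝ}
    (hq : q ∈ D.policies) (hp : p ∈ D.policies) :
    TransportCostLE (D.sinkMass q) (D.sinkMass p) (D.shift q p) := by
  have h := A.transportCostLE_hit hq hp D.root
  rw [D.charge_root, ← shift_eq_sum_inner] at h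
  have e : ∀ r : D.V → D.V → ℝ, D.hit r D.root = D.sinkMass r := fun r => by
    funext x; exact D.hit_root r x
  rwa [e, e] at h

end MarkedDAG

open MeasureTheory in
/-- The uniform distribution on the unit interval. -/
def unitUniform : Measure ℝ := volume.restrict (Set.Icc 0 1)

namespace unitUniform

open MeasureTheory

instance : IsProbabilityMeasure unitUniform := by
  constructor
  simp [unitUniform]

theorem exists_subset_real_eq {S : Set ℝ} (hS : MeasurableSet S) {m : ℝ} (hm : 0 ≤ m)
    (hmS : m ≤ unitUniform.real S) :
    ∃ T ⊆ S, MeasurableSet T ∧ unitUniform.real T = m := by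
  set f : ℝ → ℝ := fun t => unitUniform.real (S ∩ Set.Iic t) with hf
  have hlip : ∀ s t, s ≤ t → f t ≤ f s + (t - s) := by
    intro s t hst
    have h1 : S ∩ Set.Iic t ⊆ (S ∩ Set.Iic s) ∪ Set.Ioc s t := by
      rintro x ⟨hx, hxt⟩
      rcases le_or_gt x s with h | h
      · exact Or.inl ⟨hx, h⟩
      · exact Or.inr ⟨h, hxt⟩
    have h2 : unitUniform.real (Set.Ioc s t) ≤ t - s := by
      have : unitUniform (Set.Ioc s t) ≤ volume (Set.Ioc s t) := Measure.restrict_apply_le _ _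
      rw [Real.volume_Ioc] at this
      exact ENNReal.toReal_le_of_le_ofReal (by linarith) this
    have h3 := (measureReal_mono h1).trans (measureReal_union_le (μ := unitUniform) _ _)
    simp only [hf]
    linarith
  have hmono : ∀ s t, s ≤ t → f s ≤ f t := fun s t hst =>
    measureReal_mono (Set.inter_subset_inter_right _ (Set.Iic_subset_Iic.2 hst))
  have hcont : Continuous f := by
    refine LipschitzWith.continuous (K := 1) (LipschitzWith.of_le_add fun s t => ?_)
    rw [Real.dist_eq]
    rcases le_total s t with h | h
    · have := hmono s t h
      have := abs_nonneg (s - t)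
      linarith
    · have := hlip t s h
      have := le_abs_self (s - t)
      linarith
  have h0 : f (-1) = 0 := by
    have : unitUniform (S ∩ Set.Iic (-1)) = 0 := by
      refine measure_mono_null Set.inter_subset_right ?_
      unfold unitUniform
      rw [Measure.restrict_apply measurableSet_Iic]
      have : Set.Iic (-1 : ℝ) ∩ Set.Icc 0 1 = ∅ := by
        ext x
        simp only [Set.mem_inter_iff, Set.mem_Iic, Set.mem_Icc, Set.mem_empty_iff_false, iff_false]
        intro h
        linarith [h.1, h.2.1]
      rw [this, measure_empty]
    simp [hf, measureReal_def, this]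
  have h1 : f 1 = unitUniform.real S := by
    have : unitUniform (S ∩ Set.Iic 1) = unitUniform S := by
      unfold unitUniform
      rw [Measure.restrict_apply (hS.inter measurableSet_Iic), Measure.restrict_apply hS]
      congr 1
      ext x
      simp only [Set.mem_inter_iff, Set.mem_Iic, Set.mem_Icc]
      tauto
    simp [hf, measureReal_def, this]
  obtain ⟨t, _, ht⟩ := intermediate_value_Icc (by norm_num : (-1 : ℝ) ≤ 1) hcont.continuousOn
    (show m ∈ Set.Icc (f (-1)) (f 1) from ⟨h0 ▸ hm, h1 ▸ hmS⟩)
  exact ⟨S ∩ Set.Iic t, Set.inter_subset_left, hS.inter measurableSet_Iic, ht⟩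

open scoped Classical in
theorem exists_split {X : Type u} [Nonempty X] (w : X → ℝ) (hw : ∀ x, 0 ≤ w x) (T : Finset X) :
    ∀ S : Set ℝ, MeasurableSet S → ∑ x ∈ T, w x = unitUniform.real S →
      ∃ A : ℝ → X, (∀ x, MeasurableSet (A ⁻¹' {x})) ∧
        ∀ x, unitUniform.real (S ∩ A ⁻¹' {x}) = if x ∈ T then w x else 0 := by
  induction T using Finset.induction_on with
  | empty =>
    intro S hS h
    obtain ⟨x₀⟩ := ‹Nonempty X›
    refine ⟨fun _ => x₀, fun x => MeasurableSet.const _, fun x => ?_⟩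
    rw [Finset.sum_empty] at h
    have := measureReal_mono (μ := unitUniform)
      (Set.inter_subset_left : S ∩ (fun _ => x₀) ⁻¹' {x} ⊆ S)
    simp only [Finset.notMem_empty, if_false]
    exact le_antisymm (by linarith) measureReal_nonneg
  | insert x₀ T hx₀ ih =>
    intro S hS h
    rw [Finset.sum_insert hx₀] at h
    have hT0 : 0 ≤ ∑ x ∈ T, w x := Finset.sum_nonneg fun x _ => hw x
    obtain ⟨S', hS'S, hS', hS'm⟩ := exists_subset_real_eq hS (hw x₀) (by linarith)
    have hd : unitUniform.real (S \ S') = unitUniform.real S - unitUniform.real S' :=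
      measureReal_sdiff hS'S hS'
    obtain ⟨A, hA, hAm⟩ := ih (S \ S') (hS.diff hS') (by rw [hd]; linarith)
    refine ⟨fun s => if s ∈ S' then x₀ else A s, fun x => ?_, fun x => ?_⟩
    · have : (fun s => if s ∈ S' then x₀ else A s) ⁻¹' {x} =
          (S' ∩ (fun _ => x₀) ⁻¹' {x}) ∪ (S'ᶜ ∩ A ⁻¹' {x}) := by
        ext s
        by_cases hs : s ∈ S' <;> simp [hs]
      rw [this]
      exact (hS'.inter (MeasurableSet.const _)).union (hS'.compl.inter (hA x))
    · rcases eq_or_ne x x₀ with rfl | hne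
      · have : S ∩ (fun s => if s ∈ S' then x else A s) ⁻¹' {x} =
            S' ∪ ((S \ S') ∩ A ⁻¹' {x}) := by
          ext s
          by_cases hs : s ∈ S'
          · simp [hs, hS'S hs]
          · simp [hs]
        rw [this, measureReal_union _ ((hS.diff hS').inter (hA x)), hAm x, hS'm]
        · simp [hx₀]
        · exact Set.disjoint_left.2 fun s hs hs' => hs'.1.2 hs
      · have : S ∩ (fun s => if s ∈ S' then x₀ else A s) ⁻¹' {x} = (S \ S') ∩ A ⁻¹' {x} := by
          ext s
          by_cases hs : s ∈ S'
          · simp [hs, hne.symm]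
          · simp [hs]
        rw [this, hAm x]
        simp [hne]

theorem exists_extension {X : Type u} [Fintype X] [Nonempty X] {A : ℝ → X}
    (hA : ∀ x, MeasurableSet (A ⁻¹' {x})) {J : X → X → ℝ} (hJ : ∀ x y, 0 ≤ J x y)
    (hrow : ∀ x, ∑ y, J x y = unitUniform.real (A ⁻¹' {x})) :
    ∃ B : ℝ → X, (∀ y, MeasurableSet (B ⁻¹' {y})) ∧
      ∀ x y, unitUniform.real (A ⁻¹' {x} ∩ B ⁻¹' {y}) = J x y := by
  classical
  choose B hB hBm using fun x => exists_split (J x) (hJ x) Finset.univ (A ⁻¹' {x}) (hA x) (hrow x)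
  refine ⟨fun s => B (A s) s, fun y => ?_, fun x y => ?_⟩
  · have : (fun s => B (A s) s) ⁻¹' {y} = ⋃ x, A ⁻¹' {x} ∩ B x ⁻¹' {y} := by
      ext s
      simp
    rw [this]
    exact MeasurableSet.iUnion fun x => (hA x).inter (hB x y)
  · have : A ⁻¹' {x} ∩ (fun s => B (A s) s) ⁻¹' {y} = A ⁻¹' {x} ∩ B x ⁻¹' {y} := by
      ext s
      simp only [Set.mem_inter_iff, Set.mem_preimage, Set.mem_singleton_iff]
      constructor
      · rintro ⟨rfl, h⟩
        exact ⟨rfl, h⟩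
      · rintro ⟨rfl, h⟩
        exact ⟨rfl, h⟩
    rw [this, hBm]
    simp

theorem lintegral_comp {X : Type u} [Fintype X] {A : ℝ → X}
    (hA : ∀ x, MeasurableSet (A ⁻¹' {x})) (f : X → ℝ) (hf : ∀ x, 0 ≤ f x) :
    ∫⁻ s, ENNReal.ofReal (f (A s)) ∂unitUniform =
      ENNReal.ofReal (∑ x, unitUniform.real (A ⁻¹' {x}) * f x) := by
  classical
  have h1 : ∀ s, ENNReal.ofReal (f (A s)) =
      ∑ x, (A ⁻¹' {x}).indicator (fun _ => ENNReal.ofReal (f x)) s := by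
    intro s
    rw [Finset.sum_eq_single (A s)]
    · simp
    · intro x _ hx
      simp [Set.indicator, hx.symm]
    · simp
  simp only [h1]
  rw [lintegral_finsetSum _ fun x _ => measurable_const.indicator (hA x),
    ENNReal.ofReal_sum_of_nonneg fun x _ => mul_nonneg measureReal_nonneg (hf x)]
  refine Finset.sum_congr rfl fun x _ => ?_
  rw [lintegral_indicator_const (hA x), ENNReal.ofReal_mul measureReal_nonneg, mul_comm,
    ofReal_measureReal]

theorem lintegral_comp₂ {X : Type u} [Fintype X] {A B : ℝ → X}
    (hA : ∀ x, MeasurableSet (A ⁻¹' {x})) (hB : ∀ x, MeasurableSet (B ⁻¹' {x}))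
    (f : X → X → ℝ) (hf : ∀ x y, 0 ≤ f x y) :
    ∫⁻ s, ENNReal.ofReal (f (A s) (B s)) ∂unitUniform =
      ENNReal.ofReal (∑ x, ∑ y, unitUniform.real (A ⁻¹' {x} ∩ B ⁻¹' {y}) * f x y) := by
  have hpre : ∀ z : X × X, (fun s => (A s, B s)) ⁻¹' {z} = A ⁻¹' {z.1} ∩ B ⁻¹' {z.2} := by
    rintro ⟨x, y⟩
    ext s
    simp
  have := lintegral_comp (A := fun s => (A s, B s))
    (fun z => by rw [hpre]; exact (hA _).inter (hB _)) (fun z => f z.1 z.2) (fun z => hf _ _)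
  simp only [hpre, Fintype.sum_prod_type] at this
  exact this

end unitUniform

section Algorithm

variable {X : Type u} [Fintype X] [MetricSpace X]

/-- A family of laws, one for each cost history, in which consecutive laws can be coupled at
cost `r`, is realized by a random online algorithm. -/
theorem exists_realization [Nonempty X] (law : (t : ℕ) → (Fin t → X → ℝ≥0) → X → ℝ)
    (r : (t : ℕ) → (Fin (t + 1) → X → ℝ≥0) → ℝ) (x₀ : X)
    (h0 : ∀ h, law 0 h = fun x => (open scoped Classical in if x₀ = x then 1 else 0))
    (hstep : ∀ t h, TransportCostLE (law t fun i => h i.castSucc) (law (t + 1) h) (r t h)) :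
    ∃ A : (t : ℕ) → (Fin t → X → ℝ≥0) → ℝ → X, (∀ h s, A 0 h s = x₀) ∧
      (∀ t h x, MeasurableSet (A t h ⁻¹' {x})) ∧
      (∀ t h x, unitUniform.real (A t h ⁻¹' {x}) = law t h x) ∧
      ∀ t h, ∑ x, ∑ y, unitUniform.real
        (A t (fun i => h i.castSucc) ⁻¹' {x} ∩ A (t + 1) h ⁻¹' {y}) * dist x y ≤ r t h := by
  classical
  have hnext : ∀ t h (A : {A : ℝ → X // (∀ x, MeasurableSet (A ⁻¹' {x})) ∧
      ∀ x, unitUniform.real (A ⁻¹' {x}) = law t (fun i => h i.castSucc) x}),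
      ∃ B : {B : ℝ → X // (∀ x, MeasurableSet (B ⁻¹' {x})) ∧
        ∀ x, unitUniform.real (B ⁻¹' {x}) = law (t + 1) h x},
        ∑ x, ∑ y, unitUniform.real (A.1 ⁻¹' {x} ∩ B.1 ⁻¹' {y}) * dist x y ≤ r t h := by
    rintro t h ⟨A, hA, hAm⟩
    obtain ⟨J, hJ, hrow, hcol, hcost⟩ := hstep t h
    obtain ⟨B, hB, hBm⟩ := unitUniform.exists_extension hA hJ
      fun x => (hrow x).trans (hAm x).symm
    refine ⟨⟨B, hB, fun y => ?_⟩, ?_⟩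
    · rw [← hcol y, ← Finset.sum_congr rfl fun x _ => hBm x y]
      have : B ⁻¹' {y} = ⋃ x ∈ Finset.univ, (A ⁻¹' {x} ∩ B ⁻¹' {y}) := by
        ext s
        simp
      conv_lhs => rw [this]
      rw [MeasureTheory.measureReal_biUnion_finset]
      · intro x _ x' _ hne
        exact Set.disjoint_left.2 fun s hs hs' => hne (hs.1.symm.trans hs'.1)
      · exact fun x _ => (hA x).inter (hB y)
    · simpa only [hBm] using hcost
  choose next hnext using hnext
  let base : (h : Fin 0 → X → ℝ≥0) → {A : ℝ → X // (∀ x, MeasurableSet (A ⁻¹' {x})) ∧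
      ∀ x, unitUniform.real (A ⁻¹' {x}) = law 0 h x} := fun h =>
    ⟨fun _ => x₀, fun x => MeasurableSet.const _, fun x => by
      rw [h0]
      by_cases hx : x₀ = x
      · simp [hx]
      · simp [hx]⟩
  let state : (t : ℕ) → (h : Fin t → X → ℝ≥0) → {A : ℝ → X //
      (∀ x, MeasurableSet (A ⁻¹' {x})) ∧ ∀ x, unitUniform.real (A ⁻¹' {x}) = law t h x} :=
    fun t => Nat.rec base (fun t ih h => next t h (ih fun i => h i.castSucc)) t
  exact ⟨fun t h => (state t h).1, fun h s => rfl, fun t h => (state t h).2.1,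
    fun t h => (state t h).2.2, fun t h => hnext t h (state t fun i => h i.castSucc)⟩

end Algorithm

namespace MarkedDAG

variable {X : Type u} {D : MarkedDAG X}

theorem iterate_mirrorStep_mem_policies (κ : ℝ) (c : X → ℝ) {q : D.V → D.V → ℝ}
    (hq : q ∈ D.policies) (n : ℕ) : (D.mirrorStep κ c)^[n] q ∈ D.policies := by
  cases n with
  | zero => exact hq
  | succ n =>
    rw [Function.iterate_succ_apply']
    exact mirrorStep_mem_policies κ c _

theorem mirrorDescent_mem_policies (κ : ℝ) (N : (X → ℝ≥0) → ℕ) {p₀ : D.V → D.V → ℝ}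
    (hp₀ : p₀ ∈ D.policies) (t : ℕ) (h : Fin t → X → ℝ≥0) :
    D.mirrorDescent κ N p₀ t h ∈ D.policies := by
  induction t with
  | zero => exact hp₀
  | succ t ih => exact iterate_mirrorStep_mem_policies κ _ (ih _) _

theorem value_mirrorStep_le {κ : ℝ} (hκ : 0 < κ) (c : X → ℝ) {q : D.V → D.V → ℝ}
    (hq : q ∈ D.policies) (v : D.V) : D.value (D.mirrorStep κ c q) c v ≤ D.value q c v := by
  rw [← cHat_eq_value]
  exact cHat_le_value hκ c hq v

theorem value_div (q : D.V → D.V → ℝ) (c : X → ℝ) (n : ℝ) (v : D.V) :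
    D.value q (fun x => c x / n) v = D.value q c v / n := by
  induction v using D.sink_induction with
  | hsink x => rw [D.value_sink, D.value_sink]
  | hinner a ha ih =>
    rw [D.value_inner _ _ ha, D.value_inner _ _ ha, Finset.sum_div]
    exact Finset.sum_congr rfl fun b hb => by rw [ih b hb, mul_div_assoc]

/-- The service cost of `n` consecutive mirror descent steps, each with costs `c`. -/
def iterateService (D : MarkedDAG X) (κ : ℝ) (c : X → ℝ) (q : D.V → D.V → ℝ) (n : ℕ) : ℝ :=
  ∑ j ∈ Finset.range n, D.value ((D.mirrorStep κ c)^[j + 1] q) c D.root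

theorem mul_value_iterate_le {κ : ℝ} (hκ : 0 < κ) (c : X → ℝ) {q : D.V → D.V → ℝ}
    (hq : q ∈ D.policies) (n : ℕ) :
    n * D.value ((D.mirrorStep κ c)^[n] q) c D.root ≤ D.iterateService κ c q n := by
  induction n with
  | zero => simp [iterateService]
  | succ n ih =>
    unfold iterateService at ih ⊢
    rw [Finset.sum_range_succ]
    have h := value_mirrorStep_le hκ c (iterate_mirrorStep_mem_policies κ c hq n) D.root
    rw [← Function.iterate_succ_apply' (D.mirrorStep κ c)] at h
    have h2 := mul_le_mul_of_nonneg_left h (Nat.cast_nonneg (α := ℝ) n)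
    push_cast
    linarith

theorem flowDiv_iterate_le [Fintype X] {κ : ℝ} (hκ : 0 < κ) (c : X → ℝ) {l q : D.V → D.V → ℝ}
    (hl : l ∈ D.policies) (hq : q ∈ D.policies) (n : ℕ) :
    D.flowDiv κ l ((D.mirrorStep κ c)^[n] q) + D.iterateService κ c q n ≤
      D.flowDiv κ l q + n * D.value l c D.root := by
  induction n with
  | zero => simp [iterateService]
  | succ n ih =>
    unfold iterateService at ih ⊢
    rw [Finset.sum_range_succ]
    have h := flowDiv_mirrorStep_le hκ c hl (iterate_mirrorStep_mem_policies κ c hq n)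
    rw [← Function.iterate_succ_apply' (D.mirrorStep κ c)] at h
    push_cast
    linarith

theorem Adapted.transportCostLE_iterate [Fintype X] [MetricSpace X] {K σ : ℝ}
    (A : D.Adapted K σ) {κ ε : ℝ} (hκ : 0 < κ) (hK : 0 < K) {c : X → ℝ}
    (hc : ∀ x, 0 ≤ c x) (hcε : ∀ x, c x ≤ ε)
    (hε : ∀ a b, D.Adj a b → κ * D.η a b * ε ≤ D.ω a b)
    (hε' : ∀ a b, D.Adj a b → 32 * κ * K * ε ≤ D.ω a b)
    {q : D.V → D.V → ℝ} (hq : q ∈ D.policies) (n : ℕ) :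
    TransportCostLE (D.sinkMass q) (D.sinkMass ((D.mirrorStep κ c)^[n] q))
      (2 * (D.flowPotential ((D.mirrorStep κ c)^[n] q) - D.flowPotential q) +
        16 * κ * K * D.iterateService κ c q n) := by
  induction n with
  | zero => exact (TransportCostLE.refl (D.sinkMass_nonneg hq)).mono (by simp [iterateService])
  | succ n ih =>
    have hqn := iterate_mirrorStep_mem_policies κ c hq n
    have h := A.shift_mirrorStep_le hκ hK hc hcε hε hε' hqn
    have h2 := A.transportCostLE_sinkMass hqn
      (mirrorStep_mem_policies κ c ((D.mirrorStep κ c)^[n] q))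
    rw [← Function.iterate_succ_apply' (D.mirrorStep κ c)] at h h2
    refine (ih.trans h2).mono ?_
    unfold iterateService
    rw [Finset.sum_range_succ]
    linarith

/-- One round of the mirror descent trajectory: the cost function `c` is served in `n` pieces. -/
theorem Adapted.round_le [Fintype X] [MetricSpace X] {K σ : ℝ}
    (A : D.Adapted K σ) {κ ε : ℝ} (hκ : 0 < κ) (hK : 0 < K)
    (hε : ∀ a b, D.Adj a b → κ * D.η a b * ε ≤ D.ω a b)
    (hε' : ∀ a b, D.Adj a b → 32 * κ * K * ε ≤ D.ω a b)
    {q : D.V → D.V → ℝ} (hq : q ∈ D.policies) (c : X → ℝ≥0) (n : ℕ)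
    (hn : ∀ x, (c x : ℝ) ≤ n * ε) :
    ∃ s : ℝ, D.value ((D.mirrorStep κ fun x => (c x : ℝ) / n)^[n] q) (fun x => (c x : ℝ)) D.root ≤ s ∧
      (∀ l ∈ D.policies, D.flowDiv κ l ((D.mirrorStep κ fun x => (c x : ℝ) / n)^[n] q) + s ≤
        D.flowDiv κ l q + D.value l (fun x => (c x : ℝ)) D.root) ∧
      TransportCostLE (D.sinkMass q) (D.sinkMass ((D.mirrorStep κ fun x => (c x : ℝ) / n)^[n] q))
        (2 * (D.flowPotential ((D.mirrorStep κ fun x => (c x : ℝ) / n)^[n] q) -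
          D.flowPotential q) + 16 * κ * K * s) := by
  have hval : ∀ p : D.V → D.V → ℝ, n * D.value p (fun x => (c x : ℝ) / n) D.root =
      D.value p (fun x => (c x : ℝ)) D.root := by
    intro p
    rcases Nat.eq_zero_or_pos n with rfl | hpos
    · have : (fun x => (c x : ℝ)) = fun _ => 0 := by
        funext x
        have := hn x
        have h0 := (c x).coe_nonneg
        rw [Nat.cast_zero, zero_mul] at this
        exact le_antisymm this h0
      rw [this, ← D.sum_sinkMass_mul p (fun _ => 0)]
      simp
    · rw [value_div]
      exact mul_div_cancel₀ _ (by exact_mod_cast hpos.ne')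
  refine ⟨D.iterateService κ (fun x => (c x : ℝ) / n) q n, ?_, fun l hl => ?_, ?_⟩
  · rw [← hval]
    exact mul_value_iterate_le hκ _ hq n
  · rw [← hval]
    exact flowDiv_iterate_le hκ _ hl hq n
  · rcases Nat.eq_zero_or_pos n with rfl | hpos
    · exact (TransportCostLE.refl (D.sinkMass_nonneg hq)).mono (by simp [iterateService])
    · have hpos' : (0 : ℝ) < n := by exact_mod_cast hpos
      exact A.transportCostLE_iterate hκ hK (fun x => div_nonneg (c x).coe_nonneg hpos'.le)
        (fun x => by rw [div_le_iff₀ hpos', mul_comm]; exact hn x) hε hε' hq n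

theorem Adapted.value_ref [Fintype X] [MetricSpace X] {K σ : ℝ} (A : D.Adapted K σ) (x : X)
    (c : X → ℝ) : D.value (A.ref x) c D.root = c x := by
  classical
  rw [← D.sum_sinkMass_mul]
  have h1 := D.sum_sinkMass (A.ref_mem x)
  rw [Finset.sum_eq_single x (fun y _ hy => A.sinkMass_ref x y hy) (by simp)] at h1
  rw [Finset.sum_eq_single x (fun y _ hy => by rw [A.sinkMass_ref x y hy, zero_mul]) (by simp),
    h1, one_mul]

/-- Amortization over the first `T` rounds. -/
theorem Adapted.sum_service_le [Fintype X] [MetricSpace X] {K σ : ℝ} (A : D.Adapted K σ)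
    (hσ : 0 < σ) {p : ℕ → D.V → D.V → ℝ} (hp : ∀ t, p t ∈ D.policies) {c : ℕ → X → ℝ}
    {s : ℕ → ℝ} (hs : ∀ t, ∀ l ∈ D.policies, D.flowDiv (3 * σ) l (p (t + 1)) + s t ≤
      D.flowDiv (3 * σ) l (p t) + D.value l (c t) D.root) (r : ℕ → X) (T : ℕ) :
    ∑ t ∈ Finset.range T, s t ≤ D.flowDiv (3 * σ) (A.ref (r 0)) (p 0) +
      ∑ t ∈ Finset.range T, (c t (r (t + 1)) + dist (r t) (r (t + 1))) := by
  have hκ : 0 < 3 * σ := by positivity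
  have key : D.flowDiv (3 * σ) (A.ref (r T)) (p T) + ∑ t ∈ Finset.range T, s t ≤
      D.flowDiv (3 * σ) (A.ref (r 0)) (p 0) +
        ∑ t ∈ Finset.range T, (c t (r (t + 1)) + dist (r t) (r (t + 1))) := by
    induction T with
    | zero => simp
    | succ T ih =>
      rw [Finset.sum_range_succ, Finset.sum_range_succ]
      have h1 := hs T _ (A.ref_mem (r (T + 1)))
      rw [A.value_ref] at h1
      have h2 := A.flowDiv_le hκ (A.ref_mem (r T)) (A.ref_mem (r (T + 1))) (hp T)
      have h3 : 3 / (3 * σ) * D.shift (A.ref (r T)) (A.ref (r (T + 1))) ≤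
          dist (r T) (r (T + 1)) := by
        have := A.shift_ref_le (r T) (r (T + 1))
        have e : 3 / (3 * σ) * D.shift (A.ref (r T)) (A.ref (r (T + 1))) =
          D.shift (A.ref (r T)) (A.ref (r (T + 1))) / σ := by field_simp
        rw [e, div_le_iff₀ hσ]
        linarith
      linarith
  have := flowDiv_nonneg hκ (A.ref_mem (r T)) (hp T)
  linarith

theorem exists_pos_forall_mul_le (D : MarkedDAG X) (f : D.V → D.V → ℝ)
    (hf : ∀ a b, D.Adj a b → 0 < f a b) :
    ∃ ε : ℝ, 0 < ε ∧ ∀ a b, D.Adj a b → ε ≤ f a b := by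
  classical
  obtain ⟨z, _, hz⟩ := Finset.exists_min_image (Finset.univ : Finset (D.V × D.V))
    (fun z => if D.Adj z.1 z.2 then f z.1 z.2 else 1) ⟨(D.root, D.root), Finset.mem_univ _⟩
  refine ⟨if D.Adj z.1 z.2 then f z.1 z.2 else 1, ?_, fun a b hab => ?_⟩
  · split_ifs with h
    · exact hf _ _ h
    · exact one_pos
  · have := hz (a, b) (Finset.mem_univ _)
    simpa [hab] using this

end MarkedDAG

theorem costHistory_castSucc {X : Type u} (c : ℕ → X → ℝ≥0) (t : ℕ) :
    (fun i : Fin t => costHistory c (t + 1) i.castSucc) = costHistory c t := rfl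

theorem ENNReal.tsum_ofReal_le {f : ℕ → ℝ} (hf : ∀ t, 0 ≤ f t) {a : ℕ → ℝ} (ha : ∀ t, 0 ≤ a t)
    {α β : ℝ} (hα : 0 ≤ α) (hβ : 0 ≤ β)
    (h : ∀ T, ∑ t ∈ Finset.range T, f t ≤ α * ∑ t ∈ Finset.range T, a t + β) :
    ∑' t, ENNReal.ofReal (f t) ≤
      ENNReal.ofReal α * ∑' t, ENNReal.ofReal (a t) + ENNReal.ofReal β := by
  refine ENNReal.tsum_le_of_sum_range_le fun T => ?_
  rw [← ENNReal.ofReal_sum_of_nonneg fun t _ => hf t]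
  calc ENNReal.ofReal (∑ t ∈ Finset.range T, f t)
      ≤ ENNReal.ofReal (α * ∑ t ∈ Finset.range T, a t + β) := ENNReal.ofReal_le_ofReal (h T)
    _ = ENNReal.ofReal α * ∑ t ∈ Finset.range T, ENNReal.ofReal (a t) + ENNReal.ofReal β := by
        rw [ENNReal.ofReal_add (mul_nonneg hα (Finset.sum_nonneg fun t _ => ha t)) hβ,
          ENNReal.ofReal_mul hα, ENNReal.ofReal_sum_of_nonneg fun t _ => ha t]
    _ ≤ _ := by
        gcongr
        exact ENNReal.sum_le_tsum _

theorem le_offlineCost_of_forall {X : Type u} [MetricSpace X] {x₀ : X} {c : ℕ → X → ℝ≥0}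
    {α β : ℝ} (hα : 0 < α) {v : ℝ≥0∞}
    (h : ∀ r : ℕ → X, r 0 = x₀ → v ≤ ENNReal.ofReal α *
      ∑' t, ENNReal.ofReal ((c t (r (t + 1)) : ℝ) + dist (r t) (r (t + 1))) + ENNReal.ofReal β) :
    v ≤ ENNReal.ofReal α * offlineCost x₀ c + ENNReal.ofReal β := by
  unfold offlineCost
  have hα0 : ENNReal.ofReal α ≠ 0 := (ENNReal.ofReal_pos.2 hα).ne'
  rw [ENNReal.mul_iInf_of_ne hα0 ENNReal.ofReal_ne_top, ENNReal.iInf_add]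
  refine le_iInf fun r => ?_
  rw [ENNReal.mul_iInf_of_ne hα0 ENNReal.ofReal_ne_top, ENNReal.iInf_add]
  refine le_iInf fun hr => (h r hr).trans_eq ?_
  congr 3
  funext t
  rw [ENNReal.ofReal_add (c t _).coe_nonneg dist_nonneg, ENNReal.ofReal_coe_nnreal, edist_dist]

theorem TransportCostLE.nonneg {X : Type u} [Fintype X] [MetricSpace X] {μ ν : X → ℝ} {r : ℝ}
    (h : TransportCostLE μ ν r) : 0 ≤ r := by
  obtain ⟨J, h1, _, _, h4⟩ := h
  exact (Finset.sum_nonneg fun x _ => Finset.sum_nonneg fun y _ =>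
    mul_nonneg (h1 x y) dist_nonneg).trans h4

namespace MarkedDAG

open MeasureTheory

variable {X : Type u} [Fintype X] [MetricSpace X] {D : MarkedDAG X}

theorem Adapted.exists_alg {K σ : ℝ} (A : D.Adapted K σ) (hK : 0 < K) (hσ : 0 < σ) {ε : ℝ}
    (hε : ∀ a b, D.Adj a b → 3 * σ * D.η a b * ε ≤ D.ω a b)
    (hε' : ∀ a b, D.Adj a b → 32 * (3 * σ) * K * ε ≤ D.ω a b)
    {p₀ : D.V → D.V → ℝ} (hp₀ : p₀ ∈ D.policies) {N : (X → ℝ≥0) → ℕ}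
    (hN : ∀ (c : X → ℝ≥0) (x : X), (c x : ℝ) ≤ N c * ε) (x₀ : X) :
    ∃ alg : ℝ → OnlineAlgorithm X, (∀ s h, alg s 0 h = x₀) ∧
      (∀ t h x, MeasurableSet {s : ℝ | alg s t h = x}) ∧
      (∀ t, 1 ≤ t → ∀ h x, unitUniform {s | alg s t h = x} =
        ENNReal.ofReal (D.sinkMass (D.mirrorDescent (3 * σ) N p₀ t h) x)) ∧
      ∃ β, 0 < β ∧ ∀ c : ℕ → X → ℝ≥0,
        ∫⁻ s, (alg s).serv c ∂unitUniform ≤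
            ENNReal.ofReal 1 * offlineCost x₀ c + ENNReal.ofReal β ∧
          ∫⁻ s, (alg s).move c ∂unitUniform ≤
            ENNReal.ofReal (48 * σ * K) * offlineCost x₀ c + ENNReal.ofReal β := by
  classical
  have hκ : 0 < 3 * σ := by positivity
  have : Nonempty X := ⟨x₀⟩
  set P := D.mirrorDescent (3 * σ) N p₀ with hP
  have hPmem : ∀ t h, P t h ∈ D.policies := fun t h => mirrorDescent_mem_policies _ N hp₀ t h
  have hround := fun (t : ℕ) (h : Fin (t + 1) → X → ℝ≥0) =>
    A.round_le hκ hK hε hε' (hPmem t fun i => h i.castSucc) (h (Fin.last t))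
      (N (h (Fin.last t))) (hN _)
  choose s hs1 hs2 hs3 using hround
  obtain ⟨diam, hdiam⟩ : ∃ r : ℝ, ∀ x y : X, dist x y ≤ r := by
    refine ⟨∑ z : X × X, dist z.1 z.2, fun x y => ?_⟩
    exact Finset.single_le_sum (f := fun z : X × X => dist z.1 z.2) (fun z _ => dist_nonneg)
      (Finset.mem_univ (x, y))
  have hdiam0 : 0 ≤ diam := dist_nonneg.trans (hdiam x₀ x₀)
  let law : (t : ℕ) → (Fin t → X → ℝ≥0) → X → ℝ := fun t h x =>
    if t = 0 then (if x₀ = x then 1 else 0) else D.sinkMass (P t h) x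
  let cost : (t : ℕ) → (Fin (t + 1) → X → ℝ≥0) → ℝ := fun t h =>
    (if t = 0 then diam else 0) + (2 * (D.flowPotential (P (t + 1) h) -
      D.flowPotential (P t fun i => h i.castSucc)) + 16 * (3 * σ) * K * s t h)
  have hstep : ∀ t h, TransportCostLE (law t fun i => h i.castSucc) (law (t + 1) h) (cost t h) := by
    intro t h
    have h2 := hs3 t h
    have e : law (t + 1) h = D.sinkMass (P (t + 1) h) := by funext x; simp [law]
    rw [e]
    rcases Nat.eq_zero_or_pos t with rfl | ht
    · have h3 := h2.nonneg
      have : TransportCostLE (law 0 fun i => h i.castSucc) (D.sinkMass (P (0 + 1) h)) diam := by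
        refine TransportCostLE.of_diam (fun x => ?_) (D.sinkMass_nonneg (hPmem _ _)) ?_
          (D.sum_sinkMass (hPmem _ _)) hdiam
        · simp only [law, if_true]
          split_ifs <;> norm_num
        · simp [law]
      refine this.mono ?_
      simp only [cost, if_true]
      exact le_add_of_nonneg_right h3
    · have e' : law t (fun i => h i.castSucc) = D.sinkMass (P t fun i => h i.castSucc) := by
        funext x; simp [law, ht.ne']
      rw [e']
      refine h2.mono ?_
      simp only [cost, ht.ne', if_false, zero_add]
      exact le_rfl
  obtain ⟨B, hB0, hBm, hBlaw, hBcost⟩ := exists_realization law cost x₀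
    (fun h => by funext x; simp [law]) hstep
  have hβ0 : 0 ≤ D.flowDiv (3 * σ) (A.ref x₀) p₀ := flowDiv_nonneg hκ (A.ref_mem x₀) hp₀
  have hW0 := A.W_nonneg D.root
  refine ⟨fun s t h => B t h s, fun s h => hB0 h s, hBm, ?_,
    diam + 192 * A.W D.root + 48 * σ * K * D.flowDiv (3 * σ) (A.ref x₀) p₀ +
      D.flowDiv (3 * σ) (A.ref x₀) p₀ + 1, by positivity, fun c => ?_⟩
  · intro t ht h x
    have := hBlaw t h x
    rw [measureReal_def] at this
    have h2 : {s | B t h s = x} = B t h ⁻¹' {x} := rfl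
    rw [h2, ← ENNReal.ofReal_toReal (measure_ne_top unitUniform (B t h ⁻¹' {x})), this]
    simp [law, (Nat.pos_iff_ne_zero.1 ht)]
  · set β₀ := D.flowDiv (3 * σ) (A.ref x₀) p₀ with hβ
    let s' : ℕ → ℝ := fun t => s t (costHistory c (t + 1))
    let p : ℕ → D.V → D.V → ℝ := fun t => P t (costHistory c t)
    have hp : ∀ t, p t ∈ D.policies := fun t => hPmem _ _
    have hservice : ∀ r : ℕ → X, r 0 = x₀ → ∀ T, ∑ t ∈ Finset.range T, s' t ≤ β₀ +
        ∑ t ∈ Finset.range T, ((c t (r (t + 1)) : ℝ) + dist (r t) (r (t + 1))) := by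
      intro r hr T
      have := A.sum_service_le hσ hp (c := fun t x => (c t x : ℝ)) (s := s')
        (fun t l hl => hs2 t (costHistory c (t + 1)) l hl) r T
      rwa [hr] at this
    have hmeas : ∀ t (h : Fin t → X → ℝ≥0) (f : X → ℝ≥0∞), Measurable fun u => f (B t h u) := by
      intro t h f
      let _ : MeasurableSpace X := ⊤
      exact (measurable_from_top (f := f)).comp (measurable_to_countable' fun x => hBm t h x)
    have hserv : ∫⁻ u, OnlineAlgorithm.serv (fun t h => B t h u) c ∂unitUniform =
        ∑' t, ENNReal.ofReal (∑ x, D.sinkMass (p (t + 1)) x * (c t x : ℝ)) := by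
      unfold OnlineAlgorithm.serv
      rw [lintegral_tsum fun t => (hmeas (t + 1) _ fun x => (c t x : ℝ≥0∞)).aemeasurable]
      congr 1
      funext t
      have := unitUniform.lintegral_comp (hBm (t + 1) (costHistory c (t + 1)))
        (fun x => (c t x : ℝ)) (fun x => (c t x).coe_nonneg)
      simp only [ENNReal.ofReal_coe_nnreal] at this
      rw [this]
      congr 1
      refine Finset.sum_congr rfl fun x _ => ?_
      rw [hBlaw]
      simp [law, p]
    have hmove : ∫⁻ u, OnlineAlgorithm.move (fun t h => B t h u) c ∂unitUniform =
        ∑' t, ENNReal.ofReal (∑ x, ∑ y, unitUniform.real (B t (costHistory c t) ⁻¹' {x} ∩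
          B (t + 1) (costHistory c (t + 1)) ⁻¹' {y}) * dist x y) := by
      unfold OnlineAlgorithm.move
      rw [lintegral_tsum]
      · congr 1
        funext t
        have := unitUniform.lintegral_comp₂ (hBm t (costHistory c t))
          (hBm (t + 1) (costHistory c (t + 1))) (fun x y => dist x y) (fun x y => dist_nonneg)
        simp only [← edist_dist] at this
        exact this
      · intro t
        let _ : MeasurableSpace X := ⊤
        have h1 : Measurable (B t (costHistory c t)) := measurable_to_countable' fun x => hBm _ _ x
        have h2 : Measurable (B (t + 1) (costHistory c (t + 1))) :=
          measurable_to_countable' fun x => hBm _ _ x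
        have h3 : Measurable fun z : X × X => edist z.1 z.2 := measurable_of_countable _
        exact (h3.comp (h1.prodMk h2)).aemeasurable
    constructor
    · rw [hserv]
      refine le_offlineCost_of_forall one_pos fun r hr => ?_
      refine ENNReal.tsum_ofReal_le (fun t => Finset.sum_nonneg fun x _ =>
        mul_nonneg (D.sinkMass_nonneg (hp _) x) (c t x).coe_nonneg)
        (fun t => add_nonneg (c t _).coe_nonneg dist_nonneg) zero_le_one (by positivity) fun T => ?_
      have h1 : ∑ t ∈ Finset.range T, ∑ x, D.sinkMass (p (t + 1)) x * (c t x : ℝ) ≤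
          ∑ t ∈ Finset.range T, s' t := by
        refine Finset.sum_le_sum fun t _ => ?_
        rw [D.sum_sinkMass_mul]
        exact hs1 t (costHistory c (t + 1))
      have h2 := hservice r hr T
      have h3 : 0 ≤ 48 * σ * K * β₀ := by positivity
      linarith
    · rw [hmove]
      refine le_offlineCost_of_forall (by positivity) fun r hr => ?_
      refine ENNReal.tsum_ofReal_le (fun t => Finset.sum_nonneg fun x _ => Finset.sum_nonneg fun y _ =>
        mul_nonneg measureReal_nonneg dist_nonneg)
        (fun t => add_nonneg (c t _).coe_nonneg dist_nonneg) (by positivity) (by positivity)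
        fun T => ?_
      have h1 : ∑ t ∈ Finset.range T, ∑ x, ∑ y, unitUniform.real (B t (costHistory c t) ⁻¹' {x} ∩
          B (t + 1) (costHistory c (t + 1)) ⁻¹' {y}) * dist x y ≤
          diam + 2 * (D.flowPotential (p T) - D.flowPotential (p 0)) +
            48 * σ * K * ∑ t ∈ Finset.range T, s' t := by
        induction T with
        | zero => simpa using hdiam0
        | succ T ih =>
          have h2 := hBcost T (costHistory c (T + 1))
          rw [costHistory_castSucc] at h2
          have h4 : cost T (costHistory c (T + 1)) = (if T = 0 then diam else 0) +
            (2 * (D.flowPotential (p (T + 1)) - D.flowPotential (p T)) + 48 * σ * K * s' T) := by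
            simp only [cost, costHistory_castSucc, p, s']
            ring
          rw [h4] at h2
          rcases Nat.eq_zero_or_pos T with rfl | hT
          · rw [if_pos rfl] at h2
            simp only [zero_add, Finset.range_one, Finset.sum_singleton] at h2 ⊢
            linarith
          · rw [if_neg hT.ne'] at h2
            rw [Finset.sum_range_succ, Finset.sum_range_succ]
            linarith
      have h2 := mul_le_mul_of_nonneg_left (hservice r hr T) (show 0 ≤ 48 * σ * K by positivity)
      have h3 := abs_le.1 (A.abs_flowPotential_le (hp T))
      have h4 := abs_le.1 (A.abs_flowPotential_le (hp 0))
      linarith [h3.2, h4.1]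

theorem Adapted.exists_competitive {K σ : ℝ} (A : D.Adapted K σ) (hK : 0 < K) (hσ : 0 < σ) :
    ∃ κ ε : ℝ, 0 < κ ∧ 0 < ε ∧ ∀ p₀ ∈ D.policies, ∀ N : (X → ℝ≥0) → ℕ,
      (∀ (c : X → ℝ≥0) (x : X), (c x : ℝ) ≤ N c * ε) →
      ∃ R : RandomizedAlgorithm X, D.IsPlayedBy R κ N p₀ ∧
        ∀ α, 1 + 48 * σ * K ≤ α → R.IsCompetitive α ∧ R.IsRefinedCompetitive 1 α := by
  obtain ⟨ε, hε0, hε⟩ := exists_pos_forall_mul_le D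
    (fun a b => D.ω a b / (3 * σ * D.η a b + 32 * (3 * σ) * K)) fun a b hab => by
      have := D.ω_pos a b hab
      have := D.η_pos hab
      positivity
  refine ⟨3 * σ, ε, by positivity, hε0, fun p₀ hp₀ N hN => ?_⟩
  have key : ∀ a b, D.Adj a b → 3 * σ * D.η a b * ε ≤ D.ω a b ∧ 32 * (3 * σ) * K * ε ≤ D.ω a b := by
    intro a b hab
    have hη := D.η_pos hab
    have h1 := hε a b hab
    rw [le_div_iff₀ (by positivity)] at h1
    have h2 : 0 ≤ 3 * σ * D.η a b * ε := by positivity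
    have h3 : 0 ≤ 32 * (3 * σ) * K * ε := by positivity
    constructor <;> linarith
  choose alg h0 hm hlaw β hβ hcomp using A.exists_alg hK hσ (fun a b h => (key a b h).1)
    (fun a b h => (key a b h).2) hp₀ hN
  refine ⟨⟨ℝ, unitUniform, alg, h0, hm⟩, fun x₀ t ht h x => hlaw x₀ t ht h x, fun α hα => ?_⟩
  have href : ∀ x₀ c, ∫⁻ s, (alg x₀ s).move c ∂unitUniform ≤
      ENNReal.ofReal (48 * σ * K) * offlineCost x₀ c + ENNReal.ofReal (β x₀) := fun x₀ c =>
    (hcomp x₀ c).2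
  refine ⟨fun x₀ => ⟨2 * β x₀, by have := hβ x₀; positivity, fun c => ?_⟩,
    fun x₀ => ⟨β x₀, hβ x₀, fun c => ⟨(hcomp x₀ c).1, (href x₀ c).trans ?_⟩⟩⟩
  · have hmeas : Measurable fun s => (alg x₀ s).serv c := by
      unfold OnlineAlgorithm.serv
      refine Measurable.tsum fun t => ?_
      let _ : MeasurableSpace X := ⊤
      exact (measurable_from_top (f := fun x => (c t x : ℝ≥0∞))).comp
        (measurable_to_countable' fun x => hm x₀ (t + 1) (costHistory c (t + 1)) x)
    have h1 : ∫⁻ s, (alg x₀ s).cost c ∂unitUniform =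
        ∫⁻ s, (alg x₀ s).serv c ∂unitUniform + ∫⁻ s, (alg x₀ s).move c ∂unitUniform := by
      unfold OnlineAlgorithm.cost
      exact lintegral_add_left hmeas _
    refine h1.trans_le ((add_le_add (hcomp x₀ c).1 (href x₀ c)).trans ?_)
    have h2 : ENNReal.ofReal 1 * offlineCost x₀ c + ENNReal.ofReal (β x₀) +
        (ENNReal.ofReal (48 * σ * K) * offlineCost x₀ c + ENNReal.ofReal (β x₀)) =
        ENNReal.ofReal (1 + 48 * σ * K) * offlineCost x₀ c + ENNReal.ofReal (2 * β x₀) := by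
      rw [ENNReal.ofReal_add zero_le_one (by positivity), two_mul,
        ENNReal.ofReal_add (hβ x₀).le (hβ x₀).le]
      ring
    rw [h2]
    gcongr
  · gcongr
    linarith

end MarkedDAG

theorem card_perm_isFirst_mul_le {X : Type*} [Fintype X] [DecidableEq X] {n : ℕ} (e : X ≃ Fin n)
    (S : Finset X) {w : X} (hw : w ∈ S) :
    (Finset.univ.filter fun π : Equiv.Perm X => ∀ v ∈ S, e (π w) ≤ e (π v)).card * S.card ≤
      Fintype.card (Equiv.Perm X) := by
  set T : X → Finset (Equiv.Perm X) := fun u =>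
    Finset.univ.filter fun π : Equiv.Perm X => ∀ v ∈ S, e (π u) ≤ e (π v) with hT
  have hcard : ∀ u ∈ S, (T u).card = (T w).card := by
    intro u hu
    have hswap : ∀ v ∈ S, Equiv.swap u w v ∈ S := by
      intro v hv
      rcases eq_or_ne v u with rfl | h1
      · rwa [Equiv.swap_apply_left]
      · rcases eq_or_ne v w with rfl | h2
        · rwa [Equiv.swap_apply_right]
        · rwa [Equiv.swap_apply_of_ne_of_ne h1 h2]
    refine Finset.card_bij' (fun π _ => π * Equiv.swap u w) (fun π _ => π * Equiv.swap u w)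
      ?_ ?_ ?_ ?_
    · intro π hπ
      simp only [hT, Finset.mem_filter, Finset.mem_univ, true_and] at hπ ⊢
      intro v hv
      simpa using hπ _ (hswap v hv)
    · intro π hπ
      simp only [hT, Finset.mem_filter, Finset.mem_univ, true_and] at hπ ⊢
      intro v hv
      simpa using hπ _ (hswap v hv)
    · intro π _
      simp [mul_assoc]
    · intro π _
      simp [mul_assoc]
  have hdisj : (S : Set X).PairwiseDisjoint T := by
    intro u hu v hv huv
    refine Finset.disjoint_left.2 fun π hπ hπ' => huv ?_
    simp only [hT, Finset.mem_filter, Finset.mem_univ, true_and] at hπ hπ'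
    exact π.injective (e.injective (le_antisymm (hπ v hv) (hπ' u hu)))
  calc (T w).card * S.card = ∑ u ∈ S, (T u).card := by
        rw [Finset.sum_congr rfl hcard, Finset.sum_const, smul_eq_mul, mul_comm]
    _ = (S.biUnion T).card := (Finset.card_biUnion hdisj).symm
    _ ≤ _ := Finset.card_le_univ _

theorem sum_inv_card_le_harmonic {X : Type*} [DecidableEq X] (a : X → ℝ) (s : Finset X) :
    ∑ w ∈ s, ((s.filter fun v => a v ≤ a w).card : ℝ)⁻¹ ≤ harmonic s.card := by
  induction s using Finset.induction_on_max_value a with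
  | empty => simp
  | insert w s hw hmax ih =>
    rw [Finset.sum_insert hw, Finset.card_insert_of_notMem hw, harmonic_succ]
    have h1 : (insert w s).filter (fun v => a v ≤ a w) = insert w s := by
      refine Finset.filter_true_of_mem fun v hv => ?_
      rcases Finset.mem_insert.1 hv with rfl | hv
      · exact le_rfl
      · exact hmax v hv
    rw [h1, Finset.card_insert_of_notMem hw]
    have h2 : ∑ u ∈ s, (((insert w s).filter fun v => a v ≤ a u).card : ℝ)⁻¹ ≤
        ∑ u ∈ s, ((s.filter fun v => a v ≤ a u).card : ℝ)⁻¹ := by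
      refine Finset.sum_le_sum fun u hu => ?_
      have hpos : 0 < (s.filter fun v => a v ≤ a u).card :=
        Finset.card_pos.2 ⟨u, Finset.mem_filter.2 ⟨hu, le_rfl⟩⟩
      refine inv_anti₀ (by exact_mod_cast hpos) ?_
      exact_mod_cast Finset.card_le_card
        (Finset.filter_subset_filter _ (Finset.subset_insert w s))
    push_cast
    linarith

theorem sum_geometric_indicator_le {N : ℕ} (hN : 0 < N) {r₀ : ℝ} (hr₀ : 0 < r₀) {a b : ℝ}
    (ha : 0 ≤ a) (hab : a ≤ b) (m : ℕ) :
    ∑ k ∈ Finset.range m, (open scoped Classical in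
      if a ≤ r₀ * (1 + 1 / (N : ℝ)) ^ k ∧ r₀ * (1 + 1 / (N : ℝ)) ^ k < b then
        r₀ * (1 + 1 / (N : ℝ)) ^ k else 0) ≤ N * (b - a) + b := by
  classical
  have hN' : (0 : ℝ) < N := by exact_mod_cast hN
  set R : ℕ → ℝ := fun k => r₀ * (1 + 1 / (N : ℝ)) ^ k with hR
  have hR0 : ∀ k, 0 < R k := fun k => by positivity
  have hRs : ∀ k, N * (R (k + 1) - R k) = R k := by
    intro k
    simp only [hR, pow_succ]
    field_simp
    ring
  have hmono : ∀ k, R k ≤ R (k + 1) := fun k => by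
    have h1 := hRs k
    have h2 := hR0 k
    by_contra! h
    nlinarith
  set T := b + b / N with hT
  have hbT : b ≤ T := by
    have : 0 ≤ b / N := div_nonneg (ha.trans hab) hN'.le
    linarith
  set φ : ℝ → ℝ := fun t => min (max t a) T with hφ
  have hφmono : Monotone φ := fun s t h => min_le_min_right _ (max_le_max_right _ h)
  have hterm : ∀ k, (if a ≤ R k ∧ R k < b then R k else 0) ≤ N * (φ (R (k + 1)) - φ (R k)) := by
    intro k
    split_ifs with h
    · have h1 : φ (R k) = R k := by
        simp only [hφ]
        rw [max_eq_left h.1, min_eq_left (by linarith [h.2])]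
      have h2 : φ (R (k + 1)) = R (k + 1) := by
        simp only [hφ]
        rw [max_eq_left (h.1.trans (hmono k)), min_eq_left]
        have h3 := hRs k
        have h4 : R (k + 1) = R k + R k / N := by field_simp; linarith
        rw [h4, hT]
        have := div_le_div_of_nonneg_right h.2.le hN'.le
        linarith [h.2]
      rw [h1, h2, hRs]
    · exact mul_nonneg hN'.le (sub_nonneg.2 (hφmono (hmono k)))
  calc _ ≤ ∑ k ∈ Finset.range m, N * (φ (R (k + 1)) - φ (R k)) :=
        Finset.sum_le_sum fun k _ => hterm k
    _ = N * (φ (R m) - φ (R 0)) := by rw [← Finset.mul_sum, Finset.sum_range_sub (fun k => φ (R k))]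
    _ ≤ N * (T - a) := by
        refine mul_le_mul_of_nonneg_left ?_ hN'.le
        have h1 : φ (R m) ≤ T := min_le_right _ _
        have h2 : a ≤ φ (R 0) := le_min (le_max_right _ _) (by linarith)
        linarith
    _ = N * (b - a) + b := by rw [hT]; field_simp; ring

/-- A dominating ultrametric whose values are separated by factors of `100`. -/
structure IsDominatingHST {X : Type u} [MetricSpace X] (ρ : X → X → ℝ) : Prop where
  self : ∀ x, ρ x x = 0
  symm : ∀ x y, ρ x y = ρ y x
  ultra : ∀ x y z, ρ x z ≤ max (ρ x y) (ρ y z)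
  dist_le : ∀ x y, dist x y ≤ ρ x y
  gap : ∀ x y z w, ρ x y < ρ z w → 100 * ρ x y ≤ ρ z w

namespace RandomPartition

variable {X : Type u} [MetricSpace X] [Fintype X] {n : ℕ} (e : X ≃ Fin n)

theorem exists_center (π : Equiv.Perm X) (r : ℝ≥0) (x : X) :
    ∃ w, dist x w ≤ r ∧ ∀ v, dist x v ≤ r → e (π w) ≤ e (π v) := by
  classical
  obtain ⟨w, hw, h⟩ := Finset.exists_min_image (Finset.univ.filter fun v => dist x v ≤ r)
    (fun v => e (π v)) ⟨x, by simp⟩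
  exact ⟨w, (Finset.mem_filter.1 hw).2, fun v hv => h v (Finset.mem_filter.2 ⟨Finset.mem_univ _, hv⟩)⟩

/-- The first point, in the order given by `π`, at distance at most `r` from `x`. -/
def center (π : Equiv.Perm X) (r : ℝ≥0) (x : X) : X := (exists_center e π r x).choose

theorem dist_center (π : Equiv.Perm X) (r : ℝ≥0) (x : X) : dist x (center e π r x) ≤ r :=
  (exists_center e π r x).choose_spec.1

theorem center_le (π : Equiv.Perm X) (r : ℝ≥0) (x : X) {v : X} (hv : dist x v ≤ r) :
    e (π (center e π r x)) ≤ e (π v) :=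
  (exists_center e π r x).choose_spec.2 v hv

theorem center_eq (π : Equiv.Perm X) (r : ℝ≥0) (x : X) {w : X} (hw : dist x w ≤ r)
    (h : ∀ v, dist x v ≤ r → e (π w) ≤ e (π v)) : center e π r x = w :=
  π.injective (e.injective (le_antisymm (center_le e π r x hw) (h _ (dist_center e π r x))))

open scoped Classical in
theorem card_center_ne_le (r : ℝ≥0) (x y : X) :
    ((Finset.univ.filter fun π : Equiv.Perm X => center e π r x ≠ center e π r y).card : ℝ) ≤
      ∑ w, if min (dist x w) (dist y w) ≤ r ∧ r < max (dist x w) (dist y w) then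
        (Fintype.card (Equiv.Perm X) : ℝ) *
          ((Finset.univ.filter fun v =>
            min (dist x v) (dist y v) ≤ min (dist x w) (dist y w)).card : ℝ)⁻¹ else 0 := by
  set S : X → Finset X := fun w => Finset.univ.filter fun v =>
    min (dist x v) (dist y v) ≤ min (dist x w) (dist y w) with hS
  set G := Finset.univ.filter fun w : X =>
    min (dist x w) (dist y w) ≤ r ∧ r < max (dist x w) (dist y w) with hG
  have hsub : (Finset.univ.filter fun π : Equiv.Perm X => center e π r x ≠ center e π r y) ⊆
      G.biUnion fun w => Finset.univ.filter fun π : Equiv.Perm X =>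
        ∀ v ∈ S w, e (π w) ≤ e (π v) := by
    intro π hπ
    have hne := (Finset.mem_filter.1 hπ).2
    obtain ⟨w, hw, hmin⟩ := Finset.exists_min_image
      (Finset.univ.filter fun v => min (dist x v) (dist y v) ≤ r) (fun v => e (π v))
      ⟨x, by simp⟩
    have hw' := (Finset.mem_filter.1 hw).2
    have hmin' : ∀ v, dist x v ≤ r ∨ dist y v ≤ r → e (π w) ≤ e (π v) := fun v hv =>
      hmin v (Finset.mem_filter.2 ⟨Finset.mem_univ _, min_le_iff.2 hv⟩)
    rw [Finset.mem_biUnion]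
    refine ⟨w, Finset.mem_filter.2 ⟨Finset.mem_univ _, hw', ?_⟩,
      Finset.mem_filter.2 ⟨Finset.mem_univ _, fun v hv => hmin v (Finset.mem_filter.2
        ⟨Finset.mem_univ _, (Finset.mem_filter.1 hv).2.trans hw'⟩)⟩⟩
    by_contra! hcon
    rw [max_le_iff] at hcon
    refine hne ?_
    rw [center_eq e π r x hcon.1 fun v hv => hmin' v (Or.inl hv),
      center_eq e π r y hcon.2 fun v hv => hmin' v (Or.inr hv)]
  calc ((Finset.univ.filter fun π : Equiv.Perm X => center e π r x ≠ center e π r y).card : ℝ)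
      ≤ ∑ w ∈ G, ((Finset.univ.filter fun π : Equiv.Perm X =>
          ∀ v ∈ S w, e (π w) ≤ e (π v)).card : ℝ) := by
        exact_mod_cast (Finset.card_le_card hsub).trans Finset.card_biUnion_le
    _ ≤ ∑ w ∈ G, (Fintype.card (Equiv.Perm X) : ℝ) * ((S w).card : ℝ)⁻¹ := by
        refine Finset.sum_le_sum fun w _ => ?_
        have hwS : w ∈ S w := Finset.mem_filter.2 ⟨Finset.mem_univ _, le_rfl⟩
        have hpos : (0 : ℝ) < (S w).card := by exact_mod_cast Finset.card_pos.2 ⟨w, hwS⟩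
        rw [← div_eq_mul_inv, le_div_iff₀ hpos]
        exact_mod_cast card_perm_isFirst_mul_le e (S w) hwS
    _ = _ := by rw [hG, Finset.sum_filter]

open scoped Classical in
/-- The ultrametric given by the permutation `π` and the radii `R j`, `j < J`. -/
def hst (c : ℝ≥0) (J : ℕ) (R : ℕ → ℝ≥0) (π : Equiv.Perm X) (x y : X) : ℝ≥0 :=
  (Finset.range J).sup fun j => if center e π (R j) x ≠ center e π (R j) y then c * R j else 0

theorem isDominatingHST_hst {c : ℝ≥0} {J : ℕ} {R : ℕ → ℝ≥0}
    (hR100 : ∀ j, 100 * R j ≤ R (j + 1)) (hRc : ∀ j, 2 * R (j + 1) ≤ c * R j)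
    (hR0 : ∀ x y : X, x ≠ y → 2 * (R 0 : ℝ) < dist x y)
    (hRJ : ∀ x y : X, dist x y ≤ 2 * (R J : ℝ)) (π : Equiv.Perm X) :
    IsDominatingHST fun x y => (hst e c J R π x y : ℝ) := by
  classical
  have hmono : ∀ i j, i < j → 100 * R i ≤ R j := by
    intro i j hij
    induction j, hij using Nat.le_induction with
    | base => exact hR100 i
    | succ j _ ih =>
      refine ih.trans (le_trans ?_ (hR100 j))
      exact le_mul_of_one_le_left' (by norm_num)
  refine ⟨fun x => by simp [hst], fun x y => ?_, fun x y z => ?_, fun x y => ?_,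
    fun x y z w h => ?_⟩
  · unfold hst
    simp only [ne_comm]
  · rw [← NNReal.coe_max, NNReal.coe_le_coe]
    refine Finset.sup_le fun j hj => ?_
    split_ifs with h
    · by_cases h1 : center e π (R j) x = center e π (R j) y
      · refine le_max_of_le_right ?_
        have := Finset.le_sup (f := fun j =>
          if center e π (R j) y ≠ center e π (R j) z then c * R j else 0) hj
        rwa [if_pos (h1 ▸ h)] at this
      · refine le_max_of_le_left ?_
        have := Finset.le_sup (f := fun j =>
          if center e π (R j) x ≠ center e π (R j) y then c * R j else 0) hj
        rwa [if_pos h1] at this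
    · exact zero_le
  · rcases eq_or_ne x y with rfl | hne
    · simp
    · have hex : ∃ j, dist x y ≤ 2 * (R j : ℝ) := ⟨J, hRJ x y⟩
      set j := Nat.find hex with hj
      have hjs : dist x y ≤ 2 * (R j : ℝ) := Nat.find_spec hex
      have hjJ : j ≤ J := Nat.find_min' hex (hRJ x y)
      obtain ⟨i, hi⟩ : ∃ i, j = i + 1 := by
        refine Nat.exists_eq_succ_of_ne_zero fun h0 => ?_
        rw [h0] at hjs
        exact absurd (hR0 x y hne) (not_lt.2 hjs)
      have hlt : 2 * (R i : ℝ) < dist x y := by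
        have := Nat.find_min hex (m := i) (by omega)
        exact not_le.1 this
      have hsep : center e π (R i) x ≠ center e π (R i) y := by
        intro heq
        have h1 := dist_center e π (R i) x
        have h2 := dist_center e π (R i) y
        rw [heq] at h1
        have := dist_triangle_right x y (center e π (R i) y)
        linarith
      have h1 : c * R i ≤ hst e c J R π x y := by
        have := Finset.le_sup (f := fun j =>
          if center e π (R j) x ≠ center e π (R j) y then c * R j else 0)
          (Finset.mem_range.2 (show i < J by omega))
        rwa [if_pos hsep] at this
      have h2 : (2 * R (i + 1) : ℝ) ≤ hst e c J R π x y := by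
        exact_mod_cast (hRc i).trans h1
      rw [hi] at hjs
      exact hjs.trans h2
  · have hval : ∀ x y, hst e c J R π x y = 0 ∨ ∃ j, hst e c J R π x y = c * R j := by
      intro x y
      rcases J.eq_zero_or_pos with h0 | h0
      · left
        simp [hst, h0]
      · obtain ⟨j, _, hj⟩ := Finset.exists_mem_eq_sup (Finset.range J)
          (Finset.nonempty_range_iff.2 h0.ne') fun j =>
            if center e π (R j) x ≠ center e π (R j) y then c * R j else 0
        change hst e c J R π x y = _ at hj
        split_ifs at hj
        · exact Or.inr ⟨j, hj⟩
        · exact Or.inl hj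
    rw [NNReal.coe_lt_coe] at h
    have : 100 * hst e c J R π x y ≤ hst e c J R π z w := by
      rcases hval x y with h1 | ⟨i, h1⟩
      · rw [h1, mul_zero]; exact zero_le
      · rcases hval z w with h2 | ⟨j, h2⟩
        · rw [h2] at h
          exact absurd h not_lt_zero
        · rw [h1, h2] at h ⊢
          have hij : i < j := by
            by_contra! hji
            have : R j ≤ R i := by
              rcases hji.eq_or_lt with rfl | hlt
              · exact le_rfl
              · exact (le_mul_of_one_le_left' (by norm_num)).trans (hmono j i hlt)
            exact absurd h (not_lt.2 (mul_le_mul_right this c))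
          calc 100 * (c * R i) = c * (100 * R i) := by ring
            _ ≤ c * R j := mul_le_mul_right (hmono i j hij) c
    exact_mod_cast this

open scoped Classical in
theorem sum_hst_le (c : ℝ≥0) (J : ℕ) (R : ℕ → ℝ≥0) (x y : X) :
    ∑ π : Equiv.Perm X, (hst e c J R π x y : ℝ) ≤
      ∑ j ∈ Finset.range J, c * R j *
        ((Finset.univ.filter fun π : Equiv.Perm X =>
          center e π (R j) x ≠ center e π (R j) y).card : ℝ) := by
  have h1 : ∀ π : Equiv.Perm X, (hst e c J R π x y : ℝ) ≤ ∑ j ∈ Finset.range J,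
      if center e π (R j) x ≠ center e π (R j) y then (c * R j : ℝ) else 0 := by
    intro π
    have : hst e c J R π x y ≤ ∑ j ∈ Finset.range J,
        if center e π (R j) x ≠ center e π (R j) y then c * R j else 0 :=
      Finset.sup_le fun j hj => Finset.single_le_sum (f := fun j =>
        if center e π (R j) x ≠ center e π (R j) y then c * R j else 0) (fun _ _ => zero_le) hj
    refine (NNReal.coe_le_coe.2 this).trans_eq ?_
    push_cast
    refine Finset.sum_congr rfl fun j _ => ?_
    split_ifs <;> simp
  refine (Finset.sum_le_sum fun π _ => h1 π).trans_eq ?_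
  rw [Finset.sum_comm]
  refine Finset.sum_congr rfl fun j _ => ?_
  rw [Finset.card_filter, ← Finset.sum_filter, Finset.sum_const, nsmul_eq_mul, ← Finset.card_filter,
    mul_comm]

end RandomPartition

theorem sum_range_sum_range_add_mul {M : Type*} [AddCommMonoid M] (f : ℕ → M) (L J : ℕ) :
    ∑ i ∈ Finset.range L, ∑ j ∈ Finset.range J, f (i + L * j) =
      ∑ k ∈ Finset.range (J * L), f k := by
  rw [← Fin.sum_univ_eq_sum_range f, ← (finProdFinEquiv (m := J) (n := L)).sum_comp,
    Fintype.sum_prod_type, Finset.sum_comm,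
    ← Fin.sum_univ_eq_sum_range (fun j => ∑ i ∈ Finset.range L, f (i + L * j))]
  refine Finset.sum_congr rfl fun j _ => ?_
  rw [← Fin.sum_univ_eq_sum_range (fun i => f (i + L * j))]
  rfl

theorem exists_pos_le_dist (X : Type u) [MetricSpace X] [Finite X] :
    ∃ δ : ℝ, 0 < δ ∧ ∀ x y : X, x ≠ y → δ ≤ dist x y := by
  classical
  have := Fintype.ofFinite X
  rcases isEmpty_or_nonempty X with h | ⟨⟨x₀⟩⟩
  · exact ⟨1, one_pos, fun x => h.elim x⟩
  obtain ⟨z, _, hz⟩ := Finset.exists_min_image (Finset.univ : Finset (X × X))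
    (fun z => if z.1 = z.2 then 1 else dist z.1 z.2) ⟨(x₀, x₀), Finset.mem_univ _⟩
  refine ⟨if z.1 = z.2 then 1 else dist z.1 z.2, ?_, fun x y hxy => ?_⟩
  · split_ifs with h
    · exact one_pos
    · exact dist_pos.2 h
  · simpa [hxy] using hz (x, y) (Finset.mem_univ _)

theorem exists_dist_le (X : Type u) [MetricSpace X] [Finite X] :
    ∃ Δ : ℝ, ∀ x y : X, dist x y ≤ Δ := by
  have := Fintype.ofFinite X
  exact ⟨∑ z : X × X, dist z.1 z.2, fun x y =>
    Finset.single_le_sum (f := fun z : X × X => dist z.1 z.2) (fun z _ => dist_nonneg)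
      (Finset.mem_univ (x, y))⟩

theorem two_le_one_add_inv_pow {N : ℕ} (hN : 0 < N) : 2 ≤ (1 + 1 / (N : ℝ)) ^ N := by
  have hN' : (0 : ℝ) < N := by exact_mod_cast hN
  have h := one_add_mul_le_pow (a := 1 / (N : ℝ))
    (by have : 0 ≤ 1 / (N : ℝ) := by positivity
        linarith) N
  rwa [mul_one_div_cancel hN'.ne', one_add_one_eq_two] at h

theorem one_add_inv_pow_le {N : ℕ} (hN : 0 < N) : (1 + 1 / (N : ℝ)) ^ N ≤ Real.exp 1 := by
  have hN' : (0 : ℝ) < N := by exact_mod_cast hN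
  calc (1 + 1 / (N : ℝ)) ^ N ≤ Real.exp (1 / N) ^ N := by
        refine pow_le_pow_left₀ (by positivity) ?_ N
        rw [add_comm]
        exact Real.add_one_le_exp _
    _ = Real.exp 1 := by rw [← Real.exp_nat_mul, mul_one_div_cancel hN'.ne']

theorem one_add_log_le {n : ℕ} (hn : 1 < n) : 1 + Real.log n ≤ 5 / 2 * Real.log n := by
  have h1 : Real.log 2 ≤ Real.log n :=
    Real.log_le_log (by norm_num) (by exact_mod_cast hn)
  have h2 := Real.log_two_gt_d9
  linarith

/-- A random dominating ultrametric with expected distortion `O(log n)`, given by a uniform choice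
from a finite list. -/
theorem exists_random_hst (X : Type u) [MetricSpace X] [Fintype X] (hX : 1 < Fintype.card X) :
    ∃ (Z : Type u) (_ : Fintype Z) (_ : Nonempty Z) (ρ : Z → X → X → ℝ),
      (∀ z, IsDominatingHST (ρ z)) ∧ ∀ x y, ∑ z, ρ z x y ≤
        Fintype.card Z * (2000 * Real.log (Fintype.card X) * dist x y) := by
  classical
  obtain ⟨δ, hδ, hδd⟩ := exists_pos_le_dist X
  obtain ⟨Δ, hΔ⟩ := exists_dist_le X
  set n := Fintype.card X with hn
  let e : X ≃ Fin n := Fintype.equivFin X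
  obtain ⟨N, hN1, hN2⟩ : ∃ N : ℕ, 0 < N ∧ Δ ≤ N * δ := by
    obtain ⟨N, hN⟩ := exists_nat_ge (Δ / δ)
    refine ⟨N + 1, N.succ_pos, ?_⟩
    rw [div_le_iff₀ hδ] at hN
    push_cast
    linarith
  have hN' : (0 : ℝ) < N := by exact_mod_cast hN1
  set s : ℝ := 1 + 1 / (N : ℝ) with hs
  have hs1 : 1 ≤ s := by
    have : 0 ≤ 1 / (N : ℝ) := by positivity
    linarith
  set L := 7 * N with hL
  have hsL : s ^ L = (s ^ N) ^ 7 := by rw [hL, mul_comm, pow_mul]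
  have hsL1 : 100 ≤ s ^ L := by
    rw [hsL]
    have := pow_le_pow_left₀ zero_le_two (two_le_one_add_inv_pow hN1) 7
    exact le_trans (by norm_num) this
  have hsL2 : s ^ L ≤ 1100 := by
    rw [hsL]
    have h1 : s ^ N ≤ 2.7183 :=
      (one_add_inv_pow_le hN1).trans (Real.exp_one_lt_d9.le.trans (by norm_num))
    refine (pow_le_pow_left₀ (by positivity) h1 7).trans (by norm_num)
  set r₀ : ℝ := δ / 4400 with hr₀
  have hr₀0 : 0 < r₀ := by positivity
  obtain ⟨J, hJ⟩ : ∃ J : ℕ, Δ ≤ 2 * (r₀ * 100 ^ J) := by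
    obtain ⟨J, hJ⟩ := pow_unbounded_of_one_lt (Δ / r₀) (by norm_num : (1 : ℝ) < 100)
    refine ⟨J, ?_⟩
    rw [div_lt_iff₀ hr₀0] at hJ
    have : 0 < r₀ * 100 ^ J := by positivity
    linarith
  let R : ℕ → ℕ → ℝ≥0 := fun i j => ⟨r₀ * s ^ (i + L * j), by positivity⟩
  have hRcoe : ∀ i j, (R i j : ℝ) = r₀ * s ^ (i + L * j) := fun i j => rfl
  have hRsucc : ∀ i j, (R i (j + 1) : ℝ) = s ^ L * R i j := by
    intro i j
    rw [hRcoe, hRcoe, mul_add, mul_one, ← add_assoc, pow_add s (i + L * j)]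
    ring
  have hR100 : ∀ i j, 100 * R i j ≤ R i (j + 1) := by
    intro i j
    rw [← NNReal.coe_le_coe, hRsucc]
    exact mul_le_mul_of_nonneg_right hsL1 (R i j).coe_nonneg
  have hRc : ∀ i j, 2 * R i (j + 1) ≤ 2200 * R i j := by
    intro i j
    rw [← NNReal.coe_le_coe]
    push_cast
    rw [hRsucc]
    have := mul_le_mul_of_nonneg_right hsL2 (R i j).coe_nonneg
    linarith
  have hR0 : ∀ i < L, ∀ x y : X, x ≠ y → 2 * (R i 0 : ℝ) < dist x y := by
    intro i hi x y hxy
    refine lt_of_lt_of_le ?_ (hδd x y hxy)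
    rw [hRcoe, mul_zero, add_zero, hr₀]
    have := (pow_le_pow_right₀ hs1 hi.le).trans hsL2
    have h2 := mul_le_mul_of_nonneg_left this (show 0 ≤ δ / 4400 by positivity)
    linarith
  have hRJ : ∀ i, ∀ x y : X, dist x y ≤ 2 * (R i J : ℝ) := by
    intro i x y
    refine (hΔ x y).trans (hJ.trans ?_)
    rw [hRcoe]
    have h1 : (100 : ℝ) ^ J ≤ s ^ (i + L * J) := by
      calc (100 : ℝ) ^ J ≤ (s ^ L) ^ J := pow_le_pow_left₀ (by norm_num) hsL1 J
        _ = s ^ (L * J) := (pow_mul s L J).symm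
        _ ≤ _ := pow_le_pow_right₀ hs1 (Nat.le_add_left _ _)
    have := mul_le_mul_of_nonneg_left h1 hr₀0.le
    linarith
  have hL0 : 0 < L := by positivity
  have hdom := fun (z : ULift.{u} (Fin L) × Equiv.Perm X) =>
    RandomPartition.isDominatingHST_hst e (hR100 z.1.down) (hRc _) (hR0 _ z.1.down.2) (hRJ _) z.2
  refine ⟨ULift (Fin L) × Equiv.Perm X, inferInstance, ⟨⟨⟨⟨0, hL0⟩⟩, 1⟩⟩,
    fun z x y => (RandomPartition.hst e 2200 J (R z.1.down) z.2 x y : ℝ), hdom, fun x y => ?_⟩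
  rcases eq_or_ne x y with rfl | hxy
  · rw [Finset.sum_eq_zero fun z _ => (hdom z).self x, dist_self, mul_zero, mul_zero]
  set P : ℝ := (Fintype.card (Equiv.Perm X) : ℝ) with hP
  set inv : X → ℝ := fun w => ((Finset.univ.filter fun v =>
            min (dist x v) (dist y v) ≤ min (dist x w) (dist y w)).card : ℝ)⁻¹ with hinv
  have hdxy := hδd x y hxy
  have hd0 : 0 < dist x y := dist_pos.2 hxy
  have h1 : ∀ i : Fin L, ∑ π, (RandomPartition.hst e 2200 J (R i) π x y : ℝ) ≤
      ∑ w, 2200 * P * inv w * ∑ j ∈ Finset.range J,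
        if min (dist x w) (dist y w) ≤ r₀ * s ^ ((i : ℕ) + L * j) ∧
          r₀ * s ^ ((i : ℕ) + L * j) < max (dist x w) (dist y w) then
        r₀ * s ^ ((i : ℕ) + L * j) else 0 := by
    intro i
    refine (RandomPartition.sum_hst_le e 2200 J (R i) x y).trans ?_
    simp only [Finset.mul_sum]
    rw [Finset.sum_comm]
    refine Finset.sum_le_sum fun j _ => ?_
    refine (mul_le_mul_of_nonneg_left (RandomPartition.card_center_ne_le e (R i j) x y)
      (by positivity)).trans_eq ?_
    rw [Finset.mul_sum]
    refine Finset.sum_congr rfl fun w _ => ?_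
    simp only [hRcoe]
    split_ifs
    · rw [hP, hinv]
      push_cast
      ring
    · simp
  have h2 : ∀ w, ∑ i : Fin L, ∑ j ∈ Finset.range J,
        (if min (dist x w) (dist y w) ≤ r₀ * s ^ ((i : ℕ) + L * j) ∧
          r₀ * s ^ ((i : ℕ) + L * j) < max (dist x w) (dist y w) then
        r₀ * s ^ ((i : ℕ) + L * j) else 0) ≤ 2 * N * dist x y := by
    intro w
    rw [Fin.sum_univ_eq_sum_range (fun i => ∑ j ∈ Finset.range J,
        (if min (dist x w) (dist y w) ≤ r₀ * s ^ (i + L * j) ∧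
          r₀ * s ^ (i + L * j) < max (dist x w) (dist y w) then
        r₀ * s ^ (i + L * j) else 0)), sum_range_sum_range_add_mul (fun k =>
        (if min (dist x w) (dist y w) ≤ r₀ * s ^ k ∧
          r₀ * s ^ k < max (dist x w) (dist y w) then r₀ * s ^ k else 0))]
    have h3 := sum_geometric_indicator_le hN1 hr₀0
      (le_min (dist_nonneg (x := x) (y := w)) (dist_nonneg (x := y) (y := w)))
      (min_le_max (a := dist x w) (b := dist y w)) (J * L)
    refine le_trans (le_of_eq ?_) (h3.trans ?_)
    · exact Finset.sum_congr rfl fun k _ => by congr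
    · have h4 : max (dist x w) (dist y w) - min (dist x w) (dist y w) ≤ dist x y := by
        rw [max_sub_min_eq_abs]
        have := abs_dist_sub_le y x w
        rwa [dist_comm y x] at this
      have h5 : max (dist x w) (dist y w) ≤ N * dist x y :=
        (max_le (hΔ x w) (hΔ y w)).trans
          (hN2.trans (mul_le_mul_of_nonneg_left hdxy hN'.le))
      have h6 := mul_le_mul_of_nonneg_left h4 hN'.le
      linarith
  have hinv0 : ∀ w, 0 ≤ inv w := fun w => by positivity
  have h3 : ∑ w, inv w ≤ 1 + Real.log n := by
    refine (sum_inv_card_le_harmonic (fun w => min (dist x w) (dist y w)) Finset.univ).trans ?_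
    rw [Finset.card_univ]
    exact harmonic_le_one_add_log _
  have hP0 : 0 ≤ P := by positivity
  calc ∑ z : ULift (Fin L) × Equiv.Perm X,
        (RandomPartition.hst e 2200 J (R z.1.down) z.2 x y : ℝ)
      = ∑ i : Fin L, ∑ π, (RandomPartition.hst e 2200 J (R i) π x y : ℝ) := by
        rw [Fintype.sum_prod_type]
        exact Equiv.ulift.sum_comp
          (fun i : Fin L => ∑ π, (RandomPartition.hst e 2200 J (R i) π x y : ℝ))
    _ ≤ ∑ w, 2200 * P * inv w * (2 * N * dist x y) := by
        refine (Finset.sum_le_sum fun i _ => h1 i).trans ?_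
        rw [Finset.sum_comm]
        refine Finset.sum_le_sum fun w _ => ?_
        rw [← Finset.mul_sum]
        exact mul_le_mul_of_nonneg_left (h2 w)
          (mul_nonneg (mul_nonneg (by norm_num) hP0) (hinv0 w))
    _ = 4400 * P * N * dist x y * ∑ w, inv w := by
        rw [Finset.mul_sum]
        exact Finset.sum_congr rfl fun w _ => by ring
    _ ≤ 4400 * P * N * dist x y * (5 / 2 * Real.log n) :=
        mul_le_mul_of_nonneg_left (h3.trans (one_add_log_le hX)) (by positivity)
    _ ≤ _ := by
        have hlog : 0 ≤ Real.log n := Real.log_nonneg (by exact_mod_cast hX.le)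
        have hcard : (Fintype.card (ULift (Fin L) × Equiv.Perm X) : ℝ) = 7 * N * P := by
          rw [Fintype.card_prod, Fintype.card_ulift, Fintype.card_fin, hL, hP]
          push_cast
          ring
        rw [hcard]
        have : 0 ≤ P * N * dist x y * Real.log n := by positivity
        linarith

/-- By Carathéodory's theorem, `n² + 1` ultrametrics suffice. -/
theorem exists_hst_family (X : Type u) [MetricSpace X] [Fintype X] (hX : 1 < Fintype.card X) :
    ∃ (ι : Type u) (_ : Fintype ι) (ρ : ι → X → X → ℝ) (w : ι → ℝ),
      Fintype.card ι ≤ Fintype.card X ^ 2 + 1 ∧ (∀ i, IsDominatingHST (ρ i)) ∧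
      (∀ i, 0 ≤ w i) ∧ ∑ i, w i = 1 ∧
      ∀ x y, ∑ i, w i * ρ i x y ≤ 2000 * Real.log (Fintype.card X) * dist x y := by
  classical
  obtain ⟨Z, _, _, ρ, hρ, havg⟩ := exists_random_hst X hX
  let v : Z → (X × X → ℝ) := fun z p => ρ z p.1 p.2
  have hcard : (0 : ℝ) < Fintype.card Z := by exact_mod_cast Fintype.card_pos
  have hmem : ∑ z, (Fintype.card Z : ℝ)⁻¹ • v z ∈ convexHull ℝ (Set.range v) := by
    refine (convex_convexHull ℝ _).sum_mem (fun z _ => inv_nonneg.2 hcard.le) ?_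
      fun z _ => subset_convexHull ℝ _ ⟨z, rfl⟩
    rw [Finset.sum_const, Finset.card_univ, nsmul_eq_mul, mul_inv_cancel₀ hcard.ne']
  obtain ⟨ι, _, u, w, hu, hind, hw, hw1, hsum⟩ := eq_pos_convex_span_of_mem_convexHull hmem
  choose f hf using fun i => hu ⟨i, rfl⟩
  refine ⟨ι, ‹_›, fun i => ρ (f i), w, ?_, fun i => hρ _, fun i => (hw i).le, hw1, fun x y => ?_⟩
  · have := hind.card_le_finrank_succ
    refine this.trans (Nat.succ_le_succ ((Submodule.finrank_le _).trans_eq ?_))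
    rw [Module.finrank_fintype_fun_eq_card, Fintype.card_prod, sq]
  · have h1 := congrFun hsum (x, y)
    simp only [Finset.sum_apply, Pi.smul_apply, smul_eq_mul, ← hf] at h1
    have h2 : ∑ i, w i * ρ (f i) x y = (Fintype.card Z : ℝ)⁻¹ * ∑ z, ρ z x y := by
      rw [Finset.mul_sum]
      exact h1
    rw [h2, inv_mul_le_iff₀ hcard]
    exact havg x y

namespace IsDominatingHST

variable {X : Type u} [MetricSpace X] {ρ : X → X → ℝ}

theorem nonneg (h : IsDominatingHST ρ) (x y : X) : 0 ≤ ρ x y := dist_nonneg.trans (h.dist_le x y)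

theorem eq_of_lt (h : IsDominatingHST ρ) {x y z : X} (hlt : ρ x y < ρ y z) : ρ x z = ρ y z := by
  refine le_antisymm ((h.ultra x y z).trans (max_le hlt.le le_rfl)) ?_
  have := h.ultra y x z
  rw [h.symm y x] at this
  rcases le_max_iff.1 this with h1 | h1
  · exact absurd h1 (not_le.2 hlt)
  · exact h1

end IsDominatingHST

open scoped Classical in
/-- The part that contains `y` when `B` is partitioned around `z`: points are in the same part if
they are closer to each other than to `z`. -/
def hstCell {X : Type u} (ρ : X → X → ℝ) (z : X) (B : Finset X) (y : X) : Finset X :=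
  B.filter fun w => w = y ∨ ρ w y < ρ y z

section Cells

variable {X : Type u} {ρ : X → X → ℝ}

theorem mem_hstCell {z : X} {B : Finset X} {y w : X} :
    w ∈ hstCell ρ z B y ↔ w ∈ B ∧ (w = y ∨ ρ w y < ρ y z) := by
  simp [hstCell]

theorem hstCell_subset (z : X) (B : Finset X) (y : X) : hstCell ρ z B y ⊆ B :=
  fun _ hw => (mem_hstCell.1 hw).1

theorem self_mem_hstCell {z : X} {B : Finset X} {y : X} (hy : y ∈ B) : y ∈ hstCell ρ z B y :=
  mem_hstCell.2 ⟨hy, Or.inl rfl⟩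

section

variable [Nonempty X]

variable (ρ) in
/-- A point around which all parts of `B` have at most half the size of `B`. -/
def hstCenter (B : Finset X) : X :=
  Classical.epsilon fun z => z ∈ B ∧ ∀ y ∈ B, 2 * (hstCell ρ z B y).card ≤ B.card

variable (ρ) in
/-- The part that contains `y` in the partition of `B` around its center. -/
def hstKid (B : Finset X) (y : X) : Finset X := hstCell ρ (hstCenter ρ B) B y

variable (ρ) in
/-- The clusters of the hierarchy of partitions, down to two points. -/
inductive IsHSTCluster [Fintype X] : Finset X → Prop
  | univ : IsHSTCluster Finset.univ
  | kid (B : Finset X) (y : X) : IsHSTCluster B → y ∈ B → 2 ≤ (hstKid ρ B y).card →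
    IsHSTCluster (hstKid ρ B y)

theorem IsHSTCluster.two_le_card [Fintype X] (hX : 1 < Fintype.card X) {B : Finset X}
    (h : IsHSTCluster ρ B) : 2 ≤ B.card := by
  cases h with
  | univ => rwa [Finset.card_univ]
  | kid B y _ _ h => exact h

end

variable [MetricSpace X]

theorem IsDominatingHST.hstCell_center (h : IsDominatingHST ρ) {z : X} {B : Finset X}
    (hz : z ∈ B) : hstCell ρ z B z = {z} := by
  ext w
  rw [mem_hstCell, h.self, Finset.mem_singleton]
  constructor
  · rintro ⟨_, rfl | h1⟩
    · rfl
    · exact absurd h1 (not_lt.2 (h.nonneg _ _))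
  · rintro rfl
    exact ⟨hz, Or.inl rfl⟩

theorem IsDominatingHST.dist_center_eq (h : IsDominatingHST ρ) {z : X} {B : Finset X} {y w : X}
    (hw : w ∈ hstCell ρ z B y) : ρ w z = ρ y z := by
  rcases (mem_hstCell.1 hw).2 with rfl | h1
  · rfl
  · exact h.eq_of_lt h1

theorem IsDominatingHST.hstCell_eq (h : IsDominatingHST ρ) {z : X} {B : Finset X} {y w : X}
    (hw : w ∈ hstCell ρ z B y) : hstCell ρ z B w = hstCell ρ z B y := by
  rcases (mem_hstCell.1 hw).2 with rfl | h1
  · rfl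
  · have hz := h.dist_center_eq hw
    have hpos : 0 < ρ y z := (h.nonneg w y).trans_lt h1
    ext u
    rw [mem_hstCell, mem_hstCell, hz]
    refine and_congr_right fun _ => ?_
    have e1 : (u = w ∨ ρ u w < ρ y z) ↔ ρ u w < ρ y z := by
      refine or_iff_right_of_imp ?_
      rintro rfl
      rwa [h.self]
    have e2 : (u = y ∨ ρ u y < ρ y z) ↔ ρ u y < ρ y z := by
      refine or_iff_right_of_imp ?_
      rintro rfl
      rwa [h.self]
    rw [e1, e2]
    constructor
    · intro h2
      exact (h.ultra u w y).trans_lt (max_lt h2 h1)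
    · intro h2
      exact (h.ultra u y w).trans_lt (max_lt h2 (by rwa [h.symm]))

theorem IsDominatingHST.mul_dist_le_of_mem_hstCell (h : IsDominatingHST ρ) {z : X} {B : Finset X}
    {y u u' : X} (hu : u ∈ hstCell ρ z B y) (hu' : u' ∈ hstCell ρ z B y) :
    100 * ρ u u' ≤ ρ y z := by
  rw [← h.hstCell_eq hu'] at hu
  rw [← h.dist_center_eq hu']
  rcases (mem_hstCell.1 hu).2 with rfl | h1
  · rw [h.self, mul_zero]
    exact h.nonneg _ _
  · exact h.gap _ _ _ _ h1

theorem IsDominatingHST.dist_center_le (h : IsDominatingHST ρ) {z : X} {B : Finset X} {x y : X}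
    (hx : x ∈ B) (hne : hstCell ρ z B x ≠ hstCell ρ z B y) : ρ y z ≤ ρ x y := by
  by_contra! hlt
  exact hne (h.hstCell_eq (mem_hstCell.2 ⟨hx, Or.inr hlt⟩))

theorem IsDominatingHST.exists_center (h : IsDominatingHST ρ) {B : Finset X} (hB : 2 ≤ B.card) :
    ∃ z ∈ B, ∀ y ∈ B, 2 * (hstCell ρ z B y).card ≤ B.card := by
  classical
  obtain ⟨x₀, hx₀⟩ : B.Nonempty := Finset.card_pos.1 (by omega)
  by_cases hbig : ∃ p ∈ B ×ˢ B, B.card < 2 * (hstCell ρ p.2 B p.1).card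
  · obtain ⟨p₀, hp₀, hbig₀⟩ := hbig
    obtain ⟨p, hp, hmin⟩ := Finset.exists_min_image
      ((B ×ˢ B).filter fun p => B.card < 2 * (hstCell ρ p.2 B p.1).card)
      (fun p => (hstCell ρ p.2 B p.1).card) ⟨p₀, Finset.mem_filter.2 ⟨hp₀, hbig₀⟩⟩
    obtain ⟨hpB, hpbig⟩ := Finset.mem_filter.1 hp
    obtain ⟨hz, hz₀⟩ := Finset.mem_product.1 hpB
    obtain ⟨z, z₀⟩ := p
    dsimp only at hz hz₀ hpbig hmin
    refine ⟨z, hz, fun y hy => ?_⟩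
    by_contra! hC
    rcases eq_or_ne y z with rfl | hyz
    · rw [h.hstCell_center hy, Finset.card_singleton] at hC
      omega
    have hzC : z ∉ hstCell ρ z B y := by
      rw [mem_hstCell, h.symm z y]
      rintro ⟨_, h1 | h1⟩
      · exact hyz h1.symm
      · exact lt_irrefl _ h1
    obtain ⟨u, hu⟩ : (hstCell ρ z B y ∩ hstCell ρ z₀ B z).Nonempty := by
      rw [← Finset.card_pos]
      have h1 := Finset.card_union_add_card_inter (hstCell ρ z B y) (hstCell ρ z₀ B z)
      have h2 := Finset.card_le_card
        (Finset.union_subset (hstCell_subset (ρ := ρ) z B y) (hstCell_subset (ρ := ρ) z₀ B z))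
      omega
    obtain ⟨huC, huK⟩ := Finset.mem_inter.1 hu
    have huz : ρ u z < ρ z z₀ := by
      rcases (mem_hstCell.1 huK).2 with rfl | h1
      · exact absurd huC hzC
      · exact h1
    rw [h.dist_center_eq huC] at huz
    have hsub : hstCell ρ z B y ⊂ hstCell ρ z₀ B z := by
      refine ⟨fun w hw => mem_hstCell.2 ⟨hstCell_subset z B y hw, Or.inr ?_⟩, fun hcon =>
        hzC (hcon (self_mem_hstCell hz))⟩
      rwa [h.dist_center_eq hw]
    have h1 := Finset.card_lt_card hsub
    have h2 := hmin (y, z) (Finset.mem_filter.2 ⟨Finset.mem_product.2 ⟨hy, hz⟩, hC⟩)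
    dsimp only at h2
    omega
  · push Not at hbig
    exact ⟨x₀, hx₀, fun y hy => hbig (y, x₀) (Finset.mem_product.2 ⟨hy, hx₀⟩)⟩

variable [Nonempty X]

theorem IsDominatingHST.hstCenter_mem (h : IsDominatingHST ρ) {B : Finset X} (hB : 2 ≤ B.card) :
    hstCenter ρ B ∈ B := (Classical.epsilon_spec (h.exists_center hB)).1

theorem IsDominatingHST.card_hstKid_le (h : IsDominatingHST ρ) {B : Finset X} (hB : 2 ≤ B.card)
    {y : X} (hy : y ∈ B) : 2 * (hstKid ρ B y).card ≤ B.card :=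
  (Classical.epsilon_spec (h.exists_center hB)).2 y hy

theorem IsHSTCluster.exists_hstKid_eq_singleton [Fintype X] (hX : 1 < Fintype.card X)
    (hρ : IsDominatingHST ρ) (x : X) :
    ∃ B, IsHSTCluster ρ B ∧ x ∈ B ∧ hstKid ρ B x = {x} := by
  suffices H : ∀ n, ∀ B : Finset X, B.card = n → IsHSTCluster ρ B → x ∈ B →
      ∃ B, IsHSTCluster ρ B ∧ x ∈ B ∧ hstKid ρ B x = {x} from
    H _ Finset.univ rfl .univ (Finset.mem_univ x)
  intro n
  induction n using Nat.strong_induction_on with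
  | _ n ih =>
    intro B hn hB hx
    have h2 := hB.two_le_card hX
    have hmem : x ∈ hstKid ρ B x := self_mem_hstCell hx
    rcases Nat.lt_or_ge 1 (hstKid ρ B x).card with h1 | h1
    · have := hρ.card_hstKid_le h2 hx
      exact ih _ (by omega) _ rfl (.kid B x hB hx h1) hmem
    · refine ⟨B, hB, hx, ?_⟩
      exact (Finset.eq_of_subset_of_card_le (Finset.singleton_subset_iff.2 hmem)
        (by rwa [Finset.card_singleton])).symm

end Cells

/-- A random dominating ultrametric with finitely many values. -/
structure HSTFamily (X : Type u) [MetricSpace X] [Fintype X] where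
  ι : Type u
  [fintypeι : Fintype ι]
  ρ : ι → X → X → ℝ
  isHST : ∀ i, IsDominatingHST (ρ i)
  w : ι → ℝ
  w_nonneg : ∀ i, 0 ≤ w i
  w_sum : ∑ i, w i = 1
  δ : ℝ
  δ_pos : 0 < δ
  δ_le : ∀ x y : X, x ≠ y → δ ≤ dist x y
  one_lt_card : 1 < Fintype.card X

attribute [instance] HSTFamily.fintypeι

namespace HSTFamily

variable {X : Type u} [MetricSpace X] [Fintype X] [Nonempty X] (T : HSTFamily X)

set_option linter.unusedSectionVars false

/-- The vertices: a source, the clusters of each hierarchy, and the points of `X`. -/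
inductive Node : Type u
  | root : Node
  | cluster (i : T.ι) (B : {B : Finset X // IsHSTCluster (T.ρ i) B}) : Node
  | leaf (x : X) : Node

variable {T}

open scoped Classical in
instance : Fintype T.Node :=
  Fintype.ofInjective (β := Option ((T.ι × Finset X) ⊕ X))
    (fun
      | .root => none
      | .cluster i B => some (.inl (i, B.1))
      | .leaf x => some (.inr x)) (by
    rintro (_ | ⟨i, B⟩ | x) (_ | ⟨j, C⟩ | y) h <;> simp_all
    obtain ⟨rfl, h⟩ := h
    exact heq_of_eq (Subtype.ext h))

/-- The points below a vertex. -/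
def Node.pts : T.Node → Finset X
  | .root => Finset.univ
  | .cluster _ B => B.1
  | .leaf x => {x}

open scoped Classical in
/-- The child of the cluster `B` whose points include `y`. -/
def child (i : T.ι) (B : {B : Finset X // IsHSTCluster (T.ρ i) B}) (y : X) : T.Node :=
  if h : y ∈ B.1 ∧ 2 ≤ (hstKid (T.ρ i) B.1 y).card
    then .cluster i ⟨_, .kid B.1 y B.2 h.1 h.2⟩ else .leaf y

/-- The arcs. -/
def Adj : T.Node → T.Node → Prop
  | .root, b => ∃ i, b = .cluster i ⟨Finset.univ, .univ⟩
  | .cluster i B, b => ∃ y ∈ B.1, b = child i B y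
  | .leaf _, _ => False

theorem pts_child {i : T.ι} {B : {B : Finset X // IsHSTCluster (T.ρ i) B}} {y : X}
    (hy : y ∈ B.1) : (child i B y).pts = hstKid (T.ρ i) B.1 y := by
  unfold child
  split_ifs with h
  · rfl
  · have hmem : y ∈ hstKid (T.ρ i) B.1 y := self_mem_hstCell hy
    have h1 : (hstKid (T.ρ i) B.1 y).card ≤ 1 := by
      by_contra! hcon
      exact h ⟨hy, hcon⟩
    exact Finset.eq_of_subset_of_card_le (Finset.singleton_subset_iff.2 hmem)
      (by rwa [Node.pts, Finset.card_singleton])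

theorem child_eq_of_mem {i : T.ι} {B : {B : Finset X // IsHSTCluster (T.ρ i) B}} {x y : X}
    (hy : y ∈ B.1) (hx : x ∈ (child i B y).pts) : child i B x = child i B y := by
  rw [pts_child hy] at hx
  have hxB : x ∈ B.1 := hstCell_subset _ _ _ hx
  have e : hstKid (T.ρ i) B.1 x = hstKid (T.ρ i) B.1 y := (T.isHST i).hstCell_eq hx
  unfold child
  by_cases h : 2 ≤ (hstKid (T.ρ i) B.1 y).card
  · rw [dif_pos ⟨hxB, e ▸ h⟩, dif_pos ⟨hy, h⟩]
    congr 2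
  · rw [dif_neg (fun h' => h (e ▸ h'.2)), dif_neg fun h' => h h'.2]
    have h1 : (hstKid (T.ρ i) B.1 y).card ≤ 1 := by omega
    rw [Finset.card_le_one.1 h1 x hx y (self_mem_hstCell hy)]

theorem mem_pts_child {i : T.ι} {B : {B : Finset X // IsHSTCluster (T.ρ i) B}} {y : X}
    (hy : y ∈ B.1) : y ∈ (child i B y).pts := by
  rw [pts_child hy]
  exact self_mem_hstCell hy

theorem pts_child_subset {i : T.ι} {B : {B : Finset X // IsHSTCluster (T.ρ i) B}} {y : X}
    (hy : y ∈ B.1) : (child i B y).pts ⊆ B.1 := by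
  rw [pts_child hy]
  exact hstCell_subset _ _ _

theorem card_pts_child_le {i : T.ι} {B : {B : Finset X // IsHSTCluster (T.ρ i) B}} {y : X}
    (hy : y ∈ B.1) : 2 * (child i B y).pts.card ≤ B.1.card := by
  rw [pts_child hy]
  exact (T.isHST i).card_hstKid_le (B.2.two_le_card T.one_lt_card) hy

theorem card_pts_child_pos {i : T.ι} {B : {B : Finset X // IsHSTCluster (T.ρ i) B}} {y : X}
    (hy : y ∈ B.1) : 0 < (child i B y).pts.card :=
  Finset.card_pos.2 ⟨y, mem_pts_child hy⟩

theorem hstCenter_mem (i : T.ι) (B : {B : Finset X // IsHSTCluster (T.ρ i) B}) :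
    hstCenter (T.ρ i) B.1 ∈ B.1 := (T.isHST i).hstCenter_mem (B.2.two_le_card T.one_lt_card)

theorem child_ne_root {i : T.ι} {B : {B : Finset X // IsHSTCluster (T.ρ i) B}} {y : X} :
    child i B y ≠ .root := by
  unfold child
  split_ifs <;> simp

/-- A strictly decreasing rank. -/
def Node.rank : T.Node → ℕ
  | .root => Fintype.card X + 1
  | .cluster _ B => B.1.card
  | .leaf _ => 1

theorem Node.rank_eq {a : T.Node} (h : a ≠ .root) : a.rank = a.pts.card := by
  cases a with
  | root => exact absurd rfl h
  | cluster i B => rfl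
  | leaf x => simp [Node.rank, Node.pts]

theorem rank_lt {a b : T.Node} (h : Adj a b) : b.rank < a.rank := by
  cases a with
  | root =>
    obtain ⟨i, rfl⟩ := h
    simp [Node.rank]
  | cluster i B =>
    obtain ⟨y, hy, rfl⟩ := h
    rw [Node.rank_eq child_ne_root]
    have h1 := card_pts_child_le hy
    have h2 := card_pts_child_pos hy
    simp only [Node.rank]
    omega
  | leaf x => exact h.elim

theorem exists_cluster_adj_leaf (i : T.ι) (x : X) :
    ∃ B : {B : Finset X // IsHSTCluster (T.ρ i) B}, Adj (.cluster i B) (Node.leaf x : T.Node) := by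
  obtain ⟨B, hB, hx, h⟩ := IsHSTCluster.exists_hstKid_eq_singleton T.one_lt_card (T.isHST i) x
  refine ⟨⟨B, hB⟩, x, hx, ?_⟩
  unfold child
  rw [dif_neg]
  rintro ⟨_, h2⟩
  rw [h, Finset.card_singleton] at h2
  omega

theorem exists_index : Nonempty T.ι := by
  by_contra hcon
  rw [not_nonempty_iff] at hcon
  have := T.w_sum
  simp at this

variable (T) in
/-- The directed acyclic graph of the family. -/
@[reducible] def flowDAG : FlowDAG X where
  V := T.Node
  Adj := Adj
  acyclic := by
    have : ∀ a b : T.Node, Relation.TransGen Adj a b → b.rank < a.rank := by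
      intro a b h
      induction h with
      | single h => exact rank_lt h
      | tail _ h ih => exact (rank_lt h).trans ih
    exact fun v h => lt_irrefl _ (this v v h)
  root := .root
  source_iff := by
    intro v
    constructor
    · intro h
      cases v with
      | root => rfl
      | cluster i B =>
        obtain ⟨B, hB⟩ := B
        exfalso
        cases hB with
        | univ => exact h .root ⟨i, rfl⟩
        | kid B y hB hy h2 =>
          refine h (.cluster i ⟨B, hB⟩) ⟨y, hy, ?_⟩
          unfold child
          rw [dif_pos ⟨hy, h2⟩]
      | leaf x =>
        obtain ⟨i⟩ := exists_index (T := T)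
        obtain ⟨B, hB⟩ := exists_cluster_adj_leaf i x
        exact absurd hB (h _)
    · rintro rfl a ha
      cases a with
      | root => obtain ⟨i, hi⟩ := ha; cases hi
      | cluster i B => obtain ⟨y, _, hy⟩ := ha; exact child_ne_root hy.symm
      | leaf x => exact ha
  sink := ⟨.leaf, fun x y h => by simpa using h⟩
  sink_iff := by
    intro v
    constructor
    · intro h
      cases v with
      | root =>
        obtain ⟨i⟩ := exists_index (T := T)
        exact absurd ⟨i, rfl⟩ (h _)
      | cluster i B => exact absurd ⟨_, hstCenter_mem i B, rfl⟩ (h (child i B _))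
      | leaf x => exact ⟨x, rfl⟩
    · rintro ⟨x, rfl⟩ b h
      exact h

theorem sum_out_root (f : T.Node → ℝ) :
    ∑ b ∈ T.flowDAG.out (Node.root : T.Node), f b = ∑ i, f (.cluster i ⟨Finset.univ, .univ⟩) := by
  classical
  have : T.flowDAG.out (Node.root : T.Node) = Finset.univ.image fun i : T.ι =>
      (.cluster i ⟨Finset.univ, .univ⟩ : T.Node) := by
    ext b
    rw [FlowDAG.mem_out, Finset.mem_image]
    constructor
    · rintro ⟨i, rfl⟩
      exact ⟨i, Finset.mem_univ _, rfl⟩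
    · rintro ⟨i, _, rfl⟩
      exact ⟨i, rfl⟩
  rw [this, Finset.sum_image]
  intro i _ j _ h
  simp only [Node.cluster.injEq] at h
  exact h.1

theorem mem_out_cluster {i : T.ι} {B : {B : Finset X // IsHSTCluster (T.ρ i) B}} {b : T.Node} :
    b ∈ T.flowDAG.out (Node.cluster i B : T.Node) ↔ ∃ y ∈ B.1, b = child i B y :=
  T.flowDAG.mem_out

theorem sum_card_pts_out_cluster (i : T.ι) (B : {B : Finset X // IsHSTCluster (T.ρ i) B}) :
    ∑ b ∈ T.flowDAG.out (Node.cluster i B : T.Node), b.pts.card = B.1.card := by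
  classical
  symm
  rw [Finset.card_eq_sum_card_fiberwise (f := child i B)
    (t := T.flowDAG.out (Node.cluster i B : T.Node))
    (fun y hy => Finset.mem_coe.2 (mem_out_cluster.2 ⟨y, hy, rfl⟩))]
  refine Finset.sum_congr rfl fun b hb => ?_
  obtain ⟨y, hy, rfl⟩ := mem_out_cluster.1 hb
  congr 1
  ext x
  rw [Finset.mem_filter]
  constructor
  · rintro ⟨hx, hxy⟩
    rw [← hxy]
    exact mem_pts_child hx
  · intro hx
    exact ⟨pts_child_subset hy hx, child_eq_of_mem hy hx⟩

variable (T) in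
/-- The length of the arcs at the source. -/
def top : ℝ := 1 + 100 * ∑ i, ∑ x, ∑ y, T.ρ i x y

theorem mul_le_top (i : T.ι) (x y : X) : 100 * T.ρ i x y ≤ T.top := by
  have h0 := fun i => (T.isHST i).nonneg
  have h1 := Finset.single_le_sum (f := fun i => ∑ x, ∑ y, T.ρ i x y)
    (fun i _ => Finset.sum_nonneg fun x _ => Finset.sum_nonneg fun y _ => h0 i x y)
    (Finset.mem_univ i)
  have h2 := Finset.single_le_sum (f := fun x => ∑ y, T.ρ i x y)
    (fun x _ => Finset.sum_nonneg fun y _ => h0 i x y) (Finset.mem_univ x)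
  have h3 := Finset.single_le_sum (f := fun y => T.ρ i x y)
    (fun y _ => h0 i x y) (Finset.mem_univ y)
  unfold top
  linarith

theorem top_pos : 0 < T.top := by
  have h0 := fun i => (T.isHST i).nonneg
  have := Finset.sum_nonneg fun i (_ : i ∈ Finset.univ) => Finset.sum_nonneg fun x
    (_ : x ∈ Finset.univ) => Finset.sum_nonneg fun y (_ : y ∈ Finset.univ) => h0 i x y
  unfold top
  linarith

/-- The length of the arc from the cluster `B` to its part `C`. -/
def len (i : T.ι) (B C : Finset X) : ℝ :=
  max T.δ (T.ρ i (Classical.epsilon fun y => y ∈ C) (hstCenter (T.ρ i) B))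

/-- The largest distance from the center of a cluster. -/
def radius (i : T.ι) (B : Finset X) : ℝ :=
  T.ρ i (Classical.epsilon fun y => y ∈ B ∧ ∀ y' ∈ B,
    T.ρ i y' (hstCenter (T.ρ i) B) ≤ T.ρ i y (hstCenter (T.ρ i) B)) (hstCenter (T.ρ i) B)

theorem radius_spec (i : T.ι) {B : Finset X} (hB : B.Nonempty) :
    (∀ y ∈ B, T.ρ i y (hstCenter (T.ρ i) B) ≤ radius i B) ∧
      ∃ y ∈ B, radius i B = T.ρ i y (hstCenter (T.ρ i) B) := by
  have h := Classical.epsilon_spec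
    (B.exists_max_image (fun y => T.ρ i y (hstCenter (T.ρ i) B)) hB)
  exact ⟨h.2, _, h.1, rfl⟩

theorem len_child {i : T.ι} {B : {B : Finset X // IsHSTCluster (T.ρ i) B}} {y : X} (hy : y ∈ B.1) :
    len i B.1 (child i B y).pts = max T.δ (T.ρ i y (hstCenter (T.ρ i) B.1)) := by
  unfold len
  have h : (Classical.epsilon fun x => x ∈ (child i B y).pts) ∈ (child i B y).pts :=
    Classical.epsilon_spec (p := fun x => x ∈ (child i B y).pts) ⟨y, mem_pts_child hy⟩
  set e := (Classical.epsilon fun x => x ∈ (child i B y).pts)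
  rw [pts_child hy] at h
  rw [(T.isHST i).dist_center_eq h]

theorem δ_le_radius {i : T.ι} (B : {B : Finset X // IsHSTCluster (T.ρ i) B}) :
    T.δ ≤ radius i B.1 := by
  have h2 := B.2.two_le_card T.one_lt_card
  obtain ⟨y, hy, hne⟩ := Finset.exists_mem_ne (s := B.1) (by omega) (hstCenter (T.ρ i) B.1)
  exact (T.δ_le _ _ hne).trans (((T.isHST i).dist_le _ _).trans
    ((radius_spec i ⟨y, hy⟩).1 y hy))

theorem len_child_le {i : T.ι} {B : {B : Finset X // IsHSTCluster (T.ρ i) B}} {y : X}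
    (hy : y ∈ B.1) : len i B.1 (child i B y).pts ≤ radius i B.1 := by
  rw [len_child hy]
  exact max_le (δ_le_radius B) ((radius_spec i ⟨y, hy⟩).1 y hy)

theorem radius_nonneg {i : T.ι} (B : {B : Finset X // IsHSTCluster (T.ρ i) B}) :
    0 ≤ radius i B.1 := T.δ_pos.le.trans (δ_le_radius B)

open scoped Classical in
/-- Arc lengths. -/
def arcLength : T.Node → T.Node → ℝ
  | .root, _ => T.top
  | .cluster i B, b => len i B.1 b.pts
  | .leaf _, _ => 1

/-- An upper bound for the lengths of the arcs that leave a vertex. -/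
def width : T.Node → ℝ
  | .root => T.top
  | .cluster i B => radius i B.1
  | .leaf _ => 0

/-- Transition probabilities. -/
def prob : T.Node → T.Node → ℝ
  | .root, _ => 1 / Fintype.card T.ι
  | .cluster _ B, b => b.pts.card / B.1.card
  | .leaf _, _ => 1

theorem width_nonneg (a : T.Node) : 0 ≤ width a := by
  cases a with
  | root => exact top_pos.le
  | cluster i B => exact radius_nonneg B
  | leaf x => exact le_rfl

theorem arcLength_le {a b : T.Node} (h : Adj a b) : arcLength a b ≤ width a := by
  cases a with
  | root => exact le_rfl
  | cluster i B =>
    obtain ⟨y, hy, rfl⟩ := h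
    exact len_child_le hy
  | leaf x => exact h.elim

theorem arcLength_pos {a b : T.Node} (h : Adj a b) : 0 < arcLength a b := by
  cases a with
  | root => exact top_pos
  | cluster i B =>
    obtain ⟨y, hy, rfl⟩ := h
    simp only [arcLength]
    rw [len_child hy]
    exact T.δ_pos.trans_le (le_max_left _ _)
  | leaf x => exact h.elim

theorem width_le {a b : T.Node} (h : Adj a b) : 100 * width b ≤ arcLength a b := by
  cases a with
  | root =>
    obtain ⟨i, rfl⟩ := h
    simp only [width, arcLength]
    exact mul_le_top _ _ _
  | cluster i B =>
    obtain ⟨y, hy, rfl⟩ := h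
    simp only [arcLength]
    have hpos := (arcLength_pos (T := T) (a := .cluster i B) ⟨y, hy, rfl⟩).le
    simp only [arcLength] at hpos
    have hp := pts_child hy
    have hl := len_child hy
    generalize hc : child i B y = c at *
    cases c with
    | root => exact absurd hc child_ne_root
    | cluster j C =>
      have hj : j = i := by
        unfold child at hc
        split_ifs at hc
        simp only [Node.cluster.injEq] at hc
        exact hc.1.symm
      subst hj
      simp only [width, Node.pts] at hl hp ⊢
      rw [hl]
      refine le_trans ?_ (le_max_right _ _)
      have hC := hstCenter_mem j C
      obtain ⟨u, hu, hur⟩ := (radius_spec j ⟨_, hC⟩).2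
      rw [hur]
      rw [hp] at hu hC ⊢
      exact (T.isHST j).mul_dist_le_of_mem_hstCell hu hC
    | leaf x => simpa [width] using hpos
  | leaf x => exact h.elim

variable (T) in
/-- The marked DAG of the family. -/
@[reducible] def markedDAG : MarkedDAG X where
  toFlowDAG := T.flowDAG
  ω := arcLength
  ω_pos := fun a b h => arcLength_pos h
  ω_decreasing := fun a b e h h' => by
    have h1 := arcLength_le h'
    have h2 := width_le h
    have h3 := arcLength_pos h
    have h4 := width_nonneg (T := T) b
    linarith
  θ := prob
  θ_pos := by
    intro a b h
    cases a with
    | root =>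
      have := exists_index (T := T)
      have : 0 < Fintype.card T.ι := Fintype.card_pos
      simp only [prob]
      positivity
    | cluster i B =>
      obtain ⟨y, hy, rfl⟩ := h
      have h1 := card_pts_child_pos hy
      have h2 : 0 < B.1.card := Finset.card_pos.2 ⟨y, hy⟩
      simp only [prob]
      positivity
    | leaf x => exact h.elim
  θ_sum := by
    intro a ha
    cases a with
    | root =>
      rw [sum_out_root]
      have := exists_index (T := T)
      have : (0 : ℝ) < Fintype.card T.ι := by exact_mod_cast Fintype.card_pos
      simp only [prob, Finset.sum_const, Finset.card_univ, nsmul_eq_mul]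
      exact mul_one_div_cancel this.ne'
    | cluster i B =>
      simp only [prob]
      rw [← Finset.sum_div, ← Nat.cast_sum, sum_card_pts_out_cluster]
      have : 0 < B.1.card := Finset.card_pos.2 ⟨_, hstCenter_mem i B⟩
      exact div_self (by exact_mod_cast this.ne')
    | leaf x => exact absurd ⟨x, rfl⟩ ha

end HSTFamily

theorem sum_mul_abs_ite_sub_ite_le {V : Type*} [DecidableEq V] {s : Finset V} {f : V → ℝ}
    (hf : ∀ b ∈ s, 0 ≤ f b) {u v : V} (hu : u ∈ s) (hv : v ∈ s) :
    ∑ b ∈ s, f b * |(if b = v then 1 else 0) - (if b = u then 1 else 0)| ≤ f u + f v := by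
  calc _ ≤ ∑ b ∈ s, ((if b = u then f b else 0) + (if b = v then f b else 0)) := by
        refine Finset.sum_le_sum fun b hb => ?_
        have := hf b hb
        split_ifs <;> norm_num
        all_goals linarith
    _ = f u + f v := by
        rw [Finset.sum_add_distrib, Finset.sum_ite_eq', Finset.sum_ite_eq', if_pos hu, if_pos hv]

namespace HSTFamily

variable {X : Type u} [MetricSpace X] [Fintype X] [Nonempty X] {T : HSTFamily X}

set_option linter.unusedSectionVars false

theorem pts_mono {a b : T.Node} (h : Adj a b) : b.pts ⊆ a.pts := by
  cases a with
  | root => exact Finset.subset_univ _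
  | cluster i B =>
    obtain ⟨y, hy, rfl⟩ := h
    exact pts_child_subset hy
  | leaf x => exact h.elim

/-- The weight of the heaviest path from a vertex to a sink, up to a constant. -/
def height : T.Node → ℝ
  | .root => 1 + Real.log (Fintype.card T.ι) + 3 * Real.log (Fintype.card X)
  | b => 3 * Real.log b.pts.card

theorem height_nonneg (a : T.Node) : 0 ≤ height a := by
  cases a with
  | root =>
    have h1 := Real.log_natCast_nonneg (Fintype.card T.ι)
    have h2 := Real.log_natCast_nonneg (Fintype.card X)
    simp only [height]
    linarith
  | cluster i B =>
    have := Real.log_natCast_nonneg B.1.card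
    simp only [height, Node.pts]
    linarith
  | leaf x => simp [height, Node.pts]

theorem height_of_ne_root {a : T.Node} (h : a ≠ .root) : height a = 3 * Real.log a.pts.card := by
  cases a with
  | root => exact absurd rfl h
  | cluster i B => rfl
  | leaf x => rfl

theorem height_le {a b : T.Node} (h : Adj a b) : T.markedDAG.η a b + height b ≤ height a := by
  unfold MarkedDAG.η
  cases a with
  | root =>
    obtain ⟨i, rfl⟩ := h
    simp only [prob, one_div_one_div, height, Node.pts, Finset.card_univ]
    exact le_rfl
  | cluster i B =>
    obtain ⟨y, hy, rfl⟩ := h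
    have h1 := card_pts_child_le hy
    have h2 := card_pts_child_pos hy
    have hC : (0 : ℝ) < (child i B y).pts.card := by exact_mod_cast h2
    have hBC : 2 * ((child i B y).pts.card : ℝ) ≤ B.1.card := by exact_mod_cast h1
    have hlog := Real.log_le_log (by positivity) hBC
    rw [Real.log_mul two_ne_zero hC.ne'] at hlog
    rw [height_of_ne_root child_ne_root]
    simp only [prob, one_div_div, height]
    rw [show (Node.cluster i B : T.Node).pts = B.1 from rfl, Real.log_div (by linarith) hC.ne']
    have := Real.log_two_gt_d9
    linarith
  | leaf x => exact h.elim

theorem dist_le {a b b' : T.Node} (h : Adj a b) (h' : Adj a b') (hne : b ≠ b') {x y : X}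
    (hx : x ∈ b.pts) (hy : y ∈ b'.pts) : dist x y ≤ arcLength a b + arcLength a b' := by
  cases a with
  | root =>
    obtain ⟨i, rfl⟩ := h
    have h1 := (T.isHST i).dist_le x y
    have h2 := (T.isHST i).nonneg x y
    have h3 := mul_le_top i x y
    simp only [arcLength]
    linarith
  | cluster i B =>
    obtain ⟨u, hu, rfl⟩ := h
    obtain ⟨v, hv, rfl⟩ := h'
    simp only [arcLength]
    rw [len_child hu, len_child hv]
    rw [pts_child hu] at hx
    rw [pts_child hv] at hy
    have hx' := (T.isHST i).dist_center_eq hx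
    have hy' := (T.isHST i).dist_center_eq hy
    have h1 := (T.isHST i).dist_le x y
    have h2 := (T.isHST i).ultra x (hstCenter (T.ρ i) B.1) y
    rw [hx', (T.isHST i).symm (hstCenter (T.ρ i) B.1) y, hy'] at h2
    have h3 := (T.isHST i).nonneg u (hstCenter (T.ρ i) B.1)
    have h4 := (T.isHST i).nonneg v (hstCenter (T.ρ i) B.1)
    have h5 := max_le_add_of_nonneg h3 h4
    have h6 := le_max_right T.δ (T.ρ i u (hstCenter (T.ρ i) B.1))
    have h7 := le_max_right T.δ (T.ρ i v (hstCenter (T.ρ i) B.1))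
    linarith
  | leaf x => exact h.elim

open scoped Classical in
/-- The point of `B` which a unit flow towards `x` aims at. -/
def aim (i : T.ι) (B : {B : Finset X // IsHSTCluster (T.ρ i) B}) (x : X) : X :=
  if x ∈ B.1 then x else hstCenter (T.ρ i) B.1

theorem aim_mem (i : T.ι) (B : {B : Finset X // IsHSTCluster (T.ρ i) B}) (x : X) :
    aim i B x ∈ B.1 := by
  unfold aim
  split_ifs with h
  · exact h
  · exact hstCenter_mem i B

open scoped Classical in
/-- The policy that picks a hierarchy at random and then follows the clusters of `x`. -/
def ref (x : X) : T.Node → T.Node → ℝ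
  | .root, .cluster i B => if B.1 = Finset.univ then T.w i else 0
  | .root, _ => 0
  | .cluster i B, b => if b = child i B (aim i B x) then 1 else 0
  | .leaf _, _ => 0

theorem sum_ref_mul_cluster (x : X) (i : T.ι) (B : {B : Finset X // IsHSTCluster (T.ρ i) B})
    (f : T.Node → ℝ) : ∑ b ∈ T.markedDAG.out (Node.cluster i B : T.Node),
      ref x (.cluster i B) b * f b = f (child i B (aim i B x)) := by
  classical
  simp only [ref, ite_mul, one_mul, zero_mul]
  rw [Finset.sum_ite_eq', if_pos (mem_out_cluster.2 ⟨_, aim_mem i B x, rfl⟩)]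

theorem sum_ref_mul_root (x : X) (f : T.Node → ℝ) :
    ∑ b ∈ T.markedDAG.out (Node.root : T.Node), ref x .root b * f b =
      ∑ i, T.w i * f (.cluster i ⟨Finset.univ, .univ⟩) := by
  rw [sum_out_root]
  simp [ref]

theorem ref_mem (x : X) : (ref x : T.Node → T.Node → ℝ) ∈ T.markedDAG.policies := by
  classical
  refine ⟨fun a b => ?_, fun a b h => ?_, fun a ha => ?_⟩
  · cases a with
    | root =>
      cases b with
      | cluster i B =>
        simp only [ref]
        split_ifs
        exacts [T.w_nonneg i, le_rfl]
      | _ => exact le_rfl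
    | cluster i B =>
      simp only [ref]
      split_ifs <;> norm_num
    | leaf x => exact le_rfl
  · cases a with
    | root =>
      cases b with
      | cluster i B =>
        simp only [ref]
        rw [if_neg]
        intro hB
        exact h ⟨i, congrArg _ (Subtype.ext hB)⟩
      | _ => rfl
    | cluster i B =>
      simp only [ref]
      rw [if_neg]
      rintro rfl
      exact h ⟨_, aim_mem i B x, rfl⟩
    | leaf x => rfl
  · cases a with
    | root => simpa [T.w_sum] using sum_ref_mul_root (T := T) x fun _ => (1 : ℝ)
    | cluster i B => simpa using sum_ref_mul_cluster x i B fun _ => (1 : ℝ)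
    | leaf y => exact absurd ⟨y, rfl⟩ ha

theorem sinkMass_ref {x y : X} (hxy : y ≠ x) : T.markedDAG.sinkMass (ref x) y = 0 := by
  classical
  let φ : T.Node → ℝ := fun v => if x ∈ v.pts then 0 else 1
  have hφ0 : ∀ v, 0 ≤ φ v := fun v => by
    simp only [φ]
    split_ifs <;> norm_num
  have hφ1 : ∀ v, φ v ≤ 1 := fun v => by
    simp only [φ]
    split_ifs <;> norm_num
  have hmem := ref_mem (T := T) x
  have h := T.markedDAG.sum_sinkMass_add_sum_inner (ref x) φ
  have hroot : φ T.markedDAG.root = 0 := if_pos (Finset.mem_univ x)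
  have hin : 0 ≤ ∑ a ∈ T.markedDAG.inner, T.markedDAG.vertexFlow (ref x) a *
      (φ a - ∑ b ∈ T.markedDAG.out a, ref x a b * φ b) := by
    refine Finset.sum_nonneg fun a ha =>
      mul_nonneg (T.markedDAG.vertexFlow_nonneg hmem a) (sub_nonneg.2 ?_)
    cases a with
    | root =>
      rw [sum_ref_mul_root]
      refine (Finset.sum_eq_zero fun i _ => ?_).trans_le (hφ0 _)
      rw [show φ (.cluster i ⟨Finset.univ, .univ⟩) = 0 from if_pos (Finset.mem_univ x), mul_zero]
    | cluster i B =>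
      rw [sum_ref_mul_cluster]
      by_cases hx : x ∈ B.1
      · have : φ (child i B (aim i B x)) = 0 := by
          unfold aim
          rw [if_pos hx]
          exact if_pos (mem_pts_child hx)
        rw [this]
        exact hφ0 _
      · rw [show φ (.cluster i B) = 1 from if_neg hx]
        exact hφ1 _
    | leaf z => exact absurd ⟨z, rfl⟩ (T.markedDAG.mem_inner.1 ha)
  have hle := Finset.single_le_sum
    (f := fun z => T.markedDAG.sinkMass (ref x) z * φ (T.markedDAG.sink z))
    (fun z _ => mul_nonneg (T.markedDAG.sinkMass_nonneg hmem z) (hφ0 _)) (Finset.mem_univ y)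
  have hy : φ (T.markedDAG.sink y) = 1 :=
    if_neg fun h : x ∈ ({y} : Finset X) => hxy (Finset.mem_singleton.1 h).symm
  simp only [hy, mul_one] at hle
  exact le_antisymm (by linarith) (T.markedDAG.sinkMass_nonneg hmem y)

open scoped Classical in
/-- A bound for the cost of moving the flow that reaches a vertex from `x` to `y`. -/
def shiftBound (x y : X) : T.Node → ℝ
  | .root => 3 * ∑ i, T.w i * T.ρ i x y
  | .cluster i B => if x ∈ B.1 ∧ y ∈ B.1 then 3 * T.ρ i x y else 4 * radius i B.1
  | .leaf _ => 0

open scoped Classical in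
theorem shiftBound_cluster (x y : X) (i : T.ι) (B : {B : Finset X // IsHSTCluster (T.ρ i) B}) :
    shiftBound x y (.cluster i B : T.Node) =
      if x ∈ B.1 ∧ y ∈ B.1 then 3 * T.ρ i x y else 4 * radius i B.1 := rfl

theorem shiftBound_nonneg (x y : X) (a : T.Node) : 0 ≤ shiftBound x y a := by
  cases a with
  | root =>
    exact mul_nonneg (by norm_num)
      (Finset.sum_nonneg fun i _ => mul_nonneg (T.w_nonneg i) ((T.isHST i).nonneg x y))
  | cluster i B =>
    have h1 := (T.isHST i).nonneg x y
    have h2 := radius_nonneg B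
    simp only [shiftBound]
    split_ifs <;> linarith
  | leaf z => exact le_rfl

theorem shiftBound_le_width (x y : X) {a : T.Node} (ha : a ≠ .root) :
    shiftBound x y a ≤ 6 * width a := by
  cases a with
  | root => exact absurd rfl ha
  | cluster i B =>
    have h2 := radius_nonneg B
    simp only [shiftBound, width]
    split_ifs with h
    · have hr := (radius_spec i ⟨x, h.1⟩).1
      have h3 := hr x h.1
      have h4 := hr y h.2
      have h5 := (T.isHST i).ultra x (hstCenter (T.ρ i) B.1) y
      rw [(T.isHST i).symm (hstCenter (T.ρ i) B.1) y] at h5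
      have := max_le h3 h4
      linarith
    · linarith
  | leaf z => simp [shiftBound, width]

theorem shiftBound_child_le {i : T.ι} {B : {B : Finset X // IsHSTCluster (T.ρ i) B}} {u x y : X}
    (hx : x ∈ (child i B u).pts) (hy : y ∈ (child i B u).pts) :
    shiftBound x y (child i B u) ≤ 3 * T.ρ i x y := by
  have h := (T.isHST i).nonneg x y
  revert hx hy
  unfold child
  split_ifs
  · intro hx hy
    simp only [shiftBound]
    rw [if_pos ⟨hx, hy⟩]
  · intro _ _
    simp only [shiftBound]
    linarith

theorem len_child_le_dist {i : T.ι} {B : {B : Finset X // IsHSTCluster (T.ρ i) B}} {x y : X}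
    (hx : x ∈ B.1) (hy : y ∈ B.1) (hne : child i B x ≠ child i B y) :
    len i B.1 (child i B y).pts ≤ T.ρ i x y := by
  rw [len_child hy]
  refine max_le ?_ ((T.isHST i).dist_center_le hx fun h => hne ?_)
  · exact (T.δ_le x y fun h => hne (h ▸ rfl)).trans ((T.isHST i).dist_le x y)
  · refine child_eq_of_mem hy ?_
    rw [pts_child hy]
    exact h.subset (self_mem_hstCell hx)

theorem sum_shift_cluster_le (x y : X) (i : T.ι) (B : {B : Finset X // IsHSTCluster (T.ρ i) B}) :
    ∑ b ∈ T.markedDAG.out (Node.cluster i B : T.Node),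
        arcLength (.cluster i B) b * |ref y (.cluster i B) b - ref x (.cluster i B) b| +
      shiftBound x y (child i B (aim i B x)) ≤ shiftBound x y (.cluster i B) := by
  classical
  have hxB := aim_mem i B x
  have hyB := aim_mem i B y
  have hr := radius_nonneg B
  have hψ := shiftBound_le_width x y (child_ne_root (i := i) (B := B) (y := aim i B x))
  have hW : 100 * width (child i B (aim i B x)) ≤ len i B.1 (child i B (aim i B x)).pts :=
    width_le (a := .cluster i B) ⟨_, hxB, rfl⟩
  have hlx := len_child_le hxB
  have hly := len_child_le hyB
  have hwn := width_nonneg (child i B (aim i B x))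
  simp only [ref]
  by_cases hc : child i B (aim i B x) = child i B (aim i B y)
  · rw [Finset.sum_eq_zero fun b _ => by rw [hc, sub_self, abs_zero, mul_zero], zero_add]
    rw [shiftBound_cluster]
    split_ifs with h
    · rw [aim, aim, if_pos h.1, if_pos h.2] at hc
      rw [aim, if_pos h.1]
      exact shiftBound_child_le (mem_pts_child h.1) (hc ▸ mem_pts_child h.2)
    · linarith
  · have hsum := sum_mul_abs_ite_sub_ite_le (f := arcLength (.cluster i B : T.Node))
      (fun b hb => (arcLength_pos (T.markedDAG.mem_out.1 hb)).le)
      (mem_out_cluster.2 ⟨_, hxB, rfl⟩) (mem_out_cluster.2 ⟨_, hyB, rfl⟩)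
    simp only [arcLength] at hsum ⊢
    refine (add_le_add hsum hψ).trans ?_
    rw [shiftBound_cluster]
    split_ifs with h
    · rw [aim, aim, if_pos h.1, if_pos h.2] at hc
      have h1 := len_child_le_dist h.1 h.2 hc
      have h2 := len_child_le_dist h.2 h.1 (Ne.symm hc)
      rw [(T.isHST i).symm y x] at h2
      simp only [aim, if_pos h.1, if_pos h.2] at hW ⊢
      have h3 := (T.isHST i).nonneg x y
      linarith
    · linarith

theorem shift_ref_le (x y : X) :
    T.markedDAG.shift (ref x) (ref y) ≤ 3 * ∑ i, T.w i * T.ρ i x y := by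
  have hmem := ref_mem (T := T) x
  have h := T.markedDAG.sum_sinkMass_add_sum_inner (ref x) (shiftBound x y)
  have h0 : 0 ≤ ∑ z, T.markedDAG.sinkMass (ref x) z * shiftBound x y (T.markedDAG.sink z) :=
    Finset.sum_nonneg fun z _ =>
      mul_nonneg (T.markedDAG.sinkMass_nonneg hmem z) (shiftBound_nonneg x y _)
  rw [MarkedDAG.shift_eq_sum_inner]
  refine le_trans (Finset.sum_le_sum fun a ha => ?_) ((le_add_of_nonneg_left h0).trans h.le)
  refine mul_le_mul_of_nonneg_left ?_ (T.markedDAG.vertexFlow_nonneg hmem a)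
  rw [le_sub_iff_add_le]
  cases a with
  | root =>
    rw [sum_ref_mul_root]
    have hz : ∑ b ∈ T.markedDAG.out (Node.root : T.Node), T.markedDAG.ω .root b *
        |ref y .root b - ref x .root b| = 0 := Finset.sum_eq_zero fun b _ => by
      have : ref y (.root : T.Node) b = ref x .root b := by cases b <;> rfl
      rw [this, sub_self, abs_zero, mul_zero]
    rw [hz, zero_add]
    simp only [shiftBound, Finset.mem_univ, and_self, if_true, Finset.mul_sum]
    exact Finset.sum_le_sum fun i _ => by linarith
  | cluster i B =>
    rw [sum_ref_mul_cluster]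
    exact sum_shift_cluster_le x y i B
  | leaf z => exact absurd ⟨z, rfl⟩ (T.markedDAG.mem_inner.1 ha)

variable (T) in
/-- The marked DAG of a family of small average distortion is adapted to the metric. -/
def adapted {K σ : ℝ}
    (hK : 1 + Real.log (Fintype.card T.ι) + 3 * Real.log (Fintype.card X) ≤ K)
    (hσ : ∀ x y, 3 * ∑ i, T.w i * T.ρ i x y ≤ σ * dist x y) : T.markedDAG.Adapted K σ where
  W := width
  W_nonneg := width_nonneg
  ω_le := fun _ _ h => arcLength_le h
  le_ω := fun _ _ h => width_le h
  height := height
  height_nonneg := height_nonneg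
  height_le := fun _ _ h => height_le h
  height_root := hK
  S := fun v => v.pts
  mem_S_sink := fun x => Finset.mem_coe.2 (Finset.mem_singleton_self x)
  S_mono := fun _ _ h => Finset.coe_subset.2 (pts_mono h)
  dist_le := fun _ _ _ h h' hne _ hx _ hy => dist_le h h' hne hx hy
  ref := ref
  ref_mem := ref_mem
  sinkMass_ref := fun _ _ h => sinkMass_ref h
  shift_ref_le := fun x y => (shift_ref_le x y).trans (hσ x y)

end HSTFamily

end

theorem mainTheorem1 :
    ∃ C : ℝ, 0 < C ∧
      ∀ (X : Type u) [MetricSpace X] [Fintype X], 1 < Fintype.card X →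
        ∃ (D : MarkedDAG X) (κ ε : ℝ), 0 < κ ∧ 0 < ε ∧
          ∀ p₀ ∈ D.policies, ∀ N : (X → ℝ≥0) → ℕ,
            (∀ (c : X → ℝ≥0) (x : X), (c x : ℝ) ≤ N c * ε) →
            ∃ R : RandomizedAlgorithm X,
              D.IsPlayedBy R κ N p₀ ∧
              R.IsCompetitive (C * Real.log (Fintype.card X) ^ 2) ∧
              R.IsRefinedCompetitive 1 (C * Real.log (Fintype.card X) ^ 2) := by
  refine ⟨48 * 6000 * 9 + 3, by norm_num, fun X _ _ hX => ?_⟩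
  have : Nonempty X := Fintype.card_pos_iff.1 (by omega)
  obtain ⟨ι, _, ρ, w, hι, hρ, hw, hw1, havg⟩ := exists_hst_family X hX
  obtain ⟨δ, hδ, hδ'⟩ := exists_pos_le_dist X
  let T : HSTFamily X :=
    { ι := ι, ρ := ρ, isHST := hρ, w := w, w_nonneg := hw, w_sum := hw1, δ := δ, δ_pos := hδ
      δ_le := hδ', one_lt_card := hX }
  have hn : (2 : ℝ) ≤ Fintype.card X := by exact_mod_cast hX
  set L := Real.log (Fintype.card X) with hL
  have hL2 : Real.log 2 ≤ L := Real.log_le_log two_pos hn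
  have hlog2 := Real.log_two_gt_d9
  have hcard : Real.log (Fintype.card ι) ≤ 3 * L := by
    have hpos : (0 : ℝ) < Fintype.card ι := by
      have : Nonempty ι := T.exists_index
      exact_mod_cast Fintype.card_pos
    have hle : (Fintype.card ι : ℝ) ≤ (Fintype.card X : ℝ) ^ 3 := by
      have : (Fintype.card ι : ℝ) ≤ (Fintype.card X : ℝ) ^ 2 + 1 := by exact_mod_cast hι
      nlinarith
    have := Real.log_le_log hpos hle
    rwa [Real.log_pow, Nat.cast_ofNat] at this
  have A : T.markedDAG.Adapted (9 * L) (6000 * L) := T.adapted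
    (by
      change 1 + Real.log (Fintype.card ι) + 3 * L ≤ 9 * L
      linarith)
    (fun x y => by
      have := havg x y
      change 3 * ∑ i, w i * ρ i x y ≤ _
      linarith)
  obtain ⟨κ, ε, hκ, hε, hR⟩ := A.exists_competitive (by linarith) (by linarith)
  refine ⟨T.markedDAG, κ, ε, hκ, hε, fun p₀ hp₀ N hN => ?_⟩
  obtain ⟨R, hplay, hcomp⟩ := hR p₀ hp₀ N hN
  exact ⟨R, hplay, hcomp _ (by nlinarith)⟩
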